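/- **Setting.** Let $V$ be a finite-dimensional Euclidean space and $S=S_0\oplus S_1$ a metric $\mathbb Z_2$-graded $C\ell(V)$-module: Clifford multiplication $\mu$ is odd, $v\cdot w+w\cdot v=-2\langle v,w\rangle$, $S_0\perp S_1$, each $\mu(v,\cdot)$ is skew. Let $\mathscr H\cong\mathbb R^3\oplus V\oplus S_0\oplus S_1$ be the space of Hermitian matrices $$X=\begin{pmatrix}x_1&s_0&s_1\\ s_0^*&x_2&v\\ s_1^*&v^*&x_3\end{pmatrix}$$ of the associated special $T$-algebra, with scalar product $\langle X,Y\rangle=\operatorname{tr}(X\cdot Y)$, let $\mathscr V=\{A\cdot A^*\}$ and $\mathscr V^*=\{A^*\cdot A\}$ ($A$ upper triangular with positive diagonal) be the special Vinberg cone and its dual cone, and put $$d_{\mathscr V}(X)=x_1x_2x_3-x_1|v|^2-x_2|s_1|^2-x_3|s_0|^2+2\langle\mu(v,s_0),s_1\rangle,\qquad \mathfrak d_{\mathscr V}(X)=\frac{|s_0|^2|s_1|^2-|s_0^\flat\cdot s_1|^2}{x_1},$$ where $s_0^\flat\cdot s_1\in V$ is defined by $\langle s_0^\flat\cdot s_1,v\rangle=\langle\mu(v,s_0),s_1\rangle$.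 Fix linear coordinates $\mathscr H\cong\mathbb R^n$ and $k>0$, and let $d=k\,d_{\mathscr V}$, assumed irreducible. (These are the cubics that determine the homogeneous scalar manifolds $\mathscr S=\mathbb R^n+i\mathscr V$.) For a covector $w=\langle X,\cdot\rangle$ put $$d'(w)=\tfrac{27}{k}\,d_{\mathscr V}(X),\qquad \mathfrak d'(w)=\tfrac{27}{k}\,\mathfrak d_{\mathscr V}(X),$$ $h_a=\frac13\partial_ad$, $h'^a=\frac13\partial d'/\partial w_a$, $\mathfrak h'^a=\frac13\partial\mathfrak d'/\partial w_a$. This normalization is the one for which $(h'+\mathfrak h')(h(X))=d(X)X$. **Black holes.** Let $\mathscr K=-\log 8d(\operatorname{Im}z)$ on $\mathscr S$, $g_{a\bar b}=\partial_a\partial_{\bar b}\mathscr K$, $F(X)=d(X^1,\dots,X^n)/X^0$, $F_I=\partial F/\partial X^I$, $Z=e^{\mathscr K/2}(p^IF_I-q_IX^I)$ at $X=(1,z)$, $Z_a=\partial_aZ+\frac12(\partial_a\mathscr K)Z$ and $V_{BH}=|Z|^2+g^{a\bar b}Z_a\overline{Z_b}$. An extremal black hole with charges $(p^I,q_I)$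 is a metric $$-e^{2U(r)}dt^2+e^{-2U(r)}\big(dr^2+r^2(d\vartheta^2+\sin^2\vartheta\,d\varphi^2)\big)$$ with scalar fields $z(r)\in\mathscr S$, both of class $C^2$ on $r>0$, solving in the variable $\tau=1/r$ the Euler–Lagrange equations of $\dot U^2+g_{a\bar b}\dot z^a\dot{\bar z}^b+e^{2U}V_{BH}$ together with the constraint $\dot U^2+g_{a\bar b}\dot z^a\dot{\bar z}^b=e^{2U}V_{BH}$, with $U\to0$ as $r\to\infty$, $r^2e^{-2U}\to m^2$ for some $m>0$, and $z\to z_o\in\mathscr S$ as $r\to0^+$. Its horizon area is $A_H=4\pi m^2$, its entropy is $S=A_H/4$, its (Bertotti–Robinson) mass is $m$; it is BPS if $m=|Z_o|$, $Z_o=Z(p,q,z_o)$. **Theorem.** Write $\alpha=h(p)-\frac13p^0q$ and, for $p^0\neq0$, $$I_4=\frac4{(p^0)^2}\Big((1+\mathfrak a)\sqrt{d'(\alpha)}+\mathfrak b\Big)^2-\frac1{(p^0)^2}\Big((q_0p^0+\langle q,p\rangle)p^0-2d(p)\Big)^2,$$ $$\mathfrak a=\frac{\sqrt{d'(\alpha)}}{\sqrt{d'(\alpha)+\mathfrak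 d'(\alpha)}}-1,\qquad \mathfrak b=\frac{\langle\alpha,\mathfrak h'(\alpha)\rangle}{\sqrt{d'(\alpha)+\mathfrak d'(\alpha)}},$$ where square roots of negative numbers are principal complex square roots. Let $\alpha_1$ be the $x_1$-entry of the Hermitian matrix representing $\alpha$. 1. For every BPS extremal black hole with $p^0\ne0$ one has $\alpha_1>0$, $d'(\alpha)+\mathfrak d'(\alpha)>0$, $I_4$ is real and positive, and $S=\pi\sqrt{I_4}$. 2. On $\{p^0\ne0,\ \alpha_1\neq0\}$, $I_4$ is (the restriction of) a real rational function of the charges, homogeneous of degree $4$: a quotient of two homogeneous polynomials whose degrees differ by $4$, with non-vanishing denominator there. 3. If the cone is symmetric, i.e. some linear automorphism of $\mathscr H$ maps $\mathscr V$ onto $\mathscr V^*$, then $\mathfrak d'\equiv0$ and, for all charges with $p^0\neq0$, $$I_4=-(q_0p^0+\langle q,p\rangle)^2+4q_0d(p)-\tfrac4{27}p^0d'(q)+\tfrac43\langle h(p),h'(q)\rangle.$$ -/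

import Mathlib

open scoped Topology

noncomputable section

namespace EntropyFormula

section Riesz

variable {E : Type*} [NormedAddCommGroup E] [InnerProductSpace ℝ E] [FiniteDimensional ℝ E]

/-- The vector representing a linear form on a Euclidean space. -/
def riesz (l : E →ₗ[ℝ] ℝ) : E :=
  haveI : CompleteSpace E := FiniteDimensional.complete ℝ E
  (InnerProductSpace.toDual ℝ E).symm (LinearMap.toContinuousLinearMap l)

theorem inner_riesz (l : E →ₗ[ℝ] ℝ) (x : E) : inner ℝ (riesz l) x = l x := by
  have : CompleteSpace E := FiniteDimensional.complete ℝ E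
  simp [riesz]

end Riesz

/-! ### Special T-algebras and special Vinberg cones -/

/-- A metric `ℤ/2`-graded Clifford module `S = S₀ ⊕ S₁` over the Euclidean space `V`: Clifford
multiplication is odd, satisfies `v · w + w · v = -2 ⟪v, w⟫`, and every `μ(v, ·)` is skew for the
Euclidean product of `S` (for which `S₀ ⟂ S₁`). -/
structure MetricCliffordModule (V S₀ S₁ : Type*)
    [NormedAddCommGroup V] [InnerProductSpace ℝ V]
    [NormedAddCommGroup S₀] [InnerProductSpace ℝ S₀]
    [NormedAddCommGroup S₁] [InnerProductSpace ℝ S₁] where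
  mul₀ : V →ₗ[ℝ] S₀ →ₗ[ℝ] S₁
  mul₁ : V →ₗ[ℝ] S₁ →ₗ[ℝ] S₀
  clifford₀ : ∀ v w s, mul₁ v (mul₀ w s) + mul₁ w (mul₀ v s) = (-2 * inner ℝ v w) • s
  clifford₁ : ∀ v w s, mul₀ v (mul₁ w s) + mul₀ w (mul₁ v s) = (-2 * inner ℝ v w) • s
  skew : ∀ v s t, inner ℝ (mul₀ v s) t = - inner ℝ s (mul₁ v t)

/-- Elements of the special T-algebra, as `3 × 3` matrices
`(x₁ s₀ s₁ ; t₀* x₂ v ; t₁* w* x₃)`; the entries below the diagonal lie in dual Euclidean spaces,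
and are recorded through the vectors that represent them. -/
@[ext] structure TMat (V S₀ S₁ : Type*) where
  x₁ : ℝ
  x₂ : ℝ
  x₃ : ℝ
  s₀ : S₀
  s₁ : S₁
  v : V
  t₀ : S₀
  t₁ : S₁
  w : V

namespace TMat

variable {V S₀ S₁ : Type*}

/-- The involution `X ↦ X*`. -/
def star (X : TMat V S₀ S₁) : TMat V S₀ S₁ :=
  ⟨X.x₁, X.x₂, X.x₃, X.t₀, X.t₁, X.w, X.s₀, X.s₁, X.v⟩

def trace (X : TMat V S₀ S₁) : ℝ := X.x₁ + X.x₂ + X.x₃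

/-- Upper triangular matrices with positive diagonal: the Vinberg triangular group `G`. -/
def IsUpperPos [Zero V] [Zero S₀] [Zero S₁] (A : TMat V S₀ S₁) : Prop :=
  0 < A.x₁ ∧ 0 < A.x₂ ∧ 0 < A.x₃ ∧ A.t₀ = 0 ∧ A.t₁ = 0 ∧ A.w = 0

end TMat

/-- The space `ℋ ≅ ℝ³ ⊕ V ⊕ S₀ ⊕ S₁` of Hermitian matrices, `X = (x₁, x₂, x₃, v, s₀, s₁)`. -/
abbrev Herm (V S₀ S₁ : Type*) : Type _ := ℝ × ℝ × ℝ × V × S₀ × S₁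

/-- The Hermitian matrix `(x₁ s₀ s₁ ; s₀* x₂ v ; s₁* v* x₃)`. -/
def Herm.toMat {V S₀ S₁ : Type*} : Herm V S₀ S₁ → TMat V S₀ S₁
  | (x₁, x₂, x₃, v, s₀, s₁) => ⟨x₁, x₂, x₃, s₀, s₁, v, s₀, s₁, v⟩

theorem Herm.star_toMat {V S₀ S₁ : Type*} (X : Herm V S₀ S₁) : X.toMat.star = X.toMat := rfl

theorem TMat.exists_toMat_of_star_eq {V S₀ S₁ : Type*} (Y : TMat V S₀ S₁) (h : Y.star = Y) :
    ∃ X : Herm V S₀ S₁, X.toMat = Y := by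
  refine ⟨(Y.x₁, Y.x₂, Y.x₃, Y.v, Y.s₀, Y.s₁), ?_⟩
  have h₀ : Y.s₀ = Y.t₀ := congrArg TMat.t₀ h
  have h₁ : Y.s₁ = Y.t₁ := congrArg TMat.t₁ h
  have h₂ : Y.v = Y.w := congrArg TMat.w h
  ext <;> simp [Herm.toMat, h₀, h₁, h₂]

namespace MetricCliffordModule

variable {V S₀ S₁ : Type*}
  [NormedAddCommGroup V] [InnerProductSpace ℝ V] [FiniteDimensional ℝ V]
  [NormedAddCommGroup S₀] [InnerProductSpace ℝ S₀] [FiniteDimensional ℝ S₀]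
  [NormedAddCommGroup S₁] [InnerProductSpace ℝ S₁] [FiniteDimensional ℝ S₁]

set_option linter.unusedSectionVars false

/-- The vector `s₀♭ · s₁ ∈ V`, given by `⟪s₀♭ · s₁, v⟫ = ⟪μ(v, s₀), s₁⟫`. -/
def vec (M : MetricCliffordModule V S₀ S₁) (s₀ : S₀) (s₁ : S₁) : V :=
  riesz ((innerₛₗ ℝ s₁).comp (M.mul₀.flip s₀))

theorem inner_vec (M : MetricCliffordModule V S₀ S₁) (s₀ : S₀) (s₁ : S₁) (v : V) :
    inner ℝ (M.vec s₀ s₁) v = inner ℝ (M.mul₀ v s₀) s₁ := by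
  rw [vec, inner_riesz]
  simp [real_inner_comm]

/-- The vector `s₁ · v♭ ∈ S₀`, given by `⟪s₁ · v♭, s₀⟫ = ⟪μ(v, s₀), s₁⟫`. -/
def adj (M : MetricCliffordModule V S₀ S₁) (v : V) (s₁ : S₁) : S₀ :=
  riesz ((innerₛₗ ℝ s₁).comp (M.mul₀ v))

theorem inner_adj (M : MetricCliffordModule V S₀ S₁) (v : V) (s₀ : S₀) (s₁ : S₁) :
    inner ℝ (M.adj v s₁) s₀ = inner ℝ (M.mul₀ v s₀) s₁ := by
  rw [adj, inner_riesz]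
  simp [real_inner_comm]

/-- The product of the special T-algebra: the matrix product whose entrywise products are
scalar multiplication, scalar products, Clifford multiplication and its transposes. -/
def mul (M : MetricCliffordModule V S₀ S₁) (X Y : TMat V S₀ S₁) : TMat V S₀ S₁ where
  x₁ := X.x₁ * Y.x₁ + inner ℝ X.s₀ Y.t₀ + inner ℝ X.s₁ Y.t₁
  x₂ := inner ℝ X.t₀ Y.s₀ + X.x₂ * Y.x₂ + inner ℝ X.v Y.w
  x₃ := inner ℝ X.t₁ Y.s₁ + inner ℝ X.w Y.v + X.x₃ * Y.x₃
  s₀ := X.x₁ • Y.s₀ + Y.x₂ • X.s₀ + M.adj Y.w X.s₁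
  s₁ := X.x₁ • Y.s₁ + M.mul₀ Y.v X.s₀ + Y.x₃ • X.s₁
  v := M.vec X.t₀ Y.s₁ + X.x₂ • Y.v + Y.x₃ • X.v
  t₀ := Y.x₁ • X.t₀ + X.x₂ • Y.t₀ + M.adj X.v Y.t₁
  t₁ := Y.x₁ • X.t₁ + M.mul₀ X.w Y.t₀ + X.x₃ • Y.t₁
  w := M.vec Y.s₀ X.t₁ + Y.x₂ • X.w + X.x₃ • Y.w

/-- The special Vinberg cone `𝒱 = {A · A* : A ∈ G} ⊆ ℋ`. -/
def cone (M : MetricCliffordModule V S₀ S₁) : Set (Herm V S₀ S₁) :=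
  {X | ∃ A : TMat V S₀ S₁, A.IsUpperPos ∧ X.toMat = M.mul A A.star}

/-- The dual cone `𝒱* = {A* · A : A ∈ G} ⊆ ℋ`. -/
def dualCone (M : MetricCliffordModule V S₀ S₁) : Set (Herm V S₀ S₁) :=
  {X | ∃ A : TMat V S₀ S₁, A.IsUpperPos ∧ X.toMat = M.mul A.star A}

/-- The cone is self-adjoint (symmetric): some linear automorphism of `ℋ` maps `𝒱` onto `𝒱*`. -/
def IsSelfAdjoint (M : MetricCliffordModule V S₀ S₁) : Prop :=
  ∃ L : Herm V S₀ S₁ ≃ₗ[ℝ] Herm V S₀ S₁, L '' M.cone = M.dualCone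

/-- The Euclidean product `⟪X, Y⟫ = tr (X · Y)` of `ℋ`. -/
def form (M : MetricCliffordModule V S₀ S₁) (X Y : Herm V S₀ S₁) : ℝ :=
  (M.mul X.toMat Y.toMat).trace

/-- The invariant cubic polynomial of the cone, with value `1` at the identity matrix. -/
def dV (M : MetricCliffordModule V S₀ S₁) : Herm V S₀ S₁ → ℝ
  | (x₁, x₂, x₃, v, s₀, s₁) =>
    x₁ * x₂ * x₃ - x₁ * ‖v‖ ^ 2 - x₂ * ‖s₁‖ ^ 2 - x₃ * ‖s₀‖ ^ 2 + 2 * inner ℝ (M.mul₀ v s₀) s₁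

/-- The rational correction `𝔡`: the dual invariant cubic rational function is `d + 𝔡`. -/
def frakdV (M : MetricCliffordModule V S₀ S₁) : Herm V S₀ S₁ → ℝ
  | (x₁, _, _, _, s₀, s₁) => (‖s₁‖ ^ 2 * ‖s₀‖ ^ 2 - ‖M.vec s₀ s₁‖ ^ 2) / x₁

end MetricCliffordModule

section Sharp

variable {V S₀ S₁ : Type*}
  [NormedAddCommGroup V] [InnerProductSpace ℝ V] [FiniteDimensional ℝ V]
  [NormedAddCommGroup S₀] [InnerProductSpace ℝ S₀] [FiniteDimensional ℝ S₀]
  [NormedAddCommGroup S₁] [InnerProductSpace ℝ S₁] [FiniteDimensional ℝ S₁]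

/-- The Hermitian matrix `l♯` with `tr (l♯ · Y) = l Y`. -/
def sharp (l : Herm V S₀ S₁ →ₗ[ℝ] ℝ) : Herm V S₀ S₁ :=
  (l (1, 0, 0, 0, 0, 0), l (0, 1, 0, 0, 0, 0), l (0, 0, 1, 0, 0, 0),
    (1 / 2 : ℝ) • riesz (l ∘ₗ LinearMap.inr ℝ ℝ _ ∘ₗ LinearMap.inr ℝ ℝ _ ∘ₗ
      LinearMap.inr ℝ ℝ _ ∘ₗ LinearMap.inl ℝ V _),
    (1 / 2 : ℝ) • riesz (l ∘ₗ LinearMap.inr ℝ ℝ _ ∘ₗ LinearMap.inr ℝ ℝ _ ∘ₗ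
      LinearMap.inr ℝ ℝ _ ∘ₗ LinearMap.inr ℝ V _ ∘ₗ LinearMap.inl ℝ S₀ _),
    (1 / 2 : ℝ) • riesz (l ∘ₗ LinearMap.inr ℝ ℝ _ ∘ₗ LinearMap.inr ℝ ℝ _ ∘ₗ
      LinearMap.inr ℝ ℝ _ ∘ₗ LinearMap.inr ℝ V _ ∘ₗ LinearMap.inr ℝ S₀ _))

theorem form_sharp (M : MetricCliffordModule V S₀ S₁) (l : Herm V S₀ S₁ →ₗ[ℝ] ℝ)
    (Y : Herm V S₀ S₁) : M.form (sharp l) Y = l Y := by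
  obtain ⟨y₁, y₂, y₃, v, s₀, s₁⟩ := Y
  have hY : ((y₁, y₂, y₃, v, s₀, s₁) : Herm V S₀ S₁) =
      y₁ • (1, 0, 0, 0, 0, 0) + y₂ • (0, 1, 0, 0, 0, 0) + y₃ • (0, 0, 1, 0, 0, 0)
        + (0, 0, 0, v, 0, 0) + (0, 0, 0, 0, s₀, 0) + (0, 0, 0, 0, 0, s₁) := by
    simp
  have hl : l (y₁, y₂, y₃, v, s₀, s₁) = y₁ * l (1, 0, 0, 0, 0, 0) + y₂ * l (0, 1, 0, 0, 0, 0)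
      + y₃ * l (0, 0, 1, 0, 0, 0) + l (0, 0, 0, v, 0, 0) + l (0, 0, 0, 0, s₀, 0)
      + l (0, 0, 0, 0, 0, s₁) := by
    rw [hY]
    simp only [map_add, map_smul, smul_eq_mul]
  rw [hl]
  simp only [MetricCliffordModule.form, sharp, Herm.toMat, MetricCliffordModule.mul, TMat.trace,
    real_inner_smul_left, inner_riesz, LinearMap.comp_apply, LinearMap.inl_apply,
    LinearMap.inr_apply]
  have hv : l (0, 0, 0, v, 0) = l (0, 0, 0, v, 0, 0) := rfl
  rw [hv]
  ring

end Sharp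

/-! ### Cubic polynomials, their duals and the quadratic maps, in linear coordinates -/

section Cubic

variable {ι : Type*} [Fintype ι] [DecidableEq ι]

/-- The quadratic map `h_a(x) = (1/3) ∂d/∂x^a = d_{abc} x^b x^c` of a cubic polynomial. -/
def hMap (d : MvPolynomial ι ℝ) (x : ι → ℝ) : ι → ℝ :=
  fun a => MvPolynomial.eval x (MvPolynomial.pderiv a d) / 3

/-- The map `w ↦ (1/3) ∂f/∂w_a` of a function `f` of covectors. -/
def gradThird (f : (ι → ℝ) → ℝ) (w : ι → ℝ) : ι → ℝ :=
  fun a => (1 / 3) * deriv (fun s : ℝ => f (w + s • Pi.single a 1)) 0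

variable {V S₀ S₁ : Type*}
  [NormedAddCommGroup V] [InnerProductSpace ℝ V] [FiniteDimensional ℝ V]
  [NormedAddCommGroup S₀] [InnerProductSpace ℝ S₀] [FiniteDimensional ℝ S₀]
  [NormedAddCommGroup S₁] [InnerProductSpace ℝ S₁] [FiniteDimensional ℝ S₁]

/-- The Hermitian matrix that represents the covector with components `w_a` in the linear
coordinates `φ`. -/
def sharpCoord (φ : (ι → ℝ) ≃ₗ[ℝ] Herm V S₀ S₁) (w : ι → ℝ) : Herm V S₀ S₁ :=
  sharp (Fintype.linearCombination ℝ w ∘ₗ φ.symm.toLinearMap)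

/-- The polynomial part `d'` of the dual invariant function canonically associated with
`d = k d_𝒱`. The factor `27 / k` is the one for which the quadratic maps satisfy
`(h' + 𝔥')(h(X)) = d(X) X`. -/
def dDual (M : MetricCliffordModule V S₀ S₁) (φ : (ι → ℝ) ≃ₗ[ℝ] Herm V S₀ S₁) (k : ℝ)
    (w : ι → ℝ) : ℝ := (27 / k) * M.dV (sharpCoord φ w)

/-- The rational part `𝔡'` of the dual invariant function canonically associated with
`d = k d_𝒱`. -/
def frakdDual (M : MetricCliffordModule V S₀ S₁) (φ : (ι → ℝ) ≃ₗ[ℝ] Herm V S₀ S₁) (k : ℝ)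
    (w : ι → ℝ) : ℝ := (27 / k) * M.frakdV (sharpCoord φ w)

/-! ### The function `I₄`

Charges are indexed by `Option ι`: `p none = p⁰`, `p (some a) = p^a`, and likewise for `q`. -/

/-- The principal square root of a real number, imaginary for negative arguments. -/
def csqrt (x : ℝ) : ℂ := (x : ℂ) ^ (1 / 2 : ℂ)

/-- The pairing `⟪q, p⟫ = q_a p^a`. -/
def pairing (q p : Option ι → ℝ) : ℝ := ∑ a, q (some a) * p (some a)

/-- The covector `h(p) - (1/3) p⁰ q`. -/
def alpha (d : MvPolynomial ι ℝ) (p q : Option ι → ℝ) : ι → ℝ :=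
  fun a => hMap d (fun b => p (some b)) a - (1 / 3) * p none * q (some a)

def frakA (M : MetricCliffordModule V S₀ S₁) (φ : (ι → ℝ) ≃ₗ[ℝ] Herm V S₀ S₁) (k : ℝ)
    (d : MvPolynomial ι ℝ) (p q : Option ι → ℝ) : ℂ :=
  csqrt (dDual M φ k (alpha d p q)) /
    csqrt (dDual M φ k (alpha d p q) + frakdDual M φ k (alpha d p q)) - 1

def frakB (M : MetricCliffordModule V S₀ S₁) (φ : (ι → ℝ) ≃ₗ[ℝ] Herm V S₀ S₁) (k : ℝ)
    (d : MvPolynomial ι ℝ) (p q : Option ι → ℝ) : ℂ :=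
  ((∑ a, alpha d p q a * gradThird (frakdDual M φ k) (alpha d p q) a : ℝ) : ℂ) /
    csqrt (dDual M φ k (alpha d p q) + frakdDual M φ k (alpha d p q))

def I₄ (M : MetricCliffordModule V S₀ S₁) (φ : (ι → ℝ) ≃ₗ[ℝ] Herm V S₀ S₁) (k : ℝ)
    (d : MvPolynomial ι ℝ) (p q : Option ι → ℝ) : ℂ :=
  4 / (p none : ℂ) ^ 2 *
      ((1 + frakA M φ k d p q) * csqrt (dDual M φ k (alpha d p q)) + frakB M φ k d p q) ^ 2
    - 1 / (p none : ℂ) ^ 2 *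
      (((q none * p none + pairing q p) * p none
        - 2 * MvPolynomial.eval (fun a => p (some a)) d : ℝ) : ℂ) ^ 2

/-- The quartic polynomial
`-(q₀p⁰ + ⟪q,p⟫)² + 4 q₀ d(p) - (4/27) p⁰ d'(q) + (4/3) ⟪h(p), h'(q)⟫`. -/
def quartic (M : MetricCliffordModule V S₀ S₁) (φ : (ι → ℝ) ≃ₗ[ℝ] Herm V S₀ S₁) (k : ℝ)
    (d : MvPolynomial ι ℝ) (p q : Option ι → ℝ) : ℝ :=
  -(q none * p none + pairing q p) ^ 2
    + 4 * q none * MvPolynomial.eval (fun a => p (some a)) d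
    - 4 / 27 * p none * dDual M φ k (fun a => q (some a))
    + 4 / 3 * ∑ a, hMap d (fun b => p (some b)) a *
        gradThird (dDual M φ k) (fun b => q (some b)) a

end Cubic

/-! ### Special Kähler geometry of `ℝⁿ + i𝒱` and BPS black holes -/

section BlackHole

variable {ι : Type*} [Fintype ι] [DecidableEq ι]

/-- The Wirtinger derivative `∂f/∂z^a`. -/
def wirt (f : (ι → ℂ) → ℂ) (z : ι → ℂ) (a : ι) : ℂ :=
  (fderiv ℝ f z (Pi.single a 1) - Complex.I * fderiv ℝ f z (Pi.single a Complex.I)) / 2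

/-- The Wirtinger derivative `∂f/∂z̄^a`. -/
def wirtBar (f : (ι → ℂ) → ℂ) (z : ι → ℂ) (a : ι) : ℂ :=
  (fderiv ℝ f z (Pi.single a 1) + Complex.I * fderiv ℝ f z (Pi.single a Complex.I)) / 2

/-- The Siegel domain `ℝⁿ + i𝒱`. -/
def siegel (C : Set (ι → ℝ)) : Set (ι → ℂ) := {z | (fun a => (z a).im) ∈ C}

/-- The prepotential `F(X) = d(X¹, …, Xⁿ) / X⁰`. -/
def prepotential (d : MvPolynomial ι ℝ) (X : Option ι → ℂ) : ℂ :=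
  MvPolynomial.aeval (fun a => X (some a)) d / X none

/-- `F_I = ∂F/∂X^I`. -/
def dPrepotential (d : MvPolynomial ι ℝ) (X : Option ι → ℂ) (I : Option ι) : ℂ :=
  deriv (fun s : ℂ => prepotential d (X + s • Pi.single I 1)) 0

/-- The section `X = (1, z¹, …, zⁿ)`. -/
def lift (z : ι → ℂ) : Option ι → ℂ
  | none => 1
  | some a => z a

/-- The Kähler potential `𝒦 = -log (8 d(Im z))`. -/
def kahler (d : MvPolynomial ι ℝ) (z : ι → ℂ) : ℝ :=
  -Real.log (8 * MvPolynomial.eval (fun a => (z a).im) d)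

/-- The Kähler metric `g_{a b̄} = ∂_a ∂_b̄ 𝒦`. -/
def kahlerMetric (d : MvPolynomial ι ℝ) (z : ι → ℂ) : Matrix ι ι ℂ :=
  Matrix.of fun a b => wirt (fun w => wirtBar (fun u => (kahler d u : ℂ)) w b) z a

/-- The central charge `Z(p, q, z, z̄) = e^{𝒦/2} (p^I F_I - q_I X^I)`. -/
def centralCharge (d : MvPolynomial ι ℝ) (p q : Option ι → ℝ) (z : ι → ℂ) : ℂ :=
  (Real.exp (kahler d z / 2) : ℂ) *
    ∑ I, ((p I : ℂ) * dPrepotential d (lift z) I - (q I : ℂ) * lift z I)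

/-- The covariant derivative `Z_a = ∂Z/∂z^a + (1/2) (∂𝒦/∂z^a) Z`. -/
def covCharge (d : MvPolynomial ι ℝ) (p q : Option ι → ℝ) (z : ι → ℂ) (a : ι) : ℂ :=
  wirt (centralCharge d p q) z a
    + (1 / 2) * wirt (fun u => (kahler d u : ℂ)) z a * centralCharge d p q z

/-- The effective black hole potential `V_BH = |Z|² + g^{a b̄} Z_a conj(Z_b)`. -/
def potentialBH (d : MvPolynomial ι ℝ) (p q : Option ι → ℝ) (z : ι → ℂ) : ℝ :=
  ‖centralCharge d p q z‖ ^ 2 +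
    (∑ a, ∑ b, (kahlerMetric d z)⁻¹ b a * covCharge d p q z a *
      (starRingEnd ℂ) (covCharge d p q z b)).re

/-- A static, spherically symmetric, asymptotically flat extremal black hole of the theory with
cubic `d` and scalar manifold `ℝⁿ + i C`, with metric
`-e^{2U(r)} dt² + e^{-2U(r)} (dr² + r² (dθ² + sin² θ dφ²))`, scalar fields `z(r)`, magnetic charges
`p` and electric charges `q`. By the symmetries the field equations are the Euler-Lagrange
equations, in the variable `τ = 1/r`, of the reduced Lagrangian
`(dU/dτ)² + g_{a b̄} (dz^a/dτ) conj(dz^b/dτ) + e^{2U} V_BH`, on its zero energy (extremal) level.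
The horizon is at `r = 0`: there `e^{-2U} ≅ radius² / r²` and the scalar fields have a limit
`zHor` in the scalar manifold. -/
structure ExtremalBlackHole (d : MvPolynomial ι ℝ) (C : Set (ι → ℝ)) where
  p : Option ι → ℝ
  q : Option ι → ℝ
  U : ℝ → ℝ
  z : ℝ → ι → ℂ
  zHor : ι → ℂ
  radius : ℝ
  contDiffOn_U : ContDiffOn ℝ 2 U (Set.Ioi 0)
  contDiffOn_z : ContDiffOn ℝ 2 z (Set.Ioi 0)
  z_mem : ∀ r, 0 < r → z r ∈ siegel C
  asymptoticallyFlat : Filter.Tendsto U Filter.atTop (𝓝 0)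
  radius_pos : 0 < radius
  horizon : Filter.Tendsto (fun r => r ^ 2 * Real.exp (-2 * U r)) (𝓝[>] 0) (𝓝 (radius ^ 2))
  zHor_mem : zHor ∈ siegel C
  tendsto_z : Filter.Tendsto z (𝓝[>] 0) (𝓝 zHor)
  equation_U : ∀ τ : ℝ, 0 < τ →
    deriv (deriv (fun t => U t⁻¹)) τ = Real.exp (2 * U τ⁻¹) * potentialBH d p q (z τ⁻¹)
  equation_z : ∀ τ : ℝ, 0 < τ → ∀ b,
    deriv (fun s => ∑ a, kahlerMetric d (z s⁻¹) a b * deriv (fun t => z t⁻¹ a) s) τ =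
      (∑ a, ∑ c, wirtBar (fun w => kahlerMetric d w a c) (z τ⁻¹) b *
        deriv (fun t => z t⁻¹ a) τ * (starRingEnd ℂ) (deriv (fun t => z t⁻¹ c) τ))
      + (Real.exp (2 * U τ⁻¹) : ℂ) *
        wirtBar (fun w => (potentialBH d p q w : ℂ)) (z τ⁻¹) b
  zero_energy : ∀ τ : ℝ, 0 < τ →
    (deriv (fun t => U t⁻¹) τ) ^ 2 +
      (∑ a, ∑ b, kahlerMetric d (z τ⁻¹) a b * deriv (fun t => z t⁻¹ a) τ *
        (starRingEnd ℂ) (deriv (fun t => z t⁻¹ b) τ)).re =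
      Real.exp (2 * U τ⁻¹) * potentialBH d p q (z τ⁻¹)

namespace ExtremalBlackHole

variable {d : MvPolynomial ι ℝ} {C : Set (ι → ℝ)}

/-- The area of the event horizon. -/
def horizonArea (B : ExtremalBlackHole d C) : ℝ := 4 * Real.pi * B.radius ^ 2

/-- The Bekenstein-Hawking entropy, in natural units. -/
def entropy (B : ExtremalBlackHole d C) : ℝ := B.horizonArea / 4

/-- The Bertotti-Robinson mass: the near-horizon geometry is
`-(r²/m²) dt² + (m²/r²) dr² + m² (dθ² + sin² θ dφ²)`. -/
def mass (B : ExtremalBlackHole d C) : ℝ := B.radius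

/-- The central charge at the horizon. -/
def chargeHor (B : ExtremalBlackHole d C) : ℂ := centralCharge d B.p B.q B.zHor

/-- The black hole is BPS: the mass equals the absolute value of the central charge at the
horizon. -/
def IsBPS (B : ExtremalBlackHole d C) : Prop := B.mass = ‖B.chargeHor‖

end ExtremalBlackHole

end BlackHole

end EntropyFormula

end

/-! Write X# for the gradient of `dV` with respect to the trace form (`adjoint`), so that h(X) is
represented by (k/3) X#, and J for `chargeJ`. All three claims pass through a simpler expression for
I₄ (`I₄_eq`): 𝔡' is homogeneous of degree 3, so Euler's identity gives ⟪α, 𝔥'(α)⟫ = 𝔡'(α), the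
bracket collapses to the square root of (d' + 𝔡')(α), and I₄ = (4 (d' + 𝔡')(α) - J²) / (p⁰)².

Entropy. Near the horizon τ² U'' tends to V_BH(z_o) / m² while U + log τ converges, which forces
V_BH(z_o) = m². In the BPS case m = |Z_o|, so the positive definite term g^{ab̄} Z_a conj(Z_b)
vanishes and Z_a = 0. Recentred at p / p⁰, the superpotential has no quadratic term: W(p/p⁰ + v) =
-p⁰ d(v) + 3 ⟪α, v⟫ / p⁰ - J / (p⁰)². At v = ξ + i y the imaginary part of Z_a = 0 gives ξ = c y,
the real part gives that α is a multiple of y#, and J and |Z_o|² become explicit in c and d(y)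
(`attractor`). The identity (d + 𝔡)(X#) = d(X)² for d = `dV` (`dV_add_frakdV_adjoint`) then
evaluates I₄ as |Z_o|⁴ = m⁴. Positivity of the metric and the conclusion ξ = c y both rest on the
strict concavity of log d on the cone (`logConcaveAt_of_mem_cone`).

Rationality. 𝔡 is a quartic polynomial, the defect |s₀|²|s₁|² - |s₀♭·s₁|², divided by the first
diagonal entry, so α₁ (p⁰)² is a denominator of I₄.

Symmetric case. If ℓ maps the dual cone onto the cone, the cubic d ∘ ℓ vanishes on the boundary of
the dual cone and is positive inside. Boundary curves show that it has degree at most one in x₁;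
unipotent automorphisms of the dual cone spread this to other directions, and a nonzero defect would
yield an interior point where the cubic vanishes (`defect_eq_zero_of_vanishesOnDualBoundary`).
Without defect X## = d(X) X, and expanding d'(α) cancels the denominator (p⁰)². -/

noncomputable section

namespace EntropyFormula

namespace MetricCliffordModule

set_option linter.unusedSectionVars false

variable {V S₀ S₁ : Type*}
  [NormedAddCommGroup V] [InnerProductSpace ℝ V] [FiniteDimensional ℝ V]
  [NormedAddCommGroup S₀] [InnerProductSpace ℝ S₀] [FiniteDimensional ℝ S₀]
  [NormedAddCommGroup S₁] [InnerProductSpace ℝ S₁] [FiniteDimensional ℝ S₁]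

/-! ### Clifford multiplication and its transposes -/

theorem adj_eq (M : MetricCliffordModule V S₀ S₁) (v : V) (t : S₁) : M.adj v t = -M.mul₁ v t := by
  refine ext_inner_right ℝ fun s => ?_
  rw [inner_adj, M.skew, inner_neg_left, real_inner_comm]

theorem adj_add_right (M : MetricCliffordModule V S₀ S₁) (v : V) (t t' : S₁) :
    M.adj v (t + t') = M.adj v t + M.adj v t' := by
  simp [adj_eq, add_comm]

theorem adj_add_left (M : MetricCliffordModule V S₀ S₁) (v v' : V) (t : S₁) :
    M.adj (v + v') t = M.adj v t + M.adj v' t := by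
  simp [adj_eq, add_comm]

theorem adj_smul_right (M : MetricCliffordModule V S₀ S₁) (c : ℝ) (v : V) (t : S₁) :
    M.adj v (c • t) = c • M.adj v t := by
  simp [adj_eq]

theorem adj_smul_left (M : MetricCliffordModule V S₀ S₁) (c : ℝ) (v : V) (t : S₁) :
    M.adj (c • v) t = c • M.adj v t := by
  simp [adj_eq]

@[simp] theorem adj_zero_left (M : MetricCliffordModule V S₀ S₁) (t : S₁) : M.adj 0 t = 0 := by
  simp [adj_eq]

@[simp] theorem adj_zero_right (M : MetricCliffordModule V S₀ S₁) (v : V) : M.adj v 0 = 0 := by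
  simp [adj_eq]

theorem vec_add_left (M : MetricCliffordModule V S₀ S₁) (s s' : S₀) (t : S₁) :
    M.vec (s + s') t = M.vec s t + M.vec s' t := by
  refine ext_inner_right ℝ fun v => ?_
  simp only [inner_add_left, inner_vec, map_add]

theorem vec_add_right (M : MetricCliffordModule V S₀ S₁) (s : S₀) (t t' : S₁) :
    M.vec s (t + t') = M.vec s t + M.vec s t' := by
  refine ext_inner_right ℝ fun v => ?_
  simp only [inner_add_left, inner_vec, inner_add_right]

theorem vec_smul_left (M : MetricCliffordModule V S₀ S₁) (c : ℝ) (s : S₀) (t : S₁) :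
    M.vec (c • s) t = c • M.vec s t := by
  refine ext_inner_right ℝ fun v => ?_
  simp only [real_inner_smul_left, inner_vec, map_smul]

theorem vec_smul_right (M : MetricCliffordModule V S₀ S₁) (c : ℝ) (s : S₀) (t : S₁) :
    M.vec s (c • t) = c • M.vec s t := by
  refine ext_inner_right ℝ fun v => ?_
  simp only [real_inner_smul_left, inner_vec, real_inner_smul_right]

@[simp] theorem vec_zero_left (M : MetricCliffordModule V S₀ S₁) (t : S₁) : M.vec 0 t = 0 := by
  simpa using M.vec_smul_left 0 0 t

@[simp] theorem vec_zero_right (M : MetricCliffordModule V S₀ S₁) (s : S₀) : M.vec s 0 = 0 := by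
  simpa using M.vec_smul_right 0 s 0

theorem mul₀_adj_add (M : MetricCliffordModule V S₀ S₁) (v w : V) (t : S₁) :
    M.mul₀ v (M.adj w t) + M.mul₀ w (M.adj v t) = (2 * inner ℝ v w) • t := by
  have h := M.clifford₁ v w t
  rw [adj_eq, adj_eq, map_neg, map_neg, ← neg_add, h, ← neg_smul]
  congr 1
  ring

theorem adj_mul₀_add (M : MetricCliffordModule V S₀ S₁) (v w : V) (s : S₀) :
    M.adj v (M.mul₀ w s) + M.adj w (M.mul₀ v s) = (2 * inner ℝ v w) • s := by
  have h := M.clifford₀ v w s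
  rw [adj_eq, adj_eq, ← neg_add, h, ← neg_smul]
  congr 1
  ring

theorem adj_mul₀ (M : MetricCliffordModule V S₀ S₁) (v : V) (s : S₀) :
    M.adj v (M.mul₀ v s) = (inner ℝ v v : ℝ) • s := by
  have h := M.adj_mul₀_add v v s
  rw [← two_smul ℝ, mul_smul] at h
  exact smul_right_injective _ (two_ne_zero' ℝ) h

theorem mul₀_adj (M : MetricCliffordModule V S₀ S₁) (v : V) (t : S₁) :
    M.mul₀ v (M.adj v t) = (inner ℝ v v : ℝ) • t := by
  have h := M.mul₀_adj_add v v t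
  rw [← two_smul ℝ, mul_smul] at h
  exact smul_right_injective _ (two_ne_zero' ℝ) h

theorem inner_mul₀_mul₀_add (M : MetricCliffordModule V S₀ S₁) (v w : V) (s t : S₀) :
    inner ℝ (M.mul₀ v s) (M.mul₀ w t) + inner ℝ (M.mul₀ w s) (M.mul₀ v t) =
      2 * inner ℝ v w * inner ℝ s t := by
  rw [real_inner_comm (M.mul₀ w t), real_inner_comm (M.mul₀ v t), ← M.inner_adj, ← M.inner_adj,
    ← inner_add_left, add_comm, M.adj_mul₀_add, real_inner_smul_left, real_inner_comm t s]

theorem inner_mul₀_mul₀ (M : MetricCliffordModule V S₀ S₁) (v : V) (s t : S₀) :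
    inner ℝ (M.mul₀ v s) (M.mul₀ v t) = inner ℝ v v * inner ℝ s t := by
  linarith [M.inner_mul₀_mul₀_add v v s t]

theorem inner_mul₀_mul₀_left (M : MetricCliffordModule V S₀ S₁) (v w : V) (s : S₀) :
    inner ℝ (M.mul₀ v s) (M.mul₀ w s) = inner ℝ v w * inner ℝ s s := by
  have h := M.inner_mul₀_mul₀_add v w s s
  rw [real_inner_comm (M.mul₀ v s) (M.mul₀ w s)] at h
  linarith

theorem inner_adj_adj_left (M : MetricCliffordModule V S₀ S₁) (v w : V) (t : S₁) :
    inner ℝ (M.adj v t) (M.adj w t) = inner ℝ v w * inner ℝ t t := by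
  have h := congrArg (fun x => inner ℝ x t) (M.mul₀_adj_add v w t)
  simp only [inner_add_left, real_inner_smul_left] at h
  rw [← M.inner_adj, ← M.inner_adj, real_inner_comm (M.adj v t) (M.adj w t)] at h
  linarith [real_inner_comm (M.adj v t) (M.adj w t)]

theorem vec_mul₀ (M : MetricCliffordModule V S₀ S₁) (v : V) (s : S₀) :
    M.vec s (M.mul₀ v s) = (inner ℝ s s : ℝ) • v := by
  refine ext_inner_right ℝ fun u => ?_
  rw [inner_vec, M.inner_mul₀_mul₀_left, real_inner_smul_left, real_inner_comm u v]
  ring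

theorem vec_adj (M : MetricCliffordModule V S₀ S₁) (v : V) (t : S₁) :
    M.vec (M.adj v t) t = (inner ℝ t t : ℝ) • v := by
  refine ext_inner_right ℝ fun u => ?_
  rw [inner_vec, ← inner_adj, M.inner_adj_adj_left, real_inner_smul_left, real_inner_comm u v]
  ring

/-- Pair the polarized Clifford relation for `v`, `u`, applied to `t`, with `μ(v, s)`; since `μ(v,
·)` scales inner products by |v|², one summand becomes |v|² times the `u`-component of `M.vec s t`.
-/
theorem vec_adj_mul₀ (M : MetricCliffordModule V S₀ S₁) (v : V) (s : S₀) (t : S₁) :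
    M.vec (M.adj v t) (M.mul₀ v s) =
      (2 * inner ℝ (M.mul₀ v s) t : ℝ) • v - (inner ℝ v v : ℝ) • M.vec s t := by
  refine ext_inner_right ℝ fun u => ?_
  have h := congrArg (fun x => inner ℝ x (M.mul₀ v s)) (M.mul₀_adj_add v u t)
  simp only [inner_add_left, real_inner_smul_left, M.inner_mul₀_mul₀] at h
  rw [M.inner_adj] at h
  rw [inner_vec, inner_sub_left, real_inner_smul_left, real_inner_smul_left, inner_vec]
  rw [real_inner_comm (M.mul₀ v s) t] at h
  linarith

/-- The obstruction `|s₀|² |s₁|² - |s₀♭ · s₁|²` to self-adjointness of the cone. -/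
def defect (M : MetricCliffordModule V S₀ S₁) (s : S₀) (t : S₁) : ℝ :=
  ‖t‖ ^ 2 * ‖s‖ ^ 2 - ‖M.vec s t‖ ^ 2

/-- For v = `M.vec s t` one has |v|² = ⟪μ(v, s), t⟫, and Cauchy-Schwarz applies with |μ(v, s)| = |v|
|s|. -/
theorem norm_vec_le (M : MetricCliffordModule V S₀ S₁) (s : S₀) (t : S₁) :
    ‖M.vec s t‖ ≤ ‖s‖ * ‖t‖ := by
  set v := M.vec s t with hv
  have h1 : ‖v‖ ^ 2 = inner ℝ (M.mul₀ v s) t := by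
    rw [← inner_vec, ← hv, real_inner_self_eq_norm_sq]
  have h2 : ‖M.mul₀ v s‖ = ‖v‖ * ‖s‖ := by
    have := M.inner_mul₀_mul₀ v s s
    rw [real_inner_self_eq_norm_sq, real_inner_self_eq_norm_sq, real_inner_self_eq_norm_sq,
      ← mul_pow] at this
    exact (pow_left_inj₀ (norm_nonneg _) (by positivity) two_ne_zero).1 this
  have h3 := real_inner_le_norm (M.mul₀ v s) t
  rw [h2, ← h1] at h3
  rcases (norm_nonneg v).eq_or_lt with h | h
  · rw [← h]; positivity
  · refine le_of_mul_le_mul_left ?_ h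
    linarith

theorem defect_nonneg (M : MetricCliffordModule V S₀ S₁) (s : S₀) (t : S₁) : 0 ≤ M.defect s t := by
  have h := pow_le_pow_left₀ (norm_nonneg _) (M.norm_vec_le s t) 2
  rw [defect]
  linarith [mul_pow ‖s‖ ‖t‖ 2]

/-! ### The cubic form and its adjoint -/

theorem form_apply (M : MetricCliffordModule V S₀ S₁) (x₁ x₂ x₃ : ℝ) (v : V) (s : S₀) (t : S₁)
    (y₁ y₂ y₃ : ℝ) (v' : V) (s' : S₀) (t' : S₁) :
    M.form (x₁, x₂, x₃, v, s, t) (y₁, y₂, y₃, v', s', t') =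
      x₁ * y₁ + x₂ * y₂ + x₃ * y₃ + 2 * inner ℝ v v' + 2 * inner ℝ s s' + 2 * inner ℝ t t' := by
  simp only [form, TMat.trace, mul, Herm.toMat]
  ring

/-- The quadratic adjoint, that is the gradient of the cubic form for the Euclidean product. -/
def adjoint (M : MetricCliffordModule V S₀ S₁) : Herm V S₀ S₁ → Herm V S₀ S₁
  | (x₁, x₂, x₃, v, s, t) =>
    (x₂ * x₃ - ‖v‖ ^ 2, x₁ * x₃ - ‖t‖ ^ 2, x₁ * x₂ - ‖s‖ ^ 2, M.vec s t - x₁ • v,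
      M.adj v t - x₃ • s, M.mul₀ v s - x₂ • t)

/-- The exact Taylor expansion of the cubic. It identifies `adjoint` as a gradient and is the source
of the derivatives of `d` used below. -/
theorem dV_add_smul (M : MetricCliffordModule V S₀ S₁) (X Y : Herm V S₀ S₁) (c : ℝ) :
    M.dV (X + c • Y) = M.dV X + c * M.form (M.adjoint X) Y + c ^ 2 * M.form (M.adjoint Y) X
      + c ^ 3 * M.dV Y := by
  obtain ⟨x₁, x₂, x₃, v, s, t⟩ := X
  obtain ⟨y₁, y₂, y₃, v', s', t'⟩ := Y
  simp only [Prod.smul_mk, dV, adjoint, form_apply, smul_eq_mul,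
    ← real_inner_self_eq_norm_sq, inner_add_left, inner_add_right, inner_sub_left,
    real_inner_smul_left, real_inner_smul_right, map_add, map_smul, LinearMap.add_apply,
    LinearMap.smul_apply, inner_vec, inner_adj]
  rw [real_inner_comm v v', real_inner_comm s s', real_inner_comm t t']
  ring

theorem form_add_right (M : MetricCliffordModule V S₀ S₁) (X Y Z : Herm V S₀ S₁) :
    M.form X (Y + Z) = M.form X Y + M.form X Z := by
  obtain ⟨x₁, x₂, x₃, v, s, t⟩ := X
  obtain ⟨y₁, y₂, y₃, v', s', t'⟩ := Y
  obtain ⟨z₁, z₂, z₃, w, a, b⟩ := Z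
  simp only [Prod.mk_add_mk, form_apply, inner_add_right]
  ring

theorem form_smul_right (M : MetricCliffordModule V S₀ S₁) (c : ℝ) (X Y : Herm V S₀ S₁) :
    M.form X (c • Y) = c * M.form X Y := by
  obtain ⟨x₁, x₂, x₃, v, s, t⟩ := X
  obtain ⟨y₁, y₂, y₃, v', s', t'⟩ := Y
  simp only [Prod.smul_mk, form_apply, real_inner_smul_right, smul_eq_mul]
  ring

theorem form_comm (M : MetricCliffordModule V S₀ S₁) (X Y : Herm V S₀ S₁) :
    M.form X Y = M.form Y X := by
  obtain ⟨x₁, x₂, x₃, v, s, t⟩ := X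
  obtain ⟨y₁, y₂, y₃, v', s', t'⟩ := Y
  simp only [form_apply]
  rw [real_inner_comm v v', real_inner_comm s s', real_inner_comm t t']
  ring

theorem eq_zero_of_form_self (M : MetricCliffordModule V S₀ S₁) {X : Herm V S₀ S₁}
    (h : M.form X X = 0) : X = 0 := by
  obtain ⟨x₁, x₂, x₃, v, s, t⟩ := X
  simp only [form_apply, real_inner_self_eq_norm_sq] at h
  have h1 : x₁ = 0 := pow_eq_zero_iff two_ne_zero |>.1
    (by nlinarith [sq_nonneg ‖v‖, sq_nonneg ‖s‖, sq_nonneg ‖t‖, sq_nonneg x₂, sq_nonneg x₃,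
      sq_nonneg x₁])
  have h2 : x₂ = 0 := pow_eq_zero_iff two_ne_zero |>.1
    (by nlinarith [sq_nonneg ‖v‖, sq_nonneg ‖s‖, sq_nonneg ‖t‖, sq_nonneg x₂, sq_nonneg x₃,
      sq_nonneg x₁])
  have h3 : x₃ = 0 := pow_eq_zero_iff two_ne_zero |>.1
    (by nlinarith [sq_nonneg ‖v‖, sq_nonneg ‖s‖, sq_nonneg ‖t‖, sq_nonneg x₂, sq_nonneg x₃,
      sq_nonneg x₁])
  have h4 : ‖v‖ = 0 := pow_eq_zero_iff two_ne_zero |>.1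
    (by nlinarith [sq_nonneg ‖v‖, sq_nonneg ‖s‖, sq_nonneg ‖t‖, sq_nonneg x₂, sq_nonneg x₃,
      sq_nonneg x₁])
  have h5 : ‖s‖ = 0 := pow_eq_zero_iff two_ne_zero |>.1
    (by nlinarith [sq_nonneg ‖v‖, sq_nonneg ‖s‖, sq_nonneg ‖t‖, sq_nonneg x₂, sq_nonneg x₃,
      sq_nonneg x₁])
  have h6 : ‖t‖ = 0 := pow_eq_zero_iff two_ne_zero |>.1
    (by nlinarith [sq_nonneg ‖v‖, sq_nonneg ‖s‖, sq_nonneg ‖t‖, sq_nonneg x₂, sq_nonneg x₃,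
      sq_nonneg x₁])
  simp [h1, h2, h3, norm_eq_zero.1 h4, norm_eq_zero.1 h5, norm_eq_zero.1 h6]

theorem eq_of_forall_form_eq (M : MetricCliffordModule V S₀ S₁) {X Y : Herm V S₀ S₁}
    (h : ∀ Z, M.form X Z = M.form Y Z) : X = Y := by
  rw [← sub_eq_zero]
  refine M.eq_zero_of_form_self ?_
  have e : X - Y = X + (-1 : ℝ) • Y := by module
  have h1 := h (X - Y)
  rw [form_comm, e, form_add_right, form_smul_right, ← e, form_comm, h1, form_comm _ _ Y]
  ring

theorem adjoint_smul (M : MetricCliffordModule V S₀ S₁) (c : ℝ) (X : Herm V S₀ S₁) :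
    M.adjoint (c • X) = c ^ 2 • M.adjoint X := by
  obtain ⟨x₁, x₂, x₃, v, s, t⟩ := X
  simp only [Prod.smul_mk, adjoint, smul_eq_mul, norm_smul, mul_pow, Real.norm_eq_abs, sq_abs,
    vec_smul_left, vec_smul_right, adj_smul_left, adj_smul_right, map_smul, LinearMap.smul_apply,
    Prod.mk.injEq]
  refine ⟨by ring, by ring, by ring, by module, by module, by module⟩

theorem dV_smul (M : MetricCliffordModule V S₀ S₁) (c : ℝ) (X : Herm V S₀ S₁) :
    M.dV (c • X) = c ^ 3 * M.dV X := by
  obtain ⟨x₁, x₂, x₃, v, s, t⟩ := X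
  simp only [Prod.smul_mk, dV, smul_eq_mul, norm_smul, mul_pow, Real.norm_eq_abs, sq_abs, map_smul,
    LinearMap.smul_apply, real_inner_smul_left, real_inner_smul_right]
  ring

/-- Up to the factor `x₁`, the dual cubic function d + 𝔡 is the last of the minors that cut out the
dual cone; compare `mem_dualCone_iff`. -/
theorem mul_dV_add_frakdV (M : MetricCliffordModule V S₀ S₁) (x₁ x₂ x₃ : ℝ) (v : V) (s : S₀)
    (t : S₁) (h : x₁ ≠ 0) :
    x₁ * (M.dV (x₁, x₂, x₃, v, s, t) + M.frakdV (x₁, x₂, x₃, v, s, t)) =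
      (x₁ * x₃ - ‖t‖ ^ 2) * (x₁ * x₂ - ‖s‖ ^ 2) - ‖x₁ • v - M.vec s t‖ ^ 2 := by
  rw [mul_add, frakdV, mul_div_cancel₀ _ h, dV]
  simp only [← real_inner_self_eq_norm_sq, inner_sub_left, inner_sub_right, real_inner_smul_left,
    real_inner_smul_right, inner_vec, real_inner_comm (M.vec s t)]
  ring

theorem mul_dV_add_defect (M : MetricCliffordModule V S₀ S₁) (x₁ x₂ x₃ : ℝ) (v : V) (s : S₀)
    (t : S₁) :
    x₁ * M.dV (x₁, x₂, x₃, v, s, t) + M.defect s t =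
      (x₁ * x₃ - ‖t‖ ^ 2) * (x₁ * x₂ - ‖s‖ ^ 2) - ‖x₁ • v - M.vec s t‖ ^ 2 := by
  rw [dV, defect]
  simp only [← real_inner_self_eq_norm_sq, inner_sub_left, inner_sub_right, real_inner_smul_left,
    real_inner_smul_right, inner_vec, real_inner_comm (M.vec s t)]
  ring

/-- With pivot `x₃` no correction arises, because |`M.adj v t`| = |v| |t| always holds, whereas
|`M.vec s t`| can be smaller than |s| |t|. -/
theorem mul_dV_eq (M : MetricCliffordModule V S₀ S₁) (x₁ x₂ x₃ : ℝ) (v : V) (s : S₀)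
    (t : S₁) :
    x₃ * M.dV (x₁, x₂, x₃, v, s, t) =
      (x₁ * x₃ - ‖t‖ ^ 2) * (x₂ * x₃ - ‖v‖ ^ 2) - ‖x₃ • s - M.adj v t‖ ^ 2 := by
  rw [dV]
  simp only [← real_inner_self_eq_norm_sq, inner_sub_left, inner_sub_right, real_inner_smul_left,
    real_inner_smul_right, real_inner_comm (M.adj v t), inner_adj, mul₀_adj]
  ring

theorem adjoint_entry₂ (M : MetricCliffordModule V S₀ S₁) (x₁ x₂ x₃ : ℝ) (v : V) (s : S₀)
    (t : S₁) : (x₂ * x₃ - ‖v‖ ^ 2) * (x₁ * x₂ - ‖s‖ ^ 2) - ‖M.mul₀ v s - x₂ • t‖ ^ 2 =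
      x₂ * M.dV (x₁, x₂, x₃, v, s, t) := by
  rw [dV]
  simp only [← real_inner_self_eq_norm_sq, inner_sub_left, inner_sub_right, real_inner_smul_left,
    real_inner_smul_right, inner_mul₀_mul₀, real_inner_comm (M.mul₀ v s)]
  ring

theorem adjoint_entry₃ (M : MetricCliffordModule V S₀ S₁) (x₁ x₂ x₃ : ℝ) (v : V) (s : S₀)
    (t : S₁) : (x₂ * x₃ - ‖v‖ ^ 2) * (x₁ * x₃ - ‖t‖ ^ 2) - ‖M.adj v t - x₃ • s‖ ^ 2 =
      x₃ * M.dV (x₁, x₂, x₃, v, s, t) := by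
  rw [mul_dV_eq, ← norm_neg (M.adj v t - x₃ • s), neg_sub]
  ring

/-- The `V`-entry of X## = d(X) X. It and the second and third diagonal entries hold for every
module; the remaining entries are where the defect intervenes. -/
theorem adjoint_vec (M : MetricCliffordModule V S₀ S₁) (x₁ x₂ x₃ : ℝ) (v : V) (s : S₀)
    (t : S₁) : M.vec (M.adj v t - x₃ • s) (M.mul₀ v s - x₂ • t)
      - (x₂ * x₃ - ‖v‖ ^ 2) • (M.vec s t - x₁ • v) = M.dV (x₁, x₂, x₃, v, s, t) • v := by
  rw [dV, sub_eq_add_neg (M.adj v t), sub_eq_add_neg (M.mul₀ v s), ← neg_smul, ← neg_smul,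
    vec_add_left, vec_add_right, vec_add_right, vec_adj_mul₀, vec_smul_right, vec_smul_right,
    vec_smul_left, vec_smul_left, vec_adj, vec_mul₀]
  simp only [real_inner_self_eq_norm_sq]
  module

/-- After multiplication by the first entry x₂x₃ - |v|² of X#, the minors of X# are x₂ d and x₃ d
and the off-diagonal vector is a multiple d v, up to sign; the total is d² (x₂x₃ - |v|²). -/
theorem dV_add_frakdV_adjoint (M : MetricCliffordModule V S₀ S₁) (X : Herm V S₀ S₁)
    (h : (M.adjoint X).1 ≠ 0) :
    M.dV (M.adjoint X) + M.frakdV (M.adjoint X) = M.dV X ^ 2 := by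
  obtain ⟨x₁, x₂, x₃, v, s, t⟩ := X
  refine mul_left_cancel₀ h ?_
  have h' : x₂ * x₃ - ‖v‖ ^ 2 ≠ 0 := h
  have hv : ‖(x₂ * x₃ - ‖v‖ ^ 2) • (M.vec s t - x₁ • v)
      - M.vec (M.adj v t - x₃ • s) (M.mul₀ v s - x₂ • t)‖ ^ 2
      = M.dV (x₁, x₂, x₃, v, s, t) ^ 2 * ‖v‖ ^ 2 := by
    rw [← norm_neg, neg_sub, adjoint_vec, norm_smul, mul_pow, Real.norm_eq_abs, sq_abs]
  simp only [adjoint]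
  rw [mul_dV_add_frakdV _ _ _ _ _ _ _ h', adjoint_entry₂, adjoint_entry₃, hv]
  ring

/-- The squared norm of the difference of the two sides is |t|² times the defect. This is the
equality case of `norm_vec_le`; `mul₀_vec` is its mirror image. -/
theorem adj_vec (M : MetricCliffordModule V S₀ S₁) (hM : ∀ s t, M.defect s t = 0) (s : S₀)
    (t : S₁) : M.adj (M.vec s t) t = (inner ℝ t t : ℝ) • s := by
  rw [← sub_eq_zero, ← norm_eq_zero, ← pow_eq_zero_iff two_ne_zero]
  have h := hM s t
  rw [defect] at h
  simp only [← real_inner_self_eq_norm_sq, inner_sub_left, inner_sub_right, real_inner_smul_left,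
    real_inner_smul_right, real_inner_comm (M.adj (M.vec s t) t), inner_adj,
    mul₀_adj] at h ⊢
  rw [← inner_vec]
  linear_combination inner ℝ t t * h

theorem adj_vec_add (M : MetricCliffordModule V S₀ S₁) (hM : ∀ s t, M.defect s t = 0) (s : S₀)
    (t t' : S₁) :
    M.adj (M.vec s t) t' + M.adj (M.vec s t') t = (2 * inner ℝ t t' : ℝ) • s := by
  have h := M.adj_vec hM s (t + t')
  simp only [vec_add_right, adj_add_left, adj_add_right, M.adj_vec hM, inner_add_left,
    inner_add_right, real_inner_comm t t'] at h
  linear_combination (norm := module) h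

theorem mul₀_vec (M : MetricCliffordModule V S₀ S₁) (hM : ∀ s t, M.defect s t = 0) (s : S₀)
    (t : S₁) : M.mul₀ (M.vec s t) s = (inner ℝ s s : ℝ) • t := by
  rw [← sub_eq_zero, ← norm_eq_zero, ← pow_eq_zero_iff two_ne_zero]
  have h := hM s t
  rw [defect] at h
  simp only [← real_inner_self_eq_norm_sq, inner_sub_left, inner_sub_right, real_inner_smul_left,
    real_inner_smul_right, inner_mul₀_mul₀, real_inner_comm (M.mul₀ (M.vec s t) s)] at h ⊢
  rw [← inner_vec]
  linear_combination inner ℝ s s * h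

theorem mul₀_vec_add (M : MetricCliffordModule V S₀ S₁) (hM : ∀ s t, M.defect s t = 0) (s s' : S₀)
    (t : S₁) :
    M.mul₀ (M.vec s t) s' + M.mul₀ (M.vec s' t) s = (2 * inner ℝ s s' : ℝ) • t := by
  have h := M.mul₀_vec hM (s + s') t
  simp only [vec_add_left, map_add, LinearMap.add_apply, M.mul₀_vec hM, inner_add_left,
    inner_add_right, real_inner_comm s s'] at h
  linear_combination (norm := module) h

/-- The adjoint identity of a cubic Jordan algebra. The spinor entries need the polarized relations
`adj_vec_add` and `mul₀_vec_add`, taken at `μ(v, s)` and at `M.adj v t`. -/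
theorem adjoint_adjoint (M : MetricCliffordModule V S₀ S₁) (hM : ∀ s t, M.defect s t = 0)
    (X : Herm V S₀ S₁) : M.adjoint (M.adjoint X) = M.dV X • X := by
  obtain ⟨x₁, x₂, x₃, v, s, t⟩ := X
  have h1 := M.mul_dV_add_defect x₁ x₂ x₃ v s t
  rw [hM, ← norm_neg (x₁ • v - M.vec s t), neg_sub] at h1
  have h5 := M.adj_vec_add hM s t (M.mul₀ v s)
  have h6 := M.mul₀_vec_add hM s (M.adj v t) t
  rw [vec_mul₀, adj_smul_left, real_inner_comm (M.mul₀ v s) t] at h5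
  rw [vec_adj, map_smul, LinearMap.smul_apply, real_inner_comm (M.adj v t) s, inner_adj] at h6
  simp only [real_inner_self_eq_norm_sq] at h5 h6
  simp only [adjoint, Prod.smul_mk, smul_eq_mul, Prod.mk.injEq]
  refine ⟨by linarith, by linarith [M.adjoint_entry₂ x₁ x₂ x₃ v s t],
    by linarith [M.adjoint_entry₃ x₁ x₂ x₃ v s t], M.adjoint_vec x₁ x₂ x₃ v s t, ?_, ?_⟩
  · rw [sub_eq_add_neg (M.vec s t), sub_eq_add_neg (M.mul₀ v s), ← neg_smul, ← neg_smul,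
      adj_add_left, adj_add_right, adj_add_right, adj_smul_left, adj_smul_left, adj_smul_right,
      adj_smul_right, adj_vec M hM, adj_mul₀, dV]
    simp only [real_inner_self_eq_norm_sq]
    linear_combination (norm := module) h5
  · rw [sub_eq_add_neg (M.vec s t), sub_eq_add_neg (M.adj v t), ← neg_smul, ← neg_smul,
      dV]
    simp only [map_add, map_smul, LinearMap.add_apply, LinearMap.smul_apply, mul₀_vec M hM,
      mul₀_adj, real_inner_self_eq_norm_sq]
    linear_combination (norm := module) h6

end MetricCliffordModule

namespace MetricCliffordModule

set_option linter.unusedSectionVars false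
set_option linter.unusedSimpArgs false

variable {V S₀ S₁ : Type*}
  [NormedAddCommGroup V] [InnerProductSpace ℝ V] [FiniteDimensional ℝ V]
  [NormedAddCommGroup S₀] [InnerProductSpace ℝ S₀] [FiniteDimensional ℝ S₀]
  [NormedAddCommGroup S₁] [InnerProductSpace ℝ S₁] [FiniteDimensional ℝ S₁]

/-! ### Inequalities defining the cone and its dual -/

/-- Cholesky factorization from the lower right corner: for X = A A* the three quantities are a₃²,
a₂²a₃² and a₁²a₂²a₃². Conversely their successive quotients have square roots a₃, a₂, a₁, and the
last two columns of A are solved for. -/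
theorem mem_cone_iff (M : MetricCliffordModule V S₀ S₁) (x₁ x₂ x₃ : ℝ) (v : V) (s : S₀) (t : S₁) :
    (x₁, x₂, x₃, v, s, t) ∈ M.cone ↔
      0 < x₃ ∧ 0 < x₂ * x₃ - ‖v‖ ^ 2 ∧ 0 < M.dV (x₁, x₂, x₃, v, s, t) := by
  have key := M.mul_dV_eq x₁ x₂ x₃ v s t
  constructor
  · rintro ⟨⟨a₁, a₂, a₃, s', t', v', u₀, u₁, w⟩, ⟨h1, h2, h3, h4, h5, h6⟩, h⟩
    dsimp only at h1 h2 h3 h4 h5 h6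
    subst h4 h5 h6
    simp only [Herm.toMat, mul, TMat.star, inner_zero_left, map_zero, LinearMap.zero_apply,
      smul_zero, zero_add, add_zero, adj_zero_left, vec_zero_left, TMat.mk.injEq] at h
    obtain ⟨e1, e2, e3, e4, e5, e6, -⟩ := h
    have hx3 : 0 < x₃ := by rw [e3]; positivity
    have hD : x₂ * x₃ - ‖v‖ ^ 2 = a₂ ^ 2 * a₃ ^ 2 := by
      rw [e2, e3, e6, norm_smul, mul_pow, Real.norm_eq_abs, sq_abs, real_inner_self_eq_norm_sq]
      ring
    have hd : x₃ * M.dV (x₁, x₂, x₃, v, s, t) = x₃ * (a₁ ^ 2 * a₂ ^ 2 * a₃ ^ 2) := by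
      have h7 : x₃ • s - M.adj v t = (a₃ ^ 2 * a₂) • s' := by
        rw [e3, e4, e5, e6, adj_smul_left, adj_smul_right]
        module
      rw [key, hD, h7, e1, e5, e3, norm_smul, norm_smul, real_inner_self_eq_norm_sq,
        real_inner_self_eq_norm_sq, mul_pow, mul_pow, Real.norm_eq_abs, Real.norm_eq_abs, sq_abs,
        sq_abs]
      ring
    refine ⟨hx3, by rw [hD]; positivity, ?_⟩
    rw [mul_left_cancel₀ hx3.ne' hd]
    positivity
  · rintro ⟨h3, hD, hd⟩
    have e3 : √x₃ * √x₃ = x₃ := Real.mul_self_sqrt h3.le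
    have p3 : 0 < √x₃ := Real.sqrt_pos.2 h3
    have h2 : 0 < (x₂ * x₃ - ‖v‖ ^ 2) / x₃ := by positivity
    have e2 := Real.mul_self_sqrt h2.le
    have p2 := Real.sqrt_pos.2 h2
    have h1 : 0 < M.dV (x₁, x₂, x₃, v, s, t) / (x₂ * x₃ - ‖v‖ ^ 2) := by positivity
    have e1 := Real.mul_self_sqrt h1.le
    have p1 := Real.sqrt_pos.2 h1
    set a₁ := √(M.dV (x₁, x₂, x₃, v, s, t) / (x₂ * x₃ - ‖v‖ ^ 2))
    set a₂ := √((x₂ * x₃ - ‖v‖ ^ 2) / x₃)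
    set a₃ := √x₃
    refine ⟨⟨a₁, a₂, a₃, (a₂⁻¹ * x₃⁻¹) • (x₃ • s - M.adj v t), a₃⁻¹ • t, a₃⁻¹ • v, 0, 0, 0⟩,
      ⟨p1, p2, p3, rfl, rfl, rfl⟩, ?_⟩
    have ha : a₂ • (a₂⁻¹ * x₃⁻¹) • (x₃ • s - M.adj v t) + M.adj (a₃⁻¹ • v) (a₃⁻¹ • t) = s := by
      rw [adj_smul_left, adj_smul_right, smul_smul, smul_smul, ← mul_inv a₃ a₃, e3, ← mul_assoc,
        mul_inv_cancel₀ p2.ne', one_mul, smul_sub, smul_smul, inv_mul_cancel₀ h3.ne', one_smul,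
        sub_add_cancel]
    simp only [Herm.toMat, mul, TMat.star, inner_zero_left, map_zero, LinearMap.zero_apply,
      smul_zero, zero_add, add_zero, adj_zero_left, vec_zero_left, TMat.mk.injEq, ha,
      smul_inv_smul₀ p3.ne', e3, and_true, real_inner_self_eq_norm_sq, norm_smul, mul_pow,
      Real.norm_eq_abs, sq_abs, inv_pow]
    have q3 : a₃ ^ 2 = x₃ := by rw [sq, e3]
    have q2 : a₂ ^ 2 = (x₂ * x₃ - ‖v‖ ^ 2) / x₃ := by rw [sq, e2]
    rw [e1, e2, q2, q3]
    have hD' := hD.ne'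
    have h3' := h3.ne'
    constructor
    · have hn : ‖x₃ • s - M.adj v t‖ ^ 2 = (x₁ * x₃ - ‖t‖ ^ 2) * (x₂ * x₃ - ‖v‖ ^ 2)
        - x₃ * M.dV (x₁, x₂, x₃, v, s, t) := by linarith
      rw [hn]
      field_simp
      ring
    · field_simp
      ring

/-- The same factorization from the upper left corner. The third quantity is a₁⁴a₂²a₃², one factor
a₁² = x₁ more than a genuine determinant. -/
theorem mem_dualCone_iff (M : MetricCliffordModule V S₀ S₁) (x₁ x₂ x₃ : ℝ) (v : V) (s : S₀)
    (t : S₁) :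
    (x₁, x₂, x₃, v, s, t) ∈ M.dualCone ↔ 0 < x₁ ∧ 0 < x₁ * x₂ - ‖s‖ ^ 2 ∧
      0 < (x₁ * x₃ - ‖t‖ ^ 2) * (x₁ * x₂ - ‖s‖ ^ 2) - ‖x₁ • v - M.vec s t‖ ^ 2 := by
  constructor
  · rintro ⟨⟨a₁, a₂, a₃, s', t', v', u₀, u₁, w⟩, ⟨h1, h2, h3, h4, h5, h6⟩, h⟩
    dsimp only at h1 h2 h3 h4 h5 h6
    subst h4 h5 h6
    simp only [Herm.toMat, mul, TMat.star, inner_zero_left, map_zero, LinearMap.zero_apply,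
      smul_zero, zero_add, add_zero, adj_zero_left, vec_zero_left, TMat.mk.injEq,
      adj_zero_right] at h
    obtain ⟨e1, e2, e3, e4, e5, e6, -⟩ := h
    have hD : x₁ * x₂ - ‖s‖ ^ 2 = a₁ ^ 2 * a₂ ^ 2 := by
      rw [e1, e2, e4, norm_smul, mul_pow, Real.norm_eq_abs, sq_abs, real_inner_self_eq_norm_sq]
      ring
    have hd : (x₁ * x₃ - ‖t‖ ^ 2) * (x₁ * x₂ - ‖s‖ ^ 2) - ‖x₁ • v - M.vec s t‖ ^ 2
        = a₁ ^ 4 * a₂ ^ 2 * a₃ ^ 2 := by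
      have h7 : x₁ • v - M.vec s t = (a₁ ^ 2 * a₂) • v' := by
        rw [e1, e4, e5, e6, vec_smul_left, vec_smul_right]
        module
      rw [hD, h7, e1, e3, e5, norm_smul, norm_smul, real_inner_self_eq_norm_sq,
        real_inner_self_eq_norm_sq, mul_pow, mul_pow, Real.norm_eq_abs, Real.norm_eq_abs, sq_abs,
        sq_abs]
      ring
    refine ⟨by rw [e1]; positivity, by rw [hD]; positivity, by rw [hd]; positivity⟩
  · rintro ⟨h1, hD, hd⟩
    set δ := (x₁ * x₃ - ‖t‖ ^ 2) * (x₁ * x₂ - ‖s‖ ^ 2) - ‖x₁ • v - M.vec s t‖ ^ 2 with hδ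
    have e1 : √x₁ * √x₁ = x₁ := Real.mul_self_sqrt h1.le
    have p1 : 0 < √x₁ := Real.sqrt_pos.2 h1
    have h2 : 0 < (x₁ * x₂ - ‖s‖ ^ 2) / x₁ := by positivity
    have e2 := Real.mul_self_sqrt h2.le
    have p2 := Real.sqrt_pos.2 h2
    have h3 : 0 < δ / (x₁ * (x₁ * x₂ - ‖s‖ ^ 2)) := by positivity
    have e3 := Real.mul_self_sqrt h3.le
    have p3 := Real.sqrt_pos.2 h3
    set a₁ := √x₁
    set a₂ := √((x₁ * x₂ - ‖s‖ ^ 2) / x₁)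
    set a₃ := √(δ / (x₁ * (x₁ * x₂ - ‖s‖ ^ 2)))
    refine ⟨⟨a₁, a₂, a₃, a₁⁻¹ • s, a₁⁻¹ • t, (a₂⁻¹ * x₁⁻¹) • (x₁ • v - M.vec s t), 0, 0, 0⟩,
      ⟨p1, p2, p3, rfl, rfl, rfl⟩, ?_⟩
    have ha : M.vec (a₁⁻¹ • s) (a₁⁻¹ • t) + a₂ • (a₂⁻¹ * x₁⁻¹) • (x₁ • v - M.vec s t) = v := by
      rw [vec_smul_left, vec_smul_right, smul_smul, smul_smul, ← mul_inv, e1, ← mul_assoc,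
        mul_inv_cancel₀ p2.ne', one_mul, smul_sub, smul_smul, inv_mul_cancel₀ h1.ne', one_smul,
        add_sub_cancel]
    simp only [Herm.toMat, mul, TMat.star, inner_zero_left, map_zero, LinearMap.zero_apply,
      smul_zero, zero_add, add_zero, adj_zero_left, vec_zero_left, TMat.mk.injEq, ha,
      smul_inv_smul₀ p1.ne', e1, and_true, real_inner_self_eq_norm_sq, norm_smul, mul_pow,
      Real.norm_eq_abs, sq_abs, inv_pow, adj_zero_right, true_and]
    have q1 : a₁ ^ 2 = x₁ := by rw [sq, e1]
    have q2 : a₂ ^ 2 = (x₁ * x₂ - ‖s‖ ^ 2) / x₁ := by rw [sq, e2]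
    rw [e2, e3, q2, q1]
    have hD' := hD.ne'
    have h1' := h1.ne'
    constructor
    · field_simp
      ring
    · have hn : ‖x₁ • v - M.vec s t‖ ^ 2 = (x₁ * x₃ - ‖t‖ ^ 2) * (x₁ * x₂ - ‖s‖ ^ 2) - δ := by
        linarith
      rw [hn]
      field_simp
      ring

/-! ### Convexity of `-log d` -/

/-- Negative definiteness of the Hessian of `log d` at a point. -/
def LogConcaveAt (M : MetricCliffordModule V S₀ S₁) (X : Herm V S₀ S₁) : Prop :=
  ∀ U, U ≠ 0 → 2 * M.dV X * M.form (M.adjoint U) X < M.form (M.adjoint X) U ^ 2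

/-- The linear and quadratic coefficients in `c` of d(X + cU) are invariant under a linear map
preserving d, and the values at c = ±1 recover them. Injectivity keeps the image of `U` nonzero. -/
theorem LogConcaveAt.of_map {M : MetricCliffordModule V S₀ S₁} {X : Herm V S₀ S₁}
    (g : Herm V S₀ S₁ →ₗ[ℝ] Herm V S₀ S₁) (hg : ∀ Y, M.dV (g Y) = M.dV Y)
    (hinj : ∀ Y, g Y = 0 → Y = 0) (h : M.LogConcaveAt (g X)) : M.LogConcaveAt X := by
  intro U hU
  have h1 := h (g U) (fun e => hU (hinj U e))
  have e (c : ℝ) := M.dV_add_smul (g X) (g U) c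
  simp only [← map_smul, ← map_add, hg, dV_add_smul] at e
  have e1 := e 1
  have e2 := e (-1)
  have e3 : M.form (M.adjoint (g X)) (g U) = M.form (M.adjoint X) U := by linarith
  have e4 : M.form (M.adjoint (g U)) (g X) = M.form (M.adjoint U) X := by linarith
  rwa [e3, e4, hg] at h1

/-- Unipotent transformation with pivot `x₃` and parameter in `V`. -/
def shearV (M : MetricCliffordModule V S₀ S₁) (c : V) : Herm V S₀ S₁ →ₗ[ℝ] Herm V S₀ S₁ where
  toFun
    | (x₁, x₂, x₃, v, s, t) =>
      (x₁, x₂ + 2 * inner ℝ v c + x₃ * inner ℝ c c, x₃, v + x₃ • c, s + M.adj c t, t)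
  map_add' := by
    rintro ⟨x₁, x₂, x₃, v, s, t⟩ ⟨y₁, y₂, y₃, v', s', t'⟩
    simp only [Prod.mk_add_mk, inner_add_left, adj_add_right, Prod.mk.injEq, true_and, and_true]
    exact ⟨by ring, by module, by module⟩
  map_smul' := by
    rintro r ⟨x₁, x₂, x₃, v, s, t⟩
    simp only [Prod.smul_mk, real_inner_smul_left, adj_smul_right, Prod.mk.injEq, true_and,
      and_true, smul_eq_mul, RingHom.id_apply]
    exact ⟨by ring, by module, by module⟩

/-- Unipotent transformation with pivot `x₃` and parameter in `S₁`. -/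
def shearS₁ (M : MetricCliffordModule V S₀ S₁) (b : S₁) : Herm V S₀ S₁ →ₗ[ℝ] Herm V S₀ S₁ where
  toFun
    | (x₁, x₂, x₃, v, s, t) =>
      (x₁ + 2 * inner ℝ t b + x₃ * inner ℝ b b, x₂, x₃, v, s + M.adj v b, t + x₃ • b)
  map_add' := by
    rintro ⟨x₁, x₂, x₃, v, s, t⟩ ⟨y₁, y₂, y₃, v', s', t'⟩
    simp only [Prod.mk_add_mk, inner_add_left, adj_add_left, Prod.mk.injEq, true_and]
    exact ⟨by ring, by module, by module⟩
  map_smul' := by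
    rintro r ⟨x₁, x₂, x₃, v, s, t⟩
    simp only [Prod.smul_mk, real_inner_smul_left, adj_smul_left, Prod.mk.injEq, true_and,
      smul_eq_mul, RingHom.id_apply]
    exact ⟨by ring, by module, by module⟩

/-- Unipotent transformation with pivot `x₂` and parameter in `S₀`. -/
def shearS₀ (M : MetricCliffordModule V S₀ S₁) (a : S₀) : Herm V S₀ S₁ →ₗ[ℝ] Herm V S₀ S₁ where
  toFun
    | (x₁, x₂, x₃, v, s, t) =>
      (x₁ + 2 * inner ℝ s a + x₂ * inner ℝ a a, x₂, x₃, v, s + x₂ • a, t + M.mul₀ v a)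
  map_add' := by
    rintro ⟨x₁, x₂, x₃, v, s, t⟩ ⟨y₁, y₂, y₃, v', s', t'⟩
    simp only [Prod.mk_add_mk, inner_add_left, map_add, LinearMap.add_apply, Prod.mk.injEq,
      true_and]
    exact ⟨by ring, by module, by module⟩
  map_smul' := by
    rintro r ⟨x₁, x₂, x₃, v, s, t⟩
    simp only [Prod.smul_mk, real_inner_smul_left, map_smul, LinearMap.smul_apply, Prod.mk.injEq,
      true_and, smul_eq_mul, RingHom.id_apply]
    exact ⟨by ring, by module, by module⟩

theorem dV_shearV (M : MetricCliffordModule V S₀ S₁) (c : V) (X : Herm V S₀ S₁) :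
    M.dV (M.shearV c X) = M.dV X := by
  obtain ⟨x₁, x₂, x₃, v, s, t⟩ := X
  have h1 : inner ℝ (M.mul₀ v (M.adj c t)) t = inner ℝ v c * inner ℝ t t := by
    rw [← inner_adj, inner_adj_adj_left]
  have h2 : inner ℝ s (M.adj c t) = inner ℝ (M.mul₀ c s) t := by rw [real_inner_comm, inner_adj]
  simp only [shearV, LinearMap.coe_mk, AddHom.coe_mk, dV, ← real_inner_self_eq_norm_sq,
    inner_add_left, inner_add_right, real_inner_smul_left, real_inner_smul_right, map_add, map_smul,
    LinearMap.add_apply, LinearMap.smul_apply, inner_adj, mul₀_adj, h1, h2, real_inner_comm v c]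
  ring

theorem dV_shearS₁ (M : MetricCliffordModule V S₀ S₁) (b : S₁) (X : Herm V S₀ S₁) :
    M.dV (M.shearS₁ b X) = M.dV X := by
  obtain ⟨x₁, x₂, x₃, v, s, t⟩ := X
  have h2 : inner ℝ s (M.adj v b) = inner ℝ (M.mul₀ v s) b := by rw [real_inner_comm, inner_adj]
  simp only [shearS₁, LinearMap.coe_mk, AddHom.coe_mk, dV, ← real_inner_self_eq_norm_sq,
    inner_add_left, inner_add_right, real_inner_smul_left, real_inner_smul_right, map_add,
    LinearMap.add_apply, inner_adj, mul₀_adj, h2, real_inner_comm t b]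
  ring

theorem dV_shearS₀ (M : MetricCliffordModule V S₀ S₁) (a : S₀) (X : Herm V S₀ S₁) :
    M.dV (M.shearS₀ a X) = M.dV X := by
  obtain ⟨x₁, x₂, x₃, v, s, t⟩ := X
  simp only [shearS₀, LinearMap.coe_mk, AddHom.coe_mk, dV, ← real_inner_self_eq_norm_sq,
    inner_add_left, inner_add_right, real_inner_smul_left, real_inner_smul_right, map_add, map_smul,
    inner_mul₀_mul₀, real_inner_comm s a, real_inner_comm (M.mul₀ v a) t]
  ring

theorem logConcaveAt_diagonal (M : MetricCliffordModule V S₀ S₁) {x₁ x₂ x₃ : ℝ} (h₁ : 0 < x₁)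
    (h₂ : 0 < x₂) (h₃ : 0 < x₃) : M.LogConcaveAt (x₁, x₂, x₃, 0, 0, 0) := by
  rintro ⟨u₁, u₂, u₃, v, s, t⟩ hU
  have h : 0 < (u₁ * x₂ * x₃) ^ 2 + (x₁ * u₂ * x₃) ^ 2 + (x₁ * x₂ * u₃) ^ 2
      + 2 * (x₁ * x₂ * x₃) * (x₁ * ‖v‖ ^ 2 + x₂ * ‖t‖ ^ 2 + x₃ * ‖s‖ ^ 2) := by
    by_contra hc
    refine hU ?_
    have n1 := sq_nonneg (u₁ * x₂ * x₃)
    have n2 := sq_nonneg (x₁ * u₂ * x₃)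
    have n3 := sq_nonneg (x₁ * x₂ * u₃)
    have n4 : 0 ≤ 2 * (x₁ * x₂ * x₃) * (x₁ * ‖v‖ ^ 2) := by positivity
    have n5 : 0 ≤ 2 * (x₁ * x₂ * x₃) * (x₂ * ‖t‖ ^ 2) := by positivity
    have n6 : 0 ≤ 2 * (x₁ * x₂ * x₃) * (x₃ * ‖s‖ ^ 2) := by positivity
    have z1 : (u₁ * x₂ * x₃) ^ 2 = 0 := by linarith
    have z2 : (x₁ * u₂ * x₃) ^ 2 = 0 := by linarith
    have z3 : (x₁ * x₂ * u₃) ^ 2 = 0 := by linarith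
    have z4 : 2 * (x₁ * x₂ * x₃) * (x₁ * ‖v‖ ^ 2) = 0 := by linarith
    have z5 : 2 * (x₁ * x₂ * x₃) * (x₂ * ‖t‖ ^ 2) = 0 := by linarith
    have z6 : 2 * (x₁ * x₂ * x₃) * (x₃ * ‖s‖ ^ 2) = 0 := by linarith
    simp only [pow_eq_zero_iff, mul_eq_zero, norm_eq_zero, h₁.ne', h₂.ne', h₃.ne', or_false,
      false_or, ne_eq, OfNat.ofNat_ne_zero, not_false_eq_true] at z1 z2 z3 z4 z5 z6
    simp [z1, z2, z3, z4, z5, z6]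
  simp only [dV, adjoint, form_apply, norm_zero, inner_zero_left, inner_zero_right, map_zero,
    LinearMap.zero_apply, vec_zero_left, adj_zero_left, smul_zero, sub_zero]
  linarith

/-- Block elimination: the shears with parameters -v/x₃, -t/x₃ and -s/y₂ clear `v`, `t` and `s` in
turn while preserving d. The remaining diagonal matrix has two entries known to be positive, and d >
0 gives the third. -/
theorem logConcaveAt_of_mem_cone (M : MetricCliffordModule V S₀ S₁) {X : Herm V S₀ S₁}
    (hX : X ∈ M.cone) : M.LogConcaveAt X := by
  obtain ⟨x₁, x₂, x₃, v, s, t⟩ := X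
  obtain ⟨h3, hD, hd⟩ := (M.mem_cone_iff ..).1 hX
  refine .of_map (M.shearV (-x₃⁻¹ • v)) (M.dV_shearV _) ?_ ?_
  · rintro ⟨y₁, y₂, y₃, v', s', t'⟩ h
    simp only [shearV, LinearMap.coe_mk, AddHom.coe_mk, Prod.mk_eq_zero] at h
    obtain ⟨rfl, h2, rfl, h4, h5, rfl⟩ := h
    simp_all
  have hv : v + x₃ • -x₃⁻¹ • v = 0 := by
    rw [smul_smul, mul_neg, mul_inv_cancel₀ h3.ne']
    module
  rw [← M.dV_shearV (-x₃⁻¹ • v)] at hd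
  have hx2 : 0 < x₂ + 2 * inner ℝ v (-x₃⁻¹ • v) + x₃ * inner ℝ (-x₃⁻¹ • v) (-x₃⁻¹ • v) := by
    have e : x₂ + 2 * inner ℝ v (-x₃⁻¹ • v) + x₃ * inner ℝ (-x₃⁻¹ • v) (-x₃⁻¹ • v)
        = (x₂ * x₃ - ‖v‖ ^ 2) / x₃ := by
      simp only [real_inner_smul_left, real_inner_smul_right]
      rw [real_inner_self_eq_norm_sq]
      field_simp
      ring
    rw [e]
    positivity
  simp only [shearV, LinearMap.coe_mk, AddHom.coe_mk, hv] at hd ⊢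
  generalize x₂ + 2 * inner ℝ v (-x₃⁻¹ • v) + x₃ * inner ℝ (-x₃⁻¹ • v) (-x₃⁻¹ • v) = y₂
    at hx2 hd ⊢
  generalize s + M.adj (-x₃⁻¹ • v) t = s at hd ⊢
  refine .of_map (M.shearS₁ (-x₃⁻¹ • t)) (M.dV_shearS₁ _) ?_ ?_
  · rintro ⟨y₁, y₂, y₃, v', s', t'⟩ h
    simp only [shearS₁, LinearMap.coe_mk, AddHom.coe_mk, Prod.mk_eq_zero] at h
    obtain ⟨h1, rfl, rfl, rfl, h5, h6⟩ := h
    simp_all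
  have ht : t + x₃ • -x₃⁻¹ • t = 0 := by
    rw [smul_smul, mul_neg, mul_inv_cancel₀ h3.ne']
    module
  rw [← M.dV_shearS₁ (-x₃⁻¹ • t)] at hd
  simp only [shearS₁, LinearMap.coe_mk, AddHom.coe_mk, ht, adj_zero_left, add_zero] at hd ⊢
  generalize x₁ + 2 * inner ℝ t (-x₃⁻¹ • t) + x₃ * inner ℝ (-x₃⁻¹ • t) (-x₃⁻¹ • t) = y₁ at hd ⊢
  refine .of_map (M.shearS₀ (-y₂⁻¹ • s)) (M.dV_shearS₀ _) ?_ ?_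
  · rintro ⟨y₁, y₂, y₃, v', s', t'⟩ h
    simp only [shearS₀, LinearMap.coe_mk, AddHom.coe_mk, Prod.mk_eq_zero] at h
    obtain ⟨h1, rfl, rfl, rfl, h5, h6⟩ := h
    simp_all
  have hs : s + y₂ • -y₂⁻¹ • s = 0 := by
    rw [smul_smul, mul_neg, mul_inv_cancel₀ hx2.ne']
    module
  rw [← M.dV_shearS₀ (-y₂⁻¹ • s)] at hd
  simp only [shearS₀, LinearMap.coe_mk, AddHom.coe_mk, hs, map_zero, LinearMap.zero_apply,
    add_zero] at hd ⊢
  generalize y₁ + 2 * inner ℝ s (-y₂⁻¹ • s) + y₂ * inner ℝ (-y₂⁻¹ • s) (-y₂⁻¹ • s) = z₁ at hd ⊢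
  refine M.logConcaveAt_diagonal ?_ hx2 h3
  simp only [dV, norm_zero, inner_zero_right] at hd
  have : 0 < z₁ * (y₂ * x₃) := by linarith
  exact pos_of_mul_pos_left this (by positivity)

end MetricCliffordModule

namespace MetricCliffordModule

set_option linter.unusedSectionVars false
set_option linter.unusedSimpArgs false

variable {V S₀ S₁ : Type*}
  [NormedAddCommGroup V] [InnerProductSpace ℝ V] [FiniteDimensional ℝ V]
  [NormedAddCommGroup S₀] [InnerProductSpace ℝ S₀] [FiniteDimensional ℝ S₀]
  [NormedAddCommGroup S₁] [InnerProductSpace ℝ S₁] [FiniteDimensional ℝ S₁]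

/-! ### Self-adjoint cones have no defect -/

/-- The polarization of the quadratic adjoint. -/
def cross (M : MetricCliffordModule V S₀ S₁) : Herm V S₀ S₁ → Herm V S₀ S₁ → Herm V S₀ S₁
  | (x₁, x₂, x₃, v, s, t), (y₁, y₂, y₃, v', s', t') =>
    (x₂ * y₃ + y₂ * x₃ - 2 * inner ℝ v v', x₁ * y₃ + y₁ * x₃ - 2 * inner ℝ t t',
      x₁ * y₂ + y₁ * x₂ - 2 * inner ℝ s s', M.vec s t' + M.vec s' t - (x₁ • v' + y₁ • v),
      M.adj v t' + M.adj v' t - (x₃ • s' + y₃ • s),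
      M.mul₀ v s' + M.mul₀ v' s - (x₂ • t' + y₂ • t))

theorem adjoint_add (M : MetricCliffordModule V S₀ S₁) (X Y : Herm V S₀ S₁) :
    M.adjoint (X + Y) = M.adjoint X + M.cross X Y + M.adjoint Y := by
  obtain ⟨x₁, x₂, x₃, v, s, t⟩ := X
  obtain ⟨y₁, y₂, y₃, v', s', t'⟩ := Y
  simp only [Prod.mk_add_mk, adjoint, cross, Prod.mk.injEq, vec_add_left, vec_add_right,
    adj_add_left, adj_add_right, map_add, LinearMap.add_apply, norm_add_sq_real]
  exact ⟨by ring, by ring, by ring, by module, by module, by module⟩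

theorem cross_add_left (M : MetricCliffordModule V S₀ S₁) (X Y Z : Herm V S₀ S₁) :
    M.cross (X + Y) Z = M.cross X Z + M.cross Y Z := by
  obtain ⟨x₁, x₂, x₃, v, s, t⟩ := X
  obtain ⟨y₁, y₂, y₃, v', s', t'⟩ := Y
  obtain ⟨z₁, z₂, z₃, w, a, b⟩ := Z
  simp only [Prod.mk_add_mk, cross, Prod.mk.injEq, vec_add_left, vec_add_right,
    adj_add_left, adj_add_right, map_add, LinearMap.add_apply, inner_add_left]
  exact ⟨by ring, by ring, by ring, by module, by module, by module⟩

theorem cross_smul_left (M : MetricCliffordModule V S₀ S₁) (c : ℝ) (X Z : Herm V S₀ S₁) :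
    M.cross (c • X) Z = c • M.cross X Z := by
  obtain ⟨x₁, x₂, x₃, v, s, t⟩ := X
  obtain ⟨z₁, z₂, z₃, w, a, b⟩ := Z
  simp only [Prod.smul_mk, cross, Prod.mk.injEq, vec_smul_left, smul_eq_mul,
    vec_smul_right, adj_smul_left, adj_smul_right, map_smul, LinearMap.smul_apply,
    real_inner_smul_left]
  exact ⟨by ring, by ring, by ring, by module, by module, by module⟩

theorem cross_comm (M : MetricCliffordModule V S₀ S₁) (X Z : Herm V S₀ S₁) :
    M.cross X Z = M.cross Z X := by
  have h := M.adjoint_add X Z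
  rw [add_comm X, adjoint_add] at h
  linear_combination (norm := module) -h

theorem cross_smul_right (M : MetricCliffordModule V S₀ S₁) (c : ℝ) (X Z : Herm V S₀ S₁) :
    M.cross X (c • Z) = c • M.cross X Z := by
  rw [cross_comm, cross_smul_left, cross_comm]

theorem form_add_left (M : MetricCliffordModule V S₀ S₁) (X Y Z : Herm V S₀ S₁) :
    M.form (X + Y) Z = M.form X Z + M.form Y Z := by
  rw [form_comm, form_add_right, M.form_comm Z, M.form_comm Z]

theorem form_smul_left (M : MetricCliffordModule V S₀ S₁) (c : ℝ) (X Y : Herm V S₀ S₁) :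
    M.form (c • X) Y = c * M.form X Y := by
  rw [form_comm, form_smul_right, form_comm]

theorem form_adjoint_self (M : MetricCliffordModule V S₀ S₁) (X : Herm V S₀ S₁) :
    M.form (M.adjoint X) X = 3 * M.dV X := by
  have e := M.dV_add_smul X X 1
  have e2 : X + (1 : ℝ) • X = (2 : ℝ) • X := by module
  rw [e2, dV_smul] at e
  linarith

/-- Unipotent transformation with pivot `x₁`, which preserves the dual cone. -/
def dualShear (M : MetricCliffordModule V S₀ S₁) (a : S₀) (b : S₁) :
    Herm V S₀ S₁ →ₗ[ℝ] Herm V S₀ S₁ where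
  toFun
    | (x₁, x₂, x₃, v, s, t) =>
      (x₁, x₂ + 2 * inner ℝ s a + x₁ * inner ℝ a a, x₃ + 2 * inner ℝ t b + x₁ * inner ℝ b b,
        v + M.vec s b + M.vec a t + x₁ • M.vec a b, s + x₁ • a, t + x₁ • b)
  map_add' := by
    rintro ⟨x₁, x₂, x₃, v, s, t⟩ ⟨y₁, y₂, y₃, v', s', t'⟩
    simp only [Prod.mk_add_mk, inner_add_left, vec_add_left, vec_add_right, Prod.mk.injEq, true_and]
    exact ⟨by ring, by ring, by module, by module, by module⟩
  map_smul' := by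
    rintro r ⟨x₁, x₂, x₃, v, s, t⟩
    simp only [Prod.smul_mk, real_inner_smul_left, vec_smul_left, vec_smul_right, Prod.mk.injEq,
      true_and, smul_eq_mul, RingHom.id_apply]
    exact ⟨by ring, by ring, by module, by module, by module⟩

theorem dualShear_mem_dualCone_iff (M : MetricCliffordModule V S₀ S₁) (a : S₀) (b : S₁)
    (X : Herm V S₀ S₁) : M.dualShear a b X ∈ M.dualCone ↔ X ∈ M.dualCone := by
  obtain ⟨x₁, x₂, x₃, v, s, t⟩ := X
  simp only [dualShear, LinearMap.coe_mk, AddHom.coe_mk, mem_dualCone_iff]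
  have h1 : x₁ * (x₂ + 2 * inner ℝ s a + x₁ * inner ℝ a a) - ‖s + x₁ • a‖ ^ 2
      = x₁ * x₂ - ‖s‖ ^ 2 := by
    rw [norm_add_sq_real, norm_smul, real_inner_smul_right, mul_pow, Real.norm_eq_abs, sq_abs,
      real_inner_self_eq_norm_sq]
    ring
  have h2 : x₁ * (x₃ + 2 * inner ℝ t b + x₁ * inner ℝ b b) - ‖t + x₁ • b‖ ^ 2
      = x₁ * x₃ - ‖t‖ ^ 2 := by
    rw [norm_add_sq_real, norm_smul, real_inner_smul_right, mul_pow, Real.norm_eq_abs, sq_abs,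
      real_inner_self_eq_norm_sq]
    ring
  have h3 : x₁ • (v + M.vec s b + M.vec a t + x₁ • M.vec a b) - M.vec (s + x₁ • a) (t + x₁ • b)
      = x₁ • v - M.vec s t := by
    simp only [vec_add_left, vec_add_right, vec_smul_left, vec_smul_right]
    module
  rw [h1, h2, h3]

/-- Seven values determine a sextic; only the three leading coefficients are needed later. -/
theorem polynomial_coeffs_eq_zero {c₀ c₁ c₂ c₃ c₄ c₅ c₆ : ℝ}
    (h : ∀ s : ℝ, c₀ + c₁ * s + c₂ * s ^ 2 + c₃ * s ^ 3 + c₄ * s ^ 4 + c₅ * s ^ 5 + c₆ * s ^ 6 = 0) :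
    c₄ = 0 ∧ c₅ = 0 ∧ c₆ = 0 := by
  have h0 := h 0
  have h1 := h 1
  have h2 := h (-1)
  have h3 := h 2
  have h4 := h (-2)
  have h5 := h 3
  have h6 := h (-3)
  norm_num at h0 h1 h2 h3 h4 h5 h6
  refine ⟨by linarith, by linarith, by linarith⟩

/-- The cubic `Y ↦ d(ℓ Y)` vanishes on the boundary of the dual cone, boundary points being
approached along segments. -/
def VanishesOnDualBoundary (M : MetricCliffordModule V S₀ S₁)
    (ℓ : Herm V S₀ S₁ →ₗ[ℝ] Herm V S₀ S₁) : Prop :=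
  ∀ Y Z, (∀ ε : ℝ, 0 < ε → Y + ε • Z ∈ M.dualCone) → Y ∉ M.dualCone → M.dV (ℓ Y) = 0

theorem VanishesOnDualBoundary.comp_dualShear {M : MetricCliffordModule V S₀ S₁}
    {ℓ : Herm V S₀ S₁ →ₗ[ℝ] Herm V S₀ S₁} (h : M.VanishesOnDualBoundary ℓ) (a : S₀) (b : S₁) :
    M.VanishesOnDualBoundary (ℓ ∘ₗ M.dualShear a b) := by
  intro Y Z hYZ hY
  refine h _ (M.dualShear a b Z) (fun ε hε => ?_) ?_
  · rw [← map_smul, ← map_add, dualShear_mem_dualCone_iff]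
    exact hYZ ε hε
  · rwa [dualShear_mem_dualCone_iff]

/-- The consequences of vanishing along a curve `s ↦ Y + s σ + s² ρ e`. -/
theorem coeffs_of_dV_curve (M : MetricCliffordModule V S₀ S₁) {Y σ e : Herm V S₀ S₁} {ρ : ℝ}
    (hρ : ρ ≠ 0) (h : ∀ s : ℝ, M.dV (Y + s • σ + (s ^ 2 * ρ) • e) = 0) :
    M.form (M.adjoint σ) e + ρ * M.form (M.adjoint e) Y = 0 ∧ M.form (M.adjoint e) σ = 0 ∧
      M.dV e = 0 := by
  have key (s : ℝ) : M.dV Y + M.form (M.adjoint Y) σ * s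
      + (M.form (M.adjoint σ) Y + ρ * M.form (M.adjoint Y) e) * s ^ 2
      + (M.dV σ + ρ * M.form (M.cross Y σ) e) * s ^ 3
      + (ρ * (M.form (M.adjoint σ) e + ρ * M.form (M.adjoint e) Y)) * s ^ 4
      + (ρ ^ 2 * M.form (M.adjoint e) σ) * s ^ 5 + (ρ ^ 3 * M.dV e) * s ^ 6 = 0 := by
    have h1 := h s
    rw [dV_add_smul, dV_add_smul, adjoint_add, adjoint_smul, cross_smul_right] at h1
    simp only [form_add_left, form_smul_left, form_add_right, form_smul_right] at h1
    linear_combination h1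
  obtain ⟨h4, h5, h6⟩ := polynomial_coeffs_eq_zero key
  simp only [mul_eq_zero, hρ, false_or, pow_eq_zero_iff, ne_eq, OfNat.ofNat_ne_zero,
    not_false_eq_true] at h4 h5 h6
  exact ⟨h4, h5, h6⟩

/-- The coefficient of s² is chosen so that x₁ (x₂x₃ - |v|²) = s²|a|²x₃, which makes the last
inequality of the dual cone an equality. Increasing x₁ by ε then leaves (x₁ + ε) ε (x₂x₃ - |v|²) >
0, so the point is a limit of points of the dual cone along a segment. -/
theorem curve_boundary_S₀ (M : MetricCliffordModule V S₀ S₁) {ℓ : Herm V S₀ S₁ →ₗ[ℝ] Herm V S₀ S₁}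
    (h : M.VanishesOnDualBoundary ℓ) (a : S₀) {x₂ x₃ : ℝ} {v : V} (h₃ : 0 < x₃)
    (hD : 0 < x₂ * x₃ - ‖v‖ ^ 2) (s : ℝ) :
    M.dV (ℓ (0, x₂, x₃, v, 0, 0) + s • ℓ (0, 0, 0, 0, a, 0) +
      (s ^ 2 * (‖a‖ ^ 2 * x₃ / (x₂ * x₃ - ‖v‖ ^ 2))) • ℓ (1, 0, 0, 0, 0, 0)) = 0 := by
  set x₁ := s ^ 2 * (‖a‖ ^ 2 * x₃ / (x₂ * x₃ - ‖v‖ ^ 2)) with hx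
  have h₁ : 0 ≤ x₁ := by positivity
  have e : x₁ * (x₂ * x₃ - ‖v‖ ^ 2) = s ^ 2 * ‖a‖ ^ 2 * x₃ := by
    rw [hx, mul_assoc, div_mul_cancel₀ _ hD.ne', mul_assoc]
  rw [← map_smul, ← map_smul, ← map_add, ← map_add]
  refine h _ (1, 0, 0, 0, 0, 0) (fun ε hε => ?_) ?_
  · simp only [Prod.smul_mk, Prod.mk_add_mk, smul_zero, add_zero, zero_add, smul_eq_mul, mul_one,
      mul_zero, mem_dualCone_iff, norm_zero, norm_smul, vec_zero_right, sub_zero, mul_pow,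
      Real.norm_eq_abs, sq_abs]
    have hp : 0 < x₁ + ε := by positivity
    have e' : 0 < x₃ * ((x₁ + ε) * x₂ - s ^ 2 * ‖a‖ ^ 2) - (x₁ + ε) * ‖v‖ ^ 2 := by
      have := mul_pos hε hD
      linarith
    have e2 : 0 < (x₁ + ε) * x₂ - s ^ 2 * ‖a‖ ^ 2 := by
      have : 0 < x₃ * ((x₁ + ε) * x₂ - s ^ 2 * ‖a‖ ^ 2) := by
        have : 0 ≤ (x₁ + ε) * ‖v‖ ^ 2 := by positivity
        linarith
      exact pos_of_mul_pos_right this h₃.le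
    refine ⟨hp, e2, ?_⟩
    have := mul_pos hp e'
    norm_num
    linarith
  · simp only [Prod.smul_mk, Prod.mk_add_mk, smul_zero, add_zero, zero_add, smul_eq_mul, mul_one,
      mul_zero, mem_dualCone_iff, norm_zero, norm_smul, vec_zero_right, sub_zero, mul_pow,
      Real.norm_eq_abs, sq_abs]
    rintro ⟨-, -, h6⟩
    norm_num at h6
    have : x₁ * (x₁ * (x₂ * x₃ - ‖v‖ ^ 2)) = x₁ * (s ^ 2 * ‖a‖ ^ 2 * x₃) := by rw [e]
    linarith

theorem curve_boundary_S₁ (M : MetricCliffordModule V S₀ S₁) {ℓ : Herm V S₀ S₁ →ₗ[ℝ] Herm V S₀ S₁}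
    (h : M.VanishesOnDualBoundary ℓ) (b : S₁) {x₂ x₃ : ℝ} {v : V} (h₂ : 0 < x₂)
    (hD : 0 < x₂ * x₃ - ‖v‖ ^ 2) (s : ℝ) :
    M.dV (ℓ (0, x₂, x₃, v, 0, 0) + s • ℓ (0, 0, 0, 0, 0, b) +
      (s ^ 2 * (‖b‖ ^ 2 * x₂ / (x₂ * x₃ - ‖v‖ ^ 2))) • ℓ (1, 0, 0, 0, 0, 0)) = 0 := by
  set x₁ := s ^ 2 * (‖b‖ ^ 2 * x₂ / (x₂ * x₃ - ‖v‖ ^ 2)) with hx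
  have h₁ : 0 ≤ x₁ := by positivity
  have e : x₁ * (x₂ * x₃ - ‖v‖ ^ 2) = s ^ 2 * ‖b‖ ^ 2 * x₂ := by
    rw [hx, mul_assoc, div_mul_cancel₀ _ hD.ne', mul_assoc]
  rw [← map_smul, ← map_smul, ← map_add, ← map_add]
  refine h _ (1, 0, 0, 0, 0, 0) (fun ε hε => ?_) ?_
  · simp only [Prod.smul_mk, Prod.mk_add_mk, smul_zero, add_zero, zero_add, smul_eq_mul, mul_one,
      mul_zero, mem_dualCone_iff, norm_zero, norm_smul, vec_zero_left, sub_zero, mul_pow,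
      Real.norm_eq_abs, sq_abs]
    have hp : 0 < x₁ + ε := by positivity
    have e' : 0 < x₂ * ((x₁ + ε) * x₃ - s ^ 2 * ‖b‖ ^ 2) - (x₁ + ε) * ‖v‖ ^ 2 := by
      have := mul_pos hε hD
      linarith
    refine ⟨hp, ?_, ?_⟩
    · norm_num
      positivity
    · have := mul_pos hp e'
      norm_num
      linarith
  · simp only [Prod.smul_mk, Prod.mk_add_mk, smul_zero, add_zero, zero_add, smul_eq_mul, mul_one,
      mul_zero, mem_dualCone_iff, norm_zero, norm_smul, vec_zero_left, sub_zero, mul_pow,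
      Real.norm_eq_abs, sq_abs]
    rintro ⟨-, -, h6⟩
    norm_num at h6
    have : x₁ * (x₁ * (x₂ * x₃ - ‖v‖ ^ 2)) = x₁ * (s ^ 2 * ‖b‖ ^ 2 * x₂) := by rw [e]
    linarith

/-- The cubic d ∘ ℓ has degree at most one in x₁. Along the boundary curves x₁ grows like s², so the
leading coefficients in s isolate the terms quadratic and cubic in x₁. Curves in both an `S₀` and an
`S₁` direction are needed, since their constants ρ depend differently on x₂ and x₃. -/
theorem form_adjoint_unit_eq_zero (M : MetricCliffordModule V S₀ S₁)
    {ℓ : Herm V S₀ S₁ →ₗ[ℝ] Herm V S₀ S₁} (h : M.VanishesOnDualBoundary ℓ) {a : S₀} (ha : a ≠ 0)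
    {b : S₁} (hb : b ≠ 0) (Y : Herm V S₀ S₁) :
    M.form (M.adjoint (ℓ (1, 0, 0, 0, 0, 0))) (ℓ Y) = 0 := by
  have hS₀ (a' : S₀) (ha' : a' ≠ 0) {x₂ x₃ : ℝ} {v : V} (h₃ : 0 < x₃)
      (hD : 0 < x₂ * x₃ - ‖v‖ ^ 2) :=
    M.coeffs_of_dV_curve (by have := norm_pos_iff.2 ha'; positivity)
      (M.curve_boundary_S₀ h a' h₃ hD)
  have hS₁ (b' : S₁) (hb' : b' ≠ 0) {x₂ x₃ : ℝ} {v : V} (h₂ : 0 < x₂)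
      (hD : 0 < x₂ * x₃ - ‖v‖ ^ 2) :=
    M.coeffs_of_dV_curve (by have := norm_pos_iff.2 hb'; positivity)
      (M.curve_boundary_S₁ h b' h₂ hD)
  set F := fun Y => M.form (M.adjoint (ℓ (1, 0, 0, 0, 0, 0))) (ℓ Y) with hF
  have Fadd (X Y) : F (X + Y) = F X + F Y := by simp only [hF, map_add, form_add_right]
  have Fsmul (c : ℝ) (X) : F (c • X) = c * F X := by simp only [hF, map_smul, form_smul_right]
  have F1 : F (1, 0, 0, 0, 0, 0) = 0 := by
    simp only [hF, form_adjoint_self]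
    rw [(hS₀ a ha (x₂ := 1) (x₃ := 1) (v := 0) one_pos (by norm_num)).2.2, mul_zero]
  have Fs (a' : S₀) : F (0, 0, 0, 0, a', 0) = 0 := by
    rcases eq_or_ne a' 0 with rfl | ha'
    · have := Fsmul 0 0
      rwa [zero_smul, zero_mul] at this
    · exact (hS₀ a' ha' (x₂ := 1) (x₃ := 1) (v := 0) one_pos (by norm_num)).2.1
  have Ft (b' : S₁) : F (0, 0, 0, 0, 0, b') = 0 := by
    rcases eq_or_ne b' 0 with rfl | hb'
    · have := Fsmul 0 0
      rwa [zero_smul, zero_mul] at this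
    · exact (hS₁ b' hb' (x₂ := 1) (x₃ := 1) (v := 0) one_pos (by norm_num)).2.1
  have na := norm_pos_iff.2 ha
  have nb := norm_pos_iff.2 hb
  -- Let G(x₂, x₃) be the coefficient of x₁² at v = 0. The `a`-curve has ρ = |a|² at both (1, 1) and
  -- (1, 2), so G(1, 1) = G(1, 2). The `b`-curve has ρ = |b|² and |b|²/2 there, so this common value
  -- is 0.
  have hκ : M.form (M.adjoint (ℓ (0, 0, 0, 0, a, 0))) (ℓ (1, 0, 0, 0, 0, 0)) = 0 := by
    have e1 := (hS₀ a ha (x₂ := 1) (x₃ := 1) (v := 0) one_pos (by norm_num)).1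
    have e2 := (hS₁ b hb (x₂ := 1) (x₃ := 1) (v := 0) one_pos (by norm_num)).1
    have e3 := (hS₀ a ha (x₂ := 1) (x₃ := 2) (v := 0) two_pos (by norm_num)).1
    have e4 := (hS₁ b hb (x₂ := 1) (x₃ := 2) (v := 0) one_pos (by norm_num)).1
    norm_num at e1 e2 e3 e4
    have e5 : ‖b‖ ^ 2 * M.form (M.adjoint (ℓ (1, 0, 0, 0, 0, 0))) (ℓ (0, 1, 1, 0, 0, 0)) = 0 := by
      have : ‖a‖ ^ 2 * (M.form (M.adjoint (ℓ (1, 0, 0, 0, 0, 0))) (ℓ (0, 1, 1, 0, 0, 0))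
        - M.form (M.adjoint (ℓ (1, 0, 0, 0, 0, 0))) (ℓ (0, 1, 2, 0, 0, 0))) = 0 := by linarith
      have := (mul_eq_zero.1 this).resolve_left (by positivity)
      rw [sub_eq_zero] at this
      rw [← this] at e4
      linarith
    rw [(mul_eq_zero.1 e5).resolve_left (by positivity)] at e1
    linarith
  have Fm {x₂ x₃ : ℝ} {v : V} (h₃ : 0 < x₃) (hD : 0 < x₂ * x₃ - ‖v‖ ^ 2) :
      F (0, x₂, x₃, v, 0, 0) = 0 := by
    have e := (hS₀ a ha h₃ hD).1
    rw [hκ, zero_add] at e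
    exact (mul_eq_zero.1 e).resolve_left (by positivity)
  change F Y = 0
  obtain ⟨y₁, y₂, y₃, v, s, t⟩ := Y
  -- Any (y₂, y₃, v) is the difference of (y₂ + N, y₃ + N, v) and N (1, 1, 0), both in the open
  -- region treated by `Fm`: the shifted diagonal entries are at least |v| + 1.
  set N := |y₂| + |y₃| + ‖v‖ + 1
  have n2 := neg_abs_le y₂
  have n3 := neg_abs_le y₃
  have m2 := abs_nonneg y₂
  have m3 := abs_nonneg y₃
  have mv := norm_nonneg v
  have k2 : ‖v‖ + 1 ≤ y₂ + N := by simp only [N]; linarith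
  have k3 : ‖v‖ + 1 ≤ y₃ + N := by simp only [N]; linarith
  have e : ((y₁, y₂, y₃, v, s, t) : Herm V S₀ S₁) = y₁ • (1, 0, 0, 0, 0, 0)
      + (0, y₂ + N, y₃ + N, v, 0, 0) + (-N) • (0, 1, 1, 0, 0, 0) + (0, 0, 0, 0, s, 0)
      + (0, 0, 0, 0, 0, t) := by
    simp
  rw [e, Fadd, Fadd, Fadd, Fadd, Fsmul, Fsmul, F1, Fs, Ft, Fm (by linarith),
    Fm one_pos (by norm_num)]
  · ring
  · nlinarith [mul_le_mul k2 k3 (by positivity) (by linarith)]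

/-- The shears with pivot x₁ move the unit e to e + r f + r² g. As they preserve the dual cone, the
adjoint of ℓ(e + r f + r² g) vanishes for every r, and its r⁴ coefficient is the adjoint of ℓ g.
Hence every term in the expansion of d(ℓ e + ℓ g) is zero, although e + g lies in the dual cone as
soon as the defect is positive. -/
theorem defect_eq_zero_of_vanishesOnDualBoundary (M : MetricCliffordModule V S₀ S₁)
    {ℓ : Herm V S₀ S₁ →ₗ[ℝ] Herm V S₀ S₁} (h : M.VanishesOnDualBoundary ℓ)
    (hpos : ∀ Y ∈ M.dualCone, 0 < M.dV (ℓ Y)) (a : S₀) (b : S₁) : M.defect a b = 0 := by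
  rcases eq_or_ne a 0 with rfl | ha
  · simp [defect]
  rcases eq_or_ne b 0 with rfl | hb
  · simp [defect]
  by_contra hne
  have hδ : 0 < M.defect a b := lt_of_le_of_ne (M.defect_nonneg a b) (Ne.symm hne)
  set e : Herm V S₀ S₁ := (1, 0, 0, 0, 0, 0) with he
  set f : Herm V S₀ S₁ := (0, 0, 0, 0, a, b) with hf
  set g : Herm V S₀ S₁ := (0, ‖a‖ ^ 2, ‖b‖ ^ 2, M.vec a b, 0, 0) with hg
  -- With first entry 1 and no spinors, the last minor of e + g is |a|²|b|² - |`M.vec a b`|², the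
  -- defect itself.
  have hmem : e + g ∈ M.dualCone := by
    simp only [he, hg, Prod.mk_add_mk, mem_dualCone_iff, add_zero, zero_add, norm_zero, one_mul,
      one_smul, vec_zero_left, sub_zero, zero_lt_one, true_and]
    have : 0 < ‖a‖ := norm_pos_iff.2 ha
    refine ⟨by norm_num; positivity, ?_⟩
    norm_num
    rw [defect] at hδ
    linarith
  have h0 : ∀ Y, M.form (M.adjoint (ℓ e)) (ℓ Y) = 0 := M.form_adjoint_unit_eq_zero h ha hb
  have h1 (r : ℝ) (Y : Herm V S₀ S₁) :
      M.form (M.adjoint (ℓ e + r • ℓ f + r ^ 2 • ℓ g)) (ℓ Y) = 0 := by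
    have h2 := M.form_adjoint_unit_eq_zero (h.comp_dualShear (r • a) (r • b)) ha hb
      (M.dualShear (-(r • a)) (-(r • b)) Y)
    -- The shear with opposite parameters is the inverse, so an arbitrary test vector is reached.
    have h3 : M.dualShear (r • a) (r • b) (M.dualShear (-(r • a)) (-(r • b)) Y) = Y := by
      obtain ⟨x₁, x₂, x₃, v, s, t⟩ := Y
      rw [← neg_smul, ← neg_smul]
      simp only [dualShear, LinearMap.coe_mk, AddHom.coe_mk, Prod.mk.injEq, true_and,
        inner_add_left, real_inner_smul_left, real_inner_smul_right, vec_add_left, vec_add_right,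
        vec_smul_left, vec_smul_right]
      exact ⟨by ring, by ring, by module, by module, by module⟩
    have h4 : M.dualShear (r • a) (r • b) (1, 0, 0, 0, 0, 0) = e + r • f + r ^ 2 • g := by
      simp only [dualShear, LinearMap.coe_mk, AddHom.coe_mk, he, hf, hg, Prod.smul_mk,
        Prod.mk_add_mk, real_inner_smul_left, real_inner_smul_right, vec_smul_left, vec_smul_right,
        inner_zero_left, vec_zero_left, vec_zero_right, Prod.mk.injEq, smul_eq_mul]
      rw [real_inner_self_eq_norm_sq, real_inner_self_eq_norm_sq]
      refine ⟨by ring, by ring, by ring, by module, by module, by module⟩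
    rw [LinearMap.comp_apply, LinearMap.comp_apply, h3, h4] at h2
    simpa only [map_add, map_smul] using h2
  have h2 (Y : Herm V S₀ S₁) : M.form (M.adjoint (ℓ g)) (ℓ Y) = 0 := by
    have key (r : ℝ) : M.form (M.adjoint (ℓ e)) (ℓ Y) + M.form (M.cross (ℓ e) (ℓ f)) (ℓ Y) * r
        + (M.form (M.adjoint (ℓ f)) (ℓ Y) + M.form (M.cross (ℓ e) (ℓ g)) (ℓ Y)) * r ^ 2
        + M.form (M.cross (ℓ f) (ℓ g)) (ℓ Y) * r ^ 3 + M.form (M.adjoint (ℓ g)) (ℓ Y) * r ^ 4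
        + 0 * r ^ 5 + 0 * r ^ 6 = 0 := by
      have h3 := h1 r Y
      rw [adjoint_add, adjoint_add, adjoint_smul, adjoint_smul, cross_smul_right, cross_smul_right,
        cross_add_left, cross_smul_left] at h3
      simp only [form_add_left, form_smul_left] at h3
      linear_combination h3
    exact (polynomial_coeffs_eq_zero key).1
  have h3 := hpos _ hmem
  have h4 := M.dV_add_smul (ℓ e) (ℓ g) 1
  have h5 := M.form_adjoint_self (ℓ e)
  have h6 := M.form_adjoint_self (ℓ g)
  rw [h0] at h5
  rw [h2] at h6
  rw [one_smul, ← map_add, h0, h2] at h4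
  linarith

/-- The inequalities of the cone persist weakly in the limit. If d stayed positive, x₃ = 0 would
force v = t = 0 and hence d = 0, while x₃ > 0 with x₂x₃ = |v|² would contradict `mul_dV_eq`. -/
theorem dV_eq_zero_of_segment (M : MetricCliffordModule V S₀ S₁) {X Z : Herm V S₀ S₁}
    (h : ∀ ε : ℝ, 0 < ε → X + ε • Z ∈ M.cone) (hX : X ∉ M.cone) : M.dV X = 0 := by
  have lim {f : ℝ → ℝ} (hf : Continuous f) (hp : ∀ ε, 0 < ε → 0 < f ε) : 0 ≤ f 0 := by
    have := hf.continuousWithinAt (s := Set.Ioi 0) (x := 0)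
    exact ge_of_tendsto this (by filter_upwards [self_mem_nhdsWithin] with ε hε using (hp ε hε).le)
  have hdV : 0 ≤ M.dV X := by
    have h1 := lim (f := fun ε => M.dV (X + ε • Z)) (by
      simp only [dV_add_smul]
      fun_prop) (fun ε hε => by
        obtain ⟨_, _, _, _, _, _⟩ := X
        obtain ⟨_, _, _, _, _, _⟩ := Z
        exact ((M.mem_cone_iff ..).1 (h ε hε)).2.2)
    simpa using h1
  obtain ⟨x₁, x₂, x₃, v, s, t⟩ := X
  obtain ⟨z₁, z₂, z₃, w, a, b⟩ := Z
  simp only [Prod.smul_mk, Prod.mk_add_mk, mem_cone_iff, smul_eq_mul] at h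
  have p3 : 0 ≤ x₃ := by
    simpa using lim (f := fun ε => x₃ + ε * z₃) (by fun_prop) (fun ε hε => (h ε hε).1)
  have pD : 0 ≤ x₂ * x₃ - ‖v‖ ^ 2 := by
    simpa using lim (f := fun ε => (x₂ + ε * z₂) * (x₃ + ε * z₃) - ‖v + ε • w‖ ^ 2) (by fun_prop)
      (fun ε hε => (h ε hε).2.1)
  -- This minor is not among the defining inequalities; its positivity on the cone follows from
  -- `mul_dV_eq`.
  have pT : 0 ≤ x₁ * x₃ - ‖t‖ ^ 2 := by
    have h1 := lim (f := fun ε => (x₁ + ε * z₁) * (x₃ + ε * z₃) - ‖t + ε • b‖ ^ 2) (by fun_prop)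
      (fun ε hε => by
        obtain ⟨h3, hD, hd⟩ := h ε hε
        have e := M.mul_dV_eq (x₁ + ε * z₁) (x₂ + ε * z₂) (x₃ + ε * z₃) (v + ε • w) (s + ε • a)
          (t + ε • b)
        have := mul_pos h3 hd
        have n := sq_nonneg (‖(x₃ + ε * z₃) • (s + ε • a) - M.adj (v + ε • w) (t + ε • b)‖)
        refine pos_of_mul_pos_left ?_ hD.le
        linarith)
    simpa using h1
  by_contra hne
  have hd : 0 < M.dV (x₁, x₂, x₃, v, s, t) := lt_of_le_of_ne hdV (Ne.symm hne)
  rcases p3.eq_or_lt with h3 | h3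
  · subst h3
    have hv : ‖v‖ = 0 := pow_eq_zero_iff two_ne_zero |>.1 (by linarith [sq_nonneg ‖v‖])
    have ht : ‖t‖ = 0 := pow_eq_zero_iff two_ne_zero |>.1 (by linarith [sq_nonneg ‖t‖])
    rw [norm_eq_zero] at hv ht
    subst hv ht
    simp [dV] at hd
  · refine hX ((M.mem_cone_iff ..).2 ⟨h3, lt_of_le_of_ne pD fun h0 => ?_, hd⟩)
    have e := M.mul_dV_eq x₁ x₂ x₃ v s t
    rw [← h0] at e
    have := mul_pos h3 hd
    linarith [sq_nonneg ‖x₃ • s - M.adj v t‖]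

theorem dV_pos_of_mem_cone (M : MetricCliffordModule V S₀ S₁) {X : Herm V S₀ S₁}
    (hX : X ∈ M.cone) : 0 < M.dV X := by
  obtain ⟨x₁, x₂, x₃, v, s, t⟩ := X
  exact ((M.mem_cone_iff ..).1 hX).2.2

theorem IsSelfAdjoint.defect_eq_zero {M : MetricCliffordModule V S₀ S₁} (h : M.IsSelfAdjoint)
    (s : S₀) (t : S₁) : M.defect s t = 0 := by
  obtain ⟨L, hL⟩ := h
  have hmem (Y : Herm V S₀ S₁) : L.symm Y ∈ M.cone ↔ Y ∈ M.dualCone := by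
    rw [← hL, ← L.apply_symm_apply Y, L.injective.mem_set_image, L.symm_apply_apply]
  refine M.defect_eq_zero_of_vanishesOnDualBoundary (ℓ := L.symm.toLinearMap) ?_ ?_ s t
  · intro Y Z hYZ hY
    refine M.dV_eq_zero_of_segment (Z := L.symm Z) (fun ε hε => ?_) ?_
    · have := (hmem _).2 (hYZ ε hε)
      rwa [map_add, map_smul] at this
    · exact fun hc => hY ((hmem _).1 hc)
  · intro Y hY
    exact M.dV_pos_of_mem_cone ((hmem _).2 hY)

end MetricCliffordModule

/-! ### Homogeneous polynomial functions -/

section IsHomPoly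

variable {σ τ : Type*}

/-- Functions given by a homogeneous polynomial of degree `n`. -/
def IsHomPoly (n : ℕ) (f : (σ → ℝ) → ℝ) : Prop :=
  ∃ P : MvPolynomial σ ℝ, P.IsHomogeneous n ∧ ∀ x, MvPolynomial.eval x P = f x

theorem IsHomPoly.add {n : ℕ} {f g : (σ → ℝ) → ℝ} (hf : IsHomPoly n f) (hg : IsHomPoly n g) :
    IsHomPoly n fun x => f x + g x := by
  obtain ⟨P, hP, eP⟩ := hf
  obtain ⟨Q, hQ, eQ⟩ := hg
  exact ⟨P + Q, hP.add hQ, fun x => by simp [eP, eQ]⟩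

theorem IsHomPoly.sub {n : ℕ} {f g : (σ → ℝ) → ℝ} (hf : IsHomPoly n f) (hg : IsHomPoly n g) :
    IsHomPoly n fun x => f x - g x := by
  obtain ⟨P, hP, eP⟩ := hf
  obtain ⟨Q, hQ, eQ⟩ := hg
  exact ⟨P - Q, hP.sub hQ, fun x => by simp [eP, eQ]⟩

theorem IsHomPoly.mul {m n : ℕ} {f g : (σ → ℝ) → ℝ} (hf : IsHomPoly m f) (hg : IsHomPoly n g) :
    IsHomPoly (m + n) fun x => f x * g x := by
  obtain ⟨P, hP, eP⟩ := hf
  obtain ⟨Q, hQ, eQ⟩ := hg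
  exact ⟨P * Q, hP.mul hQ, fun x => by simp [eP, eQ]⟩

theorem IsHomPoly.pow {m : ℕ} {f : (σ → ℝ) → ℝ} (hf : IsHomPoly m f) (n : ℕ) :
    IsHomPoly (m * n) fun x => f x ^ n := by
  obtain ⟨P, hP, eP⟩ := hf
  exact ⟨P ^ n, hP.pow n, fun x => by simp [eP]⟩

theorem IsHomPoly.const_mul {n : ℕ} {f : (σ → ℝ) → ℝ} (hf : IsHomPoly n f) (c : ℝ) :
    IsHomPoly n fun x => c * f x := by
  obtain ⟨P, hP, eP⟩ := hf
  exact ⟨MvPolynomial.C c * P, hP.C_mul c, fun x => by simp [eP]⟩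

theorem IsHomPoly.sum {κ : Type*} (s : Finset κ) {n : ℕ} {f : κ → (σ → ℝ) → ℝ}
    (hf : ∀ i, IsHomPoly n (f i)) : IsHomPoly n fun x => ∑ i ∈ s, f i x := by
  choose P hP eP using hf
  exact ⟨∑ i ∈ s, P i, .sum _ _ _ fun i _ => hP i, fun x => by simp [eP]⟩

theorem IsHomPoly.coord (i : σ) : IsHomPoly 1 fun x => x i :=
  ⟨.X i, MvPolynomial.isHomogeneous_X _ i, fun x => by simp⟩

theorem IsHomPoly.of_linear [Fintype σ] [DecidableEq σ] (l : (σ → ℝ) →ₗ[ℝ] ℝ) :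
    IsHomPoly 1 l := by
  have h : IsHomPoly 1 fun x : σ → ℝ => ∑ i, l (Pi.single i 1) * x i :=
    .sum _ fun i => (IsHomPoly.coord i).const_mul _
  convert h using 2 with x
  conv_lhs => rw [pi_eq_sum_univ' x]
  simp [mul_comm]

theorem IsHomPoly.comp {m n : ℕ} {f : (σ → ℝ) → ℝ} (hf : IsHomPoly m f)
    {g : (τ → ℝ) → σ → ℝ} (hg : ∀ i, IsHomPoly n fun y => g y i) :
    IsHomPoly (n * m) fun y => f (g y) := by
  obtain ⟨P, hP, eP⟩ := hf
  choose Q hQ eQ using hg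
  refine ⟨MvPolynomial.aeval Q P, hP.aeval Q hQ, fun y => ?_⟩
  change _ = f (g y)
  rw [← eP, ← MvPolynomial.coe_aeval_eq_eval, ← MvPolynomial.coe_aeval_eq_eval, RingHom.coe_coe,
    RingHom.coe_coe, ← AlgHom.comp_apply, MvPolynomial.comp_aeval]
  congr 2
  ext i
  simp [MvPolynomial.aeval_eq_eval, eQ]

end IsHomPoly

/-! ### Polynomiality of norms, of the cubic and of the defect -/

section Coordinates

set_option linter.unusedSectionVars false

variable {V S₀ S₁ : Type*}
  [NormedAddCommGroup V] [InnerProductSpace ℝ V] [FiniteDimensional ℝ V]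
  [NormedAddCommGroup S₀] [InnerProductSpace ℝ S₀] [FiniteDimensional ℝ S₀]
  [NormedAddCommGroup S₁] [InnerProductSpace ℝ S₁] [FiniteDimensional ℝ S₁]
  {σ ι : Type*} [Fintype σ] [DecidableEq σ] [Fintype ι] [DecidableEq ι]

theorem IsHomPoly.norm_sq {E : Type*} [NormedAddCommGroup E] [InnerProductSpace ℝ E]
    [FiniteDimensional ℝ E] (l : (σ → ℝ) →ₗ[ℝ] E) : IsHomPoly 2 fun x => ‖l x‖ ^ 2 := by
  have b := stdOrthonormalBasis ℝ E
  simp_rw [← b.sum_sq_inner_right]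
  exact .sum _ fun i => (IsHomPoly.of_linear (innerₛₗ ℝ (b i) ∘ₗ l)).pow 2

theorem IsHomPoly.inner_mul₀ (M : MetricCliffordModule V S₀ S₁) (v : V) (ls : (σ → ℝ) →ₗ[ℝ] S₀)
    (lt : (σ → ℝ) →ₗ[ℝ] S₁) : IsHomPoly 2 fun x => inner ℝ (M.mul₀ v (ls x)) (lt x) := by
  have c := stdOrthonormalBasis ℝ S₀
  have h : IsHomPoly 2 fun x => ∑ j, inner ℝ (c j) (ls x) * inner ℝ (M.mul₀ v (c j)) (lt x) :=
    .sum _ fun j => (IsHomPoly.of_linear (innerₛₗ ℝ (c j) ∘ₗ ls)).mul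
      (.of_linear (innerₛₗ ℝ (M.mul₀ v (c j)) ∘ₗ lt))
  convert h using 2 with x
  conv_lhs => rw [← c.sum_repr' (ls x)]
  simp [sum_inner, real_inner_smul_left]

/-- In an orthonormal basis of `V` the components of `M.vec s t` are the bilinear forms ⟪μ(bᵢ, s),
t⟫, so its squared norm is a quartic. -/
theorem IsHomPoly.defect (M : MetricCliffordModule V S₀ S₁) (ls : (σ → ℝ) →ₗ[ℝ] S₀)
    (lt : (σ → ℝ) →ₗ[ℝ] S₁) : IsHomPoly 4 fun x => M.defect (ls x) (lt x) := by
  have b := stdOrthonormalBasis ℝ V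
  refine ((IsHomPoly.norm_sq lt).mul (IsHomPoly.norm_sq ls)).sub ?_
  simp_rw [← b.sum_sq_inner_left, M.inner_vec]
  exact .sum _ fun i => (IsHomPoly.inner_mul₀ M (b i) ls lt).pow 2

theorem IsHomPoly.inner_mul₀_apply (M : MetricCliffordModule V S₀ S₁) (lv : (σ → ℝ) →ₗ[ℝ] V)
    (ls : (σ → ℝ) →ₗ[ℝ] S₀) (lt : (σ → ℝ) →ₗ[ℝ] S₁) :
    IsHomPoly 3 fun x => inner ℝ (M.mul₀ (lv x) (ls x)) (lt x) := by
  have b := stdOrthonormalBasis ℝ V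
  have h : IsHomPoly 3 fun x => ∑ j, inner ℝ (b j) (lv x) * inner ℝ (M.mul₀ (b j) (ls x)) (lt x) :=
    .sum _ fun j => (IsHomPoly.of_linear (innerₛₗ ℝ (b j) ∘ₗ lv)).mul
      (IsHomPoly.inner_mul₀ M (b j) ls lt)
  convert h using 2 with x
  conv_lhs => rw [← b.sum_repr' (lv x)]
  simp [sum_inner, real_inner_smul_left]

/-- The projection of `ℋ` to its `V` component. -/
def Herm.projV : Herm V S₀ S₁ →ₗ[ℝ] V :=
  LinearMap.fst ℝ _ _ ∘ₗ LinearMap.snd ℝ _ _ ∘ₗ LinearMap.snd ℝ _ _ ∘ₗ LinearMap.snd ℝ _ _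

/-- The projection of `ℋ` to its `S₀` component. -/
def Herm.projS₀ : Herm V S₀ S₁ →ₗ[ℝ] S₀ :=
  LinearMap.fst ℝ _ _ ∘ₗ LinearMap.snd ℝ _ _ ∘ₗ LinearMap.snd ℝ _ _ ∘ₗ LinearMap.snd ℝ _ _ ∘ₗ
    LinearMap.snd ℝ _ _

/-- The projection of `ℋ` to its `S₁` component. -/
def Herm.projS₁ : Herm V S₀ S₁ →ₗ[ℝ] S₁ :=
  LinearMap.snd ℝ _ _ ∘ₗ LinearMap.snd ℝ _ _ ∘ₗ LinearMap.snd ℝ _ _ ∘ₗ LinearMap.snd ℝ _ _ ∘ₗ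
    LinearMap.snd ℝ _ _

theorem IsHomPoly.dV (M : MetricCliffordModule V S₀ S₁) (l : (σ → ℝ) →ₗ[ℝ] Herm V S₀ S₁) :
    IsHomPoly 3 fun x => M.dV (l x) := by
  have h1 := IsHomPoly.of_linear (LinearMap.fst ℝ _ _ ∘ₗ l)
  have h2 := IsHomPoly.of_linear (LinearMap.fst ℝ _ _ ∘ₗ LinearMap.snd ℝ _ _ ∘ₗ l)
  have h3 := IsHomPoly.of_linear
    (LinearMap.fst ℝ _ _ ∘ₗ LinearMap.snd ℝ _ _ ∘ₗ LinearMap.snd ℝ _ _ ∘ₗ l)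
  have hv := IsHomPoly.norm_sq (Herm.projV ∘ₗ l)
  have hs := IsHomPoly.norm_sq (Herm.projS₀ ∘ₗ l)
  have ht := IsHomPoly.norm_sq (Herm.projS₁ ∘ₗ l)
  have hm := IsHomPoly.inner_mul₀_apply M (Herm.projV ∘ₗ l) (Herm.projS₀ ∘ₗ l) (Herm.projS₁ ∘ₗ l)
  exact (((((h1.mul h2).mul h3).sub (h1.mul hv)).sub (h2.mul ht)).sub (h3.mul hs)).add
    (hm.const_mul 2)

/-! ### Linear coordinates -/

theorem form_sharpCoord (M : MetricCliffordModule V S₀ S₁) (φ : (ι → ℝ) ≃ₗ[ℝ] Herm V S₀ S₁)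
    (w : ι → ℝ) (Y : Herm V S₀ S₁) :
    M.form (sharpCoord φ w) Y = ∑ a, w a * φ.symm Y a := by
  rw [sharpCoord, form_sharp]
  simp [Fintype.linearCombination_apply, mul_comm]

theorem sharpCoord_eq_iff (M : MetricCliffordModule V S₀ S₁) (φ : (ι → ℝ) ≃ₗ[ℝ] Herm V S₀ S₁)
    (w : ι → ℝ) (X : Herm V S₀ S₁) :
    sharpCoord φ w = X ↔ ∀ a, w a = M.form X (φ (Pi.single a 1)) := by
  constructor
  · rintro rfl a
    rw [form_sharpCoord, LinearEquiv.symm_apply_apply]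
    simp [Pi.single_apply]
  · intro h
    refine M.eq_of_forall_form_eq fun Z => ?_
    obtain ⟨z, rfl⟩ := φ.surjective Z
    rw [form_sharpCoord, LinearEquiv.symm_apply_apply]
    have h2 (y : ι → ℝ) : M.form X (φ y) = ∑ a, y a * M.form X (φ (Pi.single a 1)) := by
      let l : (ι → ℝ) →ₗ[ℝ] ℝ :=
        { toFun := fun y => M.form X (φ y)
          map_add' := fun _ _ => by rw [map_add, M.form_add_right]
          map_smul' := fun _ _ => by rw [map_smul, M.form_smul_right]; rfl }
      change l y = ∑ a, y a * l _
      conv_lhs => rw [pi_eq_sum_univ' y]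
      simp
    rw [h2]
    simp [h, mul_comm]

/-- The linear map `w ↦ w♯` from covectors to Hermitian matrices. -/
def sharpₗ (M : MetricCliffordModule V S₀ S₁) (φ : (ι → ℝ) ≃ₗ[ℝ] Herm V S₀ S₁) :
    (ι → ℝ) →ₗ[ℝ] Herm V S₀ S₁ where
  toFun := sharpCoord φ
  map_add' w w' := by
    rw [sharpCoord_eq_iff M]
    intro a
    rw [M.form_add_left, ← (sharpCoord_eq_iff M φ w _).1 rfl a,
      ← (sharpCoord_eq_iff M φ w' _).1 rfl a, Pi.add_apply]
  map_smul' c w := by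
    rw [sharpCoord_eq_iff M]
    intro a
    rw [RingHom.id_apply, M.form_smul_left, ← (sharpCoord_eq_iff M φ w _).1 rfl a, Pi.smul_apply,
      smul_eq_mul]

theorem sharpₗ_apply (M : MetricCliffordModule V S₀ S₁) (φ : (ι → ℝ) ≃ₗ[ℝ] Herm V S₀ S₁)
    (w : ι → ℝ) : sharpₗ M φ w = sharpCoord φ w := rfl

/-- The field is left general because the derivative is needed over ℝ for the Kähler potential and
over ℂ for the superpotential. -/
theorem hasFDerivAt_aeval {𝕜 : Type*} [NontriviallyNormedField 𝕜] [Algebra ℝ 𝕜]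
    (P : MvPolynomial ι ℝ) (z : ι → 𝕜) :
    HasFDerivAt (fun z : ι → 𝕜 => MvPolynomial.aeval z P)
      (∑ a, MvPolynomial.aeval z (MvPolynomial.pderiv a P) •
        (ContinuousLinearMap.proj a : (ι → 𝕜) →L[𝕜] 𝕜)) z := by
  induction P using MvPolynomial.induction_on with
  | C c =>
    have e : (fun z : ι → 𝕜 => MvPolynomial.aeval z (MvPolynomial.C c)) =
        fun _ => algebraMap ℝ 𝕜 c := by ext; simp
    rw [e]
    exact (hasFDerivAt_const (𝕜 := 𝕜) (algebraMap ℝ 𝕜 c) z).congr_fderiv (ContinuousLinearMap.ext fun y => by simp)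
  | add P Q hP hQ =>
    have e : (fun z : ι → 𝕜 => MvPolynomial.aeval z (P + Q)) =
        fun z => MvPolynomial.aeval z P + MvPolynomial.aeval z Q := by ext; simp
    rw [e]
    refine (hP.fun_add hQ).congr_fderiv ?_
    refine ContinuousLinearMap.ext fun y => ?_
    simp [add_mul, Finset.sum_add_distrib]
  | mul_X P n hP =>
    have e : (fun z : ι → 𝕜 => MvPolynomial.aeval z (P * MvPolynomial.X n)) =
        fun z => MvPolynomial.aeval z P * z n := by ext; simp
    rw [e]
    refine (hP.fun_mul (hasFDerivAt_apply n z)).congr_fderiv ?_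
    refine ContinuousLinearMap.ext fun y => ?_
    simp only [MvPolynomial.pderiv_mul, MvPolynomial.pderiv_X, map_add, map_mul,
      MvPolynomial.aeval_X, add_apply, smul_apply, sum_apply,
      ContinuousLinearMap.proj_apply, smul_eq_mul, add_mul,
      Finset.sum_add_distrib, Finset.mul_sum]
    rw [add_comm]
    congr 1
    · exact Finset.sum_congr rfl fun a _ => by ring
    · rw [Finset.sum_eq_single n]
      · simp
      · intro b _ hb
        simp [hb.symm]
      · simp

theorem hasDerivAt_eval_line (P : MvPolynomial ι ℝ) (x u : ι → ℝ) (t : ℝ) :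
    HasDerivAt (fun t : ℝ => MvPolynomial.eval (x + t • u) P)
      (∑ a, u a * MvPolynomial.eval (x + t • u) (MvPolynomial.pderiv a P)) t := by
  have h := (hasFDerivAt_aeval (𝕜 := ℝ) P (x + t • u)).comp_hasDerivAt t
    (((hasDerivAt_id t).smul_const u).const_add x)
  simpa [MvPolynomial.aeval_eq_eval, Function.comp_def, mul_comm] using h

variable (M : MetricCliffordModule V S₀ S₁) (φ : (ι → ℝ) ≃ₗ[ℝ] Herm V S₀ S₁)
  (k : ℝ) (d : MvPolynomial ι ℝ)

theorem isHomogeneous_of_eval (hd : ∀ x, MvPolynomial.eval x d = k * M.dV (φ x)) :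
    d.IsHomogeneous 3 := by
  obtain ⟨P, hP, eP⟩ := (IsHomPoly.dV M φ.toLinearMap).const_mul k
  rwa [MvPolynomial.funext (p := d) (q := P) fun x => by rw [hd, eP]; rfl]

theorem sum_mul_eval_pderiv (hd : ∀ x, MvPolynomial.eval x d = k * M.dV (φ x)) (x u : ι → ℝ) :
    ∑ a, u a * MvPolynomial.eval x (MvPolynomial.pderiv a d)
      = k * M.form (M.adjoint (φ x)) (φ u) := by
  have h1 := hasDerivAt_eval_line d x u 0
  rw [zero_smul, add_zero] at h1
  refine h1.unique ?_
  have h2 : HasDerivAt (fun t : ℝ => k * (M.dV (φ x) + t * M.form (M.adjoint (φ x)) (φ u)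
      + t ^ 2 * M.form (M.adjoint (φ u)) (φ x) + t ^ 3 * M.dV (φ u)))
      (k * (0 + 1 * M.form (M.adjoint (φ x)) (φ u)
        + (2 * (0 : ℝ) ^ 1 * 1) * M.form (M.adjoint (φ u)) (φ x)
        + (3 * (0 : ℝ) ^ 2 * 1) * M.dV (φ u))) 0 :=
    (((((hasDerivAt_const _ _).add ((hasDerivAt_id _).mul_const _)).add
      (((hasDerivAt_id _).pow 2).mul_const _)).add
      (((hasDerivAt_id _).pow 3).mul_const _)).const_mul k)
  have e : (fun t : ℝ => MvPolynomial.eval (x + t • u) d) = fun t : ℝ =>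
      k * (M.dV (φ x) + t * M.form (M.adjoint (φ x)) (φ u)
        + t ^ 2 * M.form (M.adjoint (φ u)) (φ x) + t ^ 3 * M.dV (φ u)) := by
    ext t
    rw [hd, map_add, map_smul, M.dV_add_smul]
  rw [e]
  refine h2.congr_deriv ?_
  ring

theorem sum_hMap_mul (hd : ∀ x, MvPolynomial.eval x d = k * M.dV (φ x)) (x u : ι → ℝ) :
    ∑ a, hMap d x a * u a = k / 3 * M.form (M.adjoint (φ x)) (φ u) := by
  have h := sum_mul_eval_pderiv M φ k d hd x u
  rw [div_mul_eq_mul_div, ← h, Finset.sum_div]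
  exact Finset.sum_congr rfl fun a _ => by rw [hMap]; ring

theorem sharpCoord_hMap (hd : ∀ x, MvPolynomial.eval x d = k * M.dV (φ x)) (x : ι → ℝ) :
    sharpCoord φ (hMap d x) = (k / 3) • M.adjoint (φ x) := by
  refine M.eq_of_forall_form_eq fun Z => ?_
  rw [form_sharpCoord, sum_hMap_mul M φ k d hd, LinearEquiv.apply_symm_apply, M.form_smul_left]

theorem sharpCoord_alpha (hd : ∀ x, MvPolynomial.eval x d = k * M.dV (φ x)) (p q : Option ι → ℝ) :
    sharpCoord φ (alpha d p q) = (k / 3) • M.adjoint (φ fun a => p (some a))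
      + (-(1 / 3) * p none) • sharpCoord φ fun a => q (some a) := by
  rw [← sharpCoord_hMap M φ k d hd, ← sharpₗ_apply M, ← sharpₗ_apply M, ← sharpₗ_apply M,
    ← map_smul, ← map_add]
  congr 1
  ext a
  simp only [alpha, Pi.add_apply, Pi.smul_apply, smul_eq_mul]
  ring

theorem frakdV_eq (X : Herm V S₀ S₁) :
    M.frakdV X = M.defect (Herm.projS₀ X) (Herm.projS₁ X) / X.1 := rfl

/-- Division by zero is harmless here: if the first entry or `c` vanishes, both sides are 0. Hence
the scaling law holds along a whole line, without exceptional parameters. -/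
theorem frakdV_smul (c : ℝ) (X : Herm V S₀ S₁) : M.frakdV (c • X) = c ^ 3 * M.frakdV X := by
  rcases eq_or_ne c 0 with rfl | hc
  · simp [frakdV_eq]
  · simp only [frakdV_eq, map_smul, MetricCliffordModule.defect, M.vec_smul_left, M.vec_smul_right,
      norm_smul, mul_pow, Real.norm_eq_abs, sq_abs, Prod.smul_fst, smul_eq_mul]
    rcases eq_or_ne X.1 0 with h | h
    · simp [h]
    · field_simp

/-- Euler's identity for the dual rational correction. -/
theorem sum_mul_gradThird_frakdDual (w : ι → ℝ) (hw : (sharpCoord φ w).1 ≠ 0) :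
    ∑ a, w a * gradThird (frakdDual M φ k) w a = frakdDual M φ k w := by
  obtain ⟨N, -, eN⟩ := IsHomPoly.defect M (Herm.projS₀ ∘ₗ sharpₗ M φ) (Herm.projS₁ ∘ₗ sharpₗ M φ)
  obtain ⟨D, -, eD⟩ := IsHomPoly.of_linear (LinearMap.fst ℝ _ _ ∘ₗ sharpₗ M φ)
  have e : frakdDual M φ k = fun w => 27 / k * (MvPolynomial.aeval w N / MvPolynomial.aeval w D) := by
    ext w
    rw [MvPolynomial.aeval_eq_eval]
    simp only [eN, eD]
    rfl
  have hdiff : DifferentiableAt ℝ (frakdDual M φ k) w := by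
    rw [e]
    simp only [div_eq_mul_inv]
    refine .const_mul ((hasFDerivAt_aeval N w).differentiableAt.fun_mul
      ((hasFDerivAt_aeval D w).differentiableAt.fun_inv ?_)) _
    rw [MvPolynomial.aeval_eq_eval, eD]
    exact hw
  have hline (u : ι → ℝ) : HasDerivAt (fun s : ℝ => frakdDual M φ k (w + s • u))
      (fderiv ℝ (frakdDual M φ k) w u) 0 := by
    have h1 : HasFDerivAt (frakdDual M φ k) (fderiv ℝ (frakdDual M φ k) w) (w + (0 : ℝ) • u) := by
      simpa using hdiff.hasFDerivAt
    have h := h1.comp_hasDerivAt (0 : ℝ) (((hasDerivAt_id (0 : ℝ)).smul_const u).const_add w)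
    simpa [Function.comp_def] using h
  have h1 : ∑ a, w a * gradThird (frakdDual M φ k) w a
      = (1 / 3) * fderiv ℝ (frakdDual M φ k) w w := by
    have h0 : fderiv ℝ (frakdDual M φ k) w w
        = ∑ a, w a * fderiv ℝ (frakdDual M φ k) w (Pi.single a 1) := by
      conv_lhs => enter [2]; rw [pi_eq_sum_univ' w]
      simp
    rw [h0, Finset.mul_sum]
    refine Finset.sum_congr rfl fun a _ => ?_
    rw [gradThird, (hline _).deriv]
    ring
  -- Along the radial line the function is (1 + s)³ times a constant; its derivative 3 at s = 0
  -- cancels the factor 1/3 of `gradThird`.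
  have h2 : (fun s : ℝ => frakdDual M φ k (w + s • w))
      = fun s => (1 + s) ^ 3 * frakdDual M φ k w := by
    ext s
    have e1 : w + s • w = (1 + s) • w := by module
    rw [e1, frakdDual, ← sharpₗ_apply M, map_smul, frakdV_smul, frakdDual, sharpₗ_apply]
    ring
  have h3 : HasDerivAt (fun s : ℝ => (1 + s) ^ 3 * frakdDual M φ k w)
      ((3 : ℕ) * (1 + (0 : ℝ)) ^ 2 * 1 * frakdDual M φ k w) 0 :=
    (((hasDerivAt_id (0 : ℝ)).const_add 1).pow 3).mul_const _
  have h4 := hline w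
  rw [h2] at h4
  rw [h1, h4.unique h3]
  push_cast
  ring

/-! ### The function `I₄` -/

theorem csqrt_sq (x : ℝ) : csqrt x ^ 2 = x := by
  rw [csqrt, one_div]
  exact Complex.cpow_nat_inv_pow _ two_ne_zero

/-- The quantity `(q₀ p⁰ + ⟪q, p⟫) p⁰ - 2 d(p)`. -/
def chargeJ (d : MvPolynomial ι ℝ) (p q : Option ι → ℝ) : ℝ :=
  (q none * p none + pairing q p) * p none - 2 * MvPolynomial.eval (fun a => p (some a)) d

/-- With A² = d' and B² = d' + 𝔡', the bracket is A²/B + 𝔡'/B = B, whatever branches of the roots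
are taken. Euler's identity is a hypothesis because it has two sources: differentiability when α₁ ≠
0, and 𝔡' = 0 in the symmetric case, where α₁ may vanish. -/
theorem I₄_eq {p q : Option ι → ℝ} (h : ∑ a, alpha d p q a *
      gradThird (frakdDual M φ k) (alpha d p q) a = frakdDual M φ k (alpha d p q)) :
    I₄ M φ k d p q = (((4 * (dDual M φ k (alpha d p q) + frakdDual M φ k (alpha d p q))
      - chargeJ d p q ^ 2) / p none ^ 2 : ℝ) : ℂ) := by
  have hA := csqrt_sq (dDual M φ k (alpha d p q))
  have hB := csqrt_sq (dDual M φ k (alpha d p q) + frakdDual M φ k (alpha d p q))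
  rw [I₄, frakA, frakB, h]
  set A := csqrt (dDual M φ k (alpha d p q))
  set B := csqrt (dDual M φ k (alpha d p q) + frakdDual M φ k (alpha d p q))
  have e : ((1 + (A / B - 1)) * A + (frakdDual M φ k (alpha d p q) : ℂ) / B) ^ 2
      = (dDual M φ k (alpha d p q) : ℂ) + frakdDual M φ k (alpha d p q) := by
    have e1 : (1 + (A / B - 1)) * A + (frakdDual M φ k (alpha d p q) : ℂ) / B = B := by
      push_cast at hB
      -- When B = 0 both quotients are 0 by convention, in agreement with the value B.
      rcases eq_or_ne B 0 with h0 | h0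
      · simp [h0]
      · field_simp
        rw [hB]
        linear_combination hA
    rw [e1, hB]
    push_cast
    ring
  rw [e]
  simp only [chargeJ]
  push_cast
  ring

/-- The denominator α₁ (p⁰)² has degree 2 + 2 = 4. It clears both (p⁰)² and the pole of 𝔡', and
leaves a numerator of degree 8. -/
theorem exists_rational_I₄ (hd : ∀ x, MvPolynomial.eval x d = k * M.dV (φ x)) :
    ∃ (m : ℕ) (N D : MvPolynomial (Option ι ⊕ Option ι) ℝ),
      N.IsHomogeneous (m + 4) ∧ D.IsHomogeneous m ∧ D ≠ 0 ∧
      ∀ p q : Option ι → ℝ, p none ≠ 0 → (sharpCoord φ (alpha d p q)).1 ≠ 0 →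
        MvPolynomial.eval (Sum.elim p q) D ≠ 0 ∧
        I₄ M φ k d p q =
          ((MvPolynomial.eval (Sum.elim p q) N / MvPolynomial.eval (Sum.elim p q) D : ℝ) : ℂ) := by
  have hom := isHomogeneous_of_eval M φ k d hd
  have hp (i : Option ι) : IsHomPoly 1 fun x : Option ι ⊕ Option ι → ℝ => x (.inl i) := .coord _
  have hq (i : Option ι) : IsHomPoly 1 fun x : Option ι ⊕ Option ι → ℝ => x (.inr i) := .coord _
  have hα (a : ι) : IsHomPoly 2 fun x : Option ι ⊕ Option ι → ℝ =>
      alpha d (fun i => x (.inl i)) (fun i => x (.inr i)) a := by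
    have h1 : IsHomPoly 2 fun x => MvPolynomial.eval x (MvPolynomial.pderiv a d) :=
      ⟨_, hom.pderiv, fun _ => rfl⟩
    have h2 := (h1.comp (g := fun (x : Option ι ⊕ Option ι → ℝ) b => x (.inl (some b)))
      fun b => hp (some b)).const_mul (1 / 3)
    have h3 := ((hp none).mul (hq (some a))).const_mul (1 / 3)
    convert h2.sub h3 using 2 with x
    simp only [alpha, hMap]
    ring
  have hJ : IsHomPoly 3 fun x : Option ι ⊕ Option ι → ℝ =>
      chargeJ d (fun i => x (.inl i)) (fun i => x (.inr i)) := by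
    have h1 : IsHomPoly 3 fun x => MvPolynomial.eval x d := ⟨_, hom, fun _ => rfl⟩
    have h2 := (h1.comp (g := fun (x : Option ι ⊕ Option ι → ℝ) b => x (.inl (some b)))
      fun b => hp (some b)).const_mul 2
    exact ((((hq none).mul (hp none)).add (.sum _ fun a => (hq (some a)).mul (hp (some a)))).mul
      (hp none)).sub h2
  have hα₁ := (IsHomPoly.of_linear (LinearMap.fst ℝ _ _ ∘ₗ sharpₗ M φ)).comp hα
  have hdV := (IsHomPoly.dV M (sharpₗ M φ)).comp hα
  have hdef := (IsHomPoly.defect M (Herm.projS₀ ∘ₗ sharpₗ M φ) (Herm.projS₁ ∘ₗ sharpₗ M φ)).comp hα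
  obtain ⟨N, hN, eN⟩ := (((hα₁.mul hdV).add hdef).const_mul (4 * (27 / k))).sub
    (hα₁.mul (hJ.pow 2))
  obtain ⟨D, hD, eD⟩ := hα₁.mul ((hp none).pow 2)
  have key (p q : Option ι → ℝ) (h0 : p none ≠ 0) (h1 : (sharpCoord φ (alpha d p q)).1 ≠ 0) :
      MvPolynomial.eval (Sum.elim p q) D ≠ 0 := by
    rw [eD]
    exact mul_ne_zero h1 (pow_ne_zero _ h0)
  refine ⟨4, N, D, hN, hD, ?_, fun p q h0 h1 => ⟨key p q h0 h1, ?_⟩⟩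
  · rintro rfl
    -- A charge where the denominator is nonzero: p⁰ = 1, the other p^a and q₀ zero, and q
    -- represented by the first diagonal unit, so that α₁ = -1/3.
    set w : ι → ℝ := fun a => M.form (1, 0, 0, 0, 0, 0) (φ (Pi.single a 1)) with hw
    refine key (fun i => i.elim 1 fun _ => 0) (fun i => i.elim 0 fun a => w a) one_ne_zero ?_
      (map_zero _)
    have h2 : sharpCoord φ w = (1, 0, 0, 0, 0, 0) := (sharpCoord_eq_iff M φ _ _).2 fun a => rfl
    rw [sharpCoord_alpha M φ k d hd]
    have e1 : φ (fun a : ι => (0 : ℝ)) = 0 := map_zero φ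
    have e2 : M.adjoint 0 = 0 := by
      have := M.adjoint_smul 0 0
      simpa using this
    simp only [Option.elim, e1, e2, h2]
    norm_num
  · rw [I₄_eq M φ k d (sum_mul_gradThird_frakdDual M φ k _ h1), eN, eD, dDual, frakdDual]
    congr 1
    change _ = (4 * (27 / k) * ((sharpCoord φ (alpha d p q)).1 * M.dV (sharpCoord φ (alpha d p q))
      + M.defect (Herm.projS₀ (sharpCoord φ (alpha d p q)))
        (Herm.projS₁ (sharpCoord φ (alpha d p q))))
      - (sharpCoord φ (alpha d p q)).1 * chargeJ d p q ^ 2)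
      / ((sharpCoord φ (alpha d p q)).1 * p none ^ 2)
    rw [frakdV_eq]
    generalize M.defect (Herm.projS₀ (sharpCoord φ (alpha d p q)))
        (Herm.projS₁ (sharpCoord φ (alpha d p q))) = δ
    generalize M.dV (sharpCoord φ (alpha d p q)) = c
    generalize (sharpCoord φ (alpha d p q)).1 = y at h1 ⊢
    rcases eq_or_ne k 0 with rfl | hk
    · simp
      field_simp
    · field_simp

theorem frakdDual_eq_zero (hM : ∀ s t, M.defect s t = 0) (w : ι → ℝ) : frakdDual M φ k w = 0 := by
  rw [frakdDual, frakdV_eq, hM, zero_div, mul_zero]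

theorem sum_mul_gradThird_dDual (u w : ι → ℝ) :
    ∑ a, u a * gradThird (dDual M φ k) w a
      = 9 / k * M.form (M.adjoint (sharpCoord φ w)) (sharpCoord φ u) := by
  have h (a : ι) : gradThird (dDual M φ k) w a
      = 9 / k * M.form (M.adjoint (sharpCoord φ w)) (sharpₗ M φ (Pi.single a 1)) := by
    rw [gradThird]
    set e := sharpₗ M φ (Pi.single a 1)
    set X := sharpCoord φ w
    have h1 : (fun s : ℝ => dDual M φ k (w + s • Pi.single a 1)) = fun s =>
        27 / k * (M.dV X + s * M.form (M.adjoint X) e + s ^ 2 * M.form (M.adjoint e) X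
          + s ^ 3 * M.dV e) := by
      ext s
      rw [dDual, ← sharpₗ_apply M, map_add, map_smul, M.dV_add_smul]
      rfl
    have h2 : HasDerivAt (fun s : ℝ =>
        27 / k * (M.dV X + s * M.form (M.adjoint X) e + s ^ 2 * M.form (M.adjoint e) X
          + s ^ 3 * M.dV e)) (27 / k * (0 + 1 * M.form (M.adjoint X) e
        + (2 * (0 : ℝ) ^ 1 * 1) * M.form (M.adjoint e) X + (3 * (0 : ℝ) ^ 2 * 1) * M.dV e)) 0 :=
      (((((hasDerivAt_const _ _).add ((hasDerivAt_id _).mul_const _)).add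
        (((hasDerivAt_id _).pow 2).mul_const _)).add
        (((hasDerivAt_id _).pow 3).mul_const _)).const_mul _)
    rw [h1, h2.deriv]
    ring
  simp only [h]
  rw [← sharpₗ_apply M φ u]
  let l : (ι → ℝ) →ₗ[ℝ] ℝ :=
    { toFun := fun y => 9 / k * M.form (M.adjoint (sharpCoord φ w)) (sharpₗ M φ y)
      map_add' := fun _ _ => by rw [map_add, M.form_add_right, mul_add]
      map_smul' := fun _ _ => by
        rw [map_smul, M.form_smul_right, RingHom.id_apply, smul_eq_mul]; ring }
  change ∑ a, u a * l _ = l u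
  conv_rhs => rw [pi_eq_sum_univ' u]
  simp

/-- Expand d'(α) in powers of p⁰. Since d(X#) = d(X)², the constant term 4 d(p)² is cancelled by J²;
since X## = d(X) X, the terms linear in p⁰ that contain ⟪q, p⟫ cancel as well. What is left is
divisible by (p⁰)². -/
theorem I₄_eq_quartic (hk : k ≠ 0) (hd : ∀ x, MvPolynomial.eval x d = k * M.dV (φ x))
    (hM : ∀ s t, M.defect s t = 0) (p q : Option ι → ℝ) (hp : p none ≠ 0) :
    I₄ M φ k d p q = (quartic M φ k d p q : ℂ) := by
  have hf : frakdDual M φ k = fun _ => 0 := funext (frakdDual_eq_zero M φ k hM)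
  rw [I₄_eq M φ k d (by simp [hf, gradThird])]
  congr 1
  rw [quartic, frakdDual_eq_zero M φ k hM, sum_mul_gradThird_dDual, dDual, dDual,
    sharpCoord_alpha M φ k d hd, sharpCoord_hMap M φ k d hd, chargeJ, hd]
  set X := φ fun a => p (some a) with hX
  set Q := sharpCoord φ fun a => q (some a) with hQ
  have h1 : pairing q p = M.form X Q := by
    rw [M.form_comm, hQ, form_sharpCoord, hX, LinearEquiv.symm_apply_apply]
    rfl
  have h2 := M.form_adjoint_self (M.adjoint X)
  rw [M.adjoint_adjoint hM, M.form_smul_left, M.form_comm, M.form_adjoint_self] at h2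
  have h3 : M.dV (M.adjoint X) = M.dV X ^ 2 := by linarith
  rw [M.dV_add_smul, M.dV_smul, h3, M.adjoint_smul, M.adjoint_adjoint hM, h1]
  simp only [M.form_smul_left, M.form_smul_right]
  generalize M.form X Q = π
  generalize M.form (M.adjoint Q) (M.adjoint X) = ω
  generalize M.dV X = D
  generalize M.dV Q = E
  field_simp
  ring

end Coordinates

/-! ### Near-horizon asymptotics -/

section Asymptotics

open Filter

/-- Midpoint convexity of G(x) - κx²/2 on [t, 3t]; the quadratic part contributes exactly κt². -/
theorem second_difference_le {G G' G'' : ℝ → ℝ} {t κ : ℝ} (ht : 0 < t)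
    (h1 : ∀ x, 0 < x → HasDerivAt G (G' x) x) (h2 : ∀ x, 0 < x → HasDerivAt G' (G'' x) x)
    (h : ∀ x ∈ Set.Ioo t (3 * t), κ ≤ G'' x) : κ * t ^ 2 ≤ G (3 * t) - 2 * G (2 * t) + G t := by
  have hconv : ConvexOn ℝ (Set.Icc t (3 * t)) fun x => G x - κ / 2 * x ^ 2 := by
    refine convexOn_of_hasDerivWithinAt2_nonneg (convex_Icc _ _) (f' := fun x => G' x - κ * x)
      (f'' := fun x => G'' x - κ) ?_ ?_ ?_ ?_
    · intro x hx
      exact ((h1 x (ht.trans_le hx.1)).continuousAt.sub (by fun_prop)).continuousWithinAt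
    · intro x hx
      rw [interior_Icc] at hx
      refine HasDerivAt.hasDerivWithinAt ?_
      have h3 : HasDerivAt (fun x : ℝ => κ / 2 * x ^ 2) (κ / 2 * ((2 : ℕ) * x ^ 1)) x :=
        (hasDerivAt_pow 2 x).const_mul _
      refine ((h1 x (ht.trans hx.1)).fun_sub h3).congr_deriv ?_
      push_cast
      ring
    · intro x hx
      rw [interior_Icc] at hx
      refine HasDerivAt.hasDerivWithinAt ?_
      have h3 : HasDerivAt (fun x : ℝ => κ * x) (κ * 1) x := (hasDerivAt_id x).const_mul _
      refine ((h2 x (ht.trans hx.1)).fun_sub h3).congr_deriv ?_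
      ring
    · intro x hx
      rw [interior_Icc] at hx
      linarith [h x hx]
  have m1 : t ∈ Set.Icc t (3 * t) := ⟨le_rfl, by linarith⟩
  have m2 : 3 * t ∈ Set.Icc t (3 * t) := ⟨by linarith, le_rfl⟩
  have h4 := And.right hconv m1 m2 (by norm_num : (0 : ℝ) ≤ 1 / 2) (by norm_num : (0 : ℝ) ≤ 1 / 2)
    (by norm_num)
  simp only [smul_eq_mul] at h4
  have e : (1 / 2 : ℝ) * t + 1 / 2 * (3 * t) = 2 * t := by ring
  rw [e] at h4
  linarith

/-- Second differences avoid any information on `G'`. If c > 0, then eventually G'' ≥ c/(2x²) ≥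
c/(18t²) on (t, 3t), so the second difference stays above c/18, although convergence of G makes it
tend to 0. -/
theorem nonpos_of_tendsto_sq_mul_deriv {G G' G'' : ℝ → ℝ} {c l : ℝ}
    (h1 : ∀ x, 0 < x → HasDerivAt G (G' x) x) (h2 : ∀ x, 0 < x → HasDerivAt G' (G'' x) x)
    (hc : Tendsto (fun x => x ^ 2 * G'' x) atTop (𝓝 c)) (hl : Tendsto G atTop (𝓝 l)) : c ≤ 0 := by
  by_contra! hpos
  obtain ⟨N, hN⟩ := eventually_atTop.1 (hc.eventually (lt_mem_nhds (half_lt_self hpos)))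
  have hlim : Tendsto (fun t => G (3 * t) - 2 * G (2 * t) + G t) atTop (𝓝 (l - 2 * l + l)) :=
    ((hl.comp (tendsto_id.const_mul_atTop (by norm_num : (0 : ℝ) < 3))).sub
      ((hl.comp (tendsto_id.const_mul_atTop (by norm_num : (0 : ℝ) < 2))).const_mul 2)).add hl
  have hge : c / 18 ≤ l - 2 * l + l := by
    refine ge_of_tendsto hlim ?_
    filter_upwards [eventually_gt_atTop (max N 0)] with t ht
    have ht0 : 0 < t := (le_max_right _ _).trans_lt ht
    have htN : N < t := (le_max_left _ _).trans_lt ht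
    have key := second_difference_le (κ := c / 18 / t ^ 2) ht0 h1 h2 fun x hx => by
      have hx0 : 0 < x := ht0.trans hx.1
      have h5 := hN x (htN.trans hx.1).le
      have h6 : x ^ 2 ≤ 9 * t ^ 2 := by nlinarith [hx.2]
      have h7 : 0 < G'' x := pos_of_mul_pos_right ((half_pos hpos).trans h5) (sq_nonneg x)
      rw [div_le_iff₀ (by positivity)]
      nlinarith [mul_le_mul_of_nonneg_right h6 h7.le]
    rwa [div_mul_cancel₀ _ (by positivity)] at key
  linarith

/-- For G = f + log the limit of t² G'' is c - 1, and the preceding bound applies to both G and -G.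
-/
theorem eq_one_of_tendsto_sq_mul_deriv {f : ℝ → ℝ} {c l : ℝ} (hf : ContDiffOn ℝ 2 f (Set.Ioi 0))
    (hc : Tendsto (fun t => t ^ 2 * deriv (deriv f) t) atTop (𝓝 c))
    (hl : Tendsto (fun t => f t + Real.log t) atTop (𝓝 l)) : c = 1 := by
  obtain ⟨d1, -, d2⟩ := (contDiffOn_succ_iff_deriv_of_isOpen (n := 1) isOpen_Ioi).1
    (by norm_num; exact hf)
  have d3 := d2.differentiableOn one_ne_zero
  have h1 (x : ℝ) (hx : 0 < x) : HasDerivAt (fun t => f t + Real.log t) (deriv f x + x⁻¹) x :=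
    ((d1 x hx).differentiableAt (Ioi_mem_nhds hx)).hasDerivAt.add (Real.hasDerivAt_log hx.ne')
  have h2 (x : ℝ) (hx : 0 < x) : HasDerivAt (fun t => deriv f t + t⁻¹)
      (deriv (deriv f) x + -(x ^ 2)⁻¹) x :=
    ((d3 x hx).differentiableAt (Ioi_mem_nhds hx)).hasDerivAt.add (hasDerivAt_inv hx.ne')
  have hlim : Tendsto (fun x => x ^ 2 * (deriv (deriv f) x + -(x ^ 2)⁻¹)) atTop (𝓝 (c - 1)) := by
    refine (hc.sub_const 1).congr' ?_
    filter_upwards [eventually_gt_atTop 0] with x hx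
    field_simp
    ring
  have up := nonpos_of_tendsto_sq_mul_deriv h1 h2 hlim hl
  have down := nonpos_of_tendsto_sq_mul_deriv (fun x hx => (h1 x hx).neg)
    (fun x hx => (h2 x hx).neg) (c := -(c - 1)) (by
      refine hlim.neg.congr fun x => ?_
      ring) hl.neg
  linarith

end Asymptotics

/-! ### Value of the black hole potential at the horizon -/

section Horizon

set_option linter.unusedSectionVars false

variable {ι : Type*} [Fintype ι] [DecidableEq ι]

/-- The horizon condition reads τ² e^{2U} → 1/m² and U + log τ → -log m. The equation for U then
gives τ² U'' → V_BH(z_o)/m², and this limit must be 1. -/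
theorem ExtremalBlackHole.potentialBH_zHor {d : MvPolynomial ι ℝ} {C : Set (ι → ℝ)}
    (B : ExtremalBlackHole d C) (hV : ContinuousAt (potentialBH d B.p B.q) B.zHor) :
    potentialBH d B.p B.q B.zHor = B.radius ^ 2 := by
  have hr := B.radius_pos
  have hinv : Filter.Tendsto (fun t : ℝ => t⁻¹) Filter.atTop (𝓝[>] 0) := tendsto_inv_atTop_nhdsGT_zero
  have hU : ContDiffOn ℝ 2 (fun t : ℝ => B.U t⁻¹) (Set.Ioi 0) := by
    refine B.contDiffOn_U.comp (t := Set.Ioi 0) (f := fun t : ℝ => t⁻¹) ?_ ?_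
    · exact fun t ht => (contDiffAt_inv ℝ (ne_of_gt ht)).contDiffWithinAt
    · exact fun t ht => Set.mem_Ioi.2 (inv_pos.2 ht)
  have hhor := B.horizon.comp hinv
  have hVlim := (hV.tendsto.comp B.tendsto_z).comp hinv
  have hc : Filter.Tendsto (fun t : ℝ => t ^ 2 * deriv (deriv fun t => B.U t⁻¹) t) Filter.atTop
      (𝓝 ((B.radius ^ 2)⁻¹ * potentialBH d B.p B.q B.zHor)) := by
    refine ((hhor.inv₀ (by positivity)).mul hVlim).congr' ?_
    filter_upwards [Filter.eventually_gt_atTop 0] with t ht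
    rw [B.equation_U t ht]
    simp only [Function.comp_apply, mul_inv, inv_pow, inv_inv, ← Real.exp_neg]
    ring_nf
  have hl : Filter.Tendsto (fun t : ℝ => B.U t⁻¹ + Real.log t) Filter.atTop
      (𝓝 (-(1 / 2) * Real.log (B.radius ^ 2))) := by
    refine ((hhor.log (by positivity)).const_mul (-(1 / 2))).congr' ?_
    filter_upwards [Filter.eventually_gt_atTop 0] with t ht
    simp only [Function.comp_apply]
    rw [Real.log_mul (by positivity) (Real.exp_ne_zero _), Real.log_exp, Real.log_pow, Real.log_inv]
    push_cast
    ring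
  have h1 := eq_one_of_tendsto_sq_mul_deriv hU hc hl
  field_simp at h1
  exact h1

/-! ### Wirtinger derivatives -/

/-- The imaginary part `z ↦ Im z` of `ℂⁿ`. -/
def imL : (ι → ℂ) →L[ℝ] (ι → ℝ) :=
  ContinuousLinearMap.pi fun a => Complex.imCLM ∘L ContinuousLinearMap.proj a

theorem imL_apply (z : ι → ℂ) : imL z = fun a => (z a).im := rfl

theorem imL_single_one (a : ι) : imL (Pi.single a (1 : ℂ)) = 0 := by
  ext b
  rcases eq_or_ne b a with rfl | h <;> simp [imL_apply, *]

theorem imL_single_I (a : ι) : imL (Pi.single a Complex.I) = Pi.single a 1 := by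
  ext b
  rcases eq_or_ne b a with rfl | h <;> simp [imL_apply, *]

theorem HasFDerivAt.ofReal_imL {F : (ι → ℝ) → ℝ} {F' : (ι → ℝ) →L[ℝ] ℝ} {z : ι → ℂ}
    (h : HasFDerivAt F F' (imL z)) :
    HasFDerivAt (fun w => (F (imL w) : ℂ)) (Complex.ofRealCLM ∘L F' ∘L imL) z :=
  Complex.ofRealCLM.hasFDerivAt.comp z (h.comp z imL.hasFDerivAt)

theorem wirt_ofReal_imL {F : (ι → ℝ) → ℝ} {F' : (ι → ℝ) →L[ℝ] ℝ} {z : ι → ℂ}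
    (h : HasFDerivAt F F' (imL z)) (a : ι) :
    wirt (fun w => (F (imL w) : ℂ)) z a = -(Complex.I / 2) * F' (Pi.single a 1) := by
  rw [wirt, (HasFDerivAt.ofReal_imL h).fderiv]
  simp only [ContinuousLinearMap.comp_apply, imL_single_one, imL_single_I, map_zero,
    Complex.ofRealCLM_apply]
  ring

theorem wirtBar_ofReal_imL {F : (ι → ℝ) → ℝ} {F' : (ι → ℝ) →L[ℝ] ℝ} {z : ι → ℂ}
    (h : HasFDerivAt F F' (imL z)) (a : ι) :
    wirtBar (fun w => (F (imL w) : ℂ)) z a = Complex.I / 2 * F' (Pi.single a 1) := by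
  rw [wirtBar, (HasFDerivAt.ofReal_imL h).fderiv]
  simp only [ContinuousLinearMap.comp_apply, imL_single_one, imL_single_I, map_zero,
    Complex.ofRealCLM_apply]
  ring

theorem wirt_mul {f g : (ι → ℂ) → ℂ} {z : ι → ℂ} (hf : DifferentiableAt ℝ f z)
    (hg : DifferentiableAt ℝ g z) (a : ι) :
    wirt (fun w => f w * g w) z a = f z * wirt g z a + wirt f z a * g z := by
  rw [wirt, fderiv_fun_mul hf hg, wirt, wirt]
  simp only [add_apply, smul_apply, smul_eq_mul]
  ring

theorem wirt_aeval (P : MvPolynomial ι ℝ) (z : ι → ℂ) (a : ι) :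
    wirt (fun w => MvPolynomial.aeval w P) z a = MvPolynomial.aeval z (MvPolynomial.pderiv a P) := by
  have h := ((hasFDerivAt_aeval (𝕜 := ℂ) P z).restrictScalars ℝ).fderiv
  rw [wirt, h]
  have e (c : ℂ) : (∑ b, MvPolynomial.aeval z (MvPolynomial.pderiv b P) •
      (ContinuousLinearMap.proj b : (ι → ℂ) →L[ℂ] ℂ)) (Pi.single a c)
      = MvPolynomial.aeval z (MvPolynomial.pderiv a P) * c := by
    simp only [sum_apply, smul_apply, ContinuousLinearMap.proj_apply, smul_eq_mul]
    rw [Finset.sum_eq_single a]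
    · simp
    · intro b _ hb
      simp [hb]
    · simp
  rw [ContinuousLinearMap.coe_restrictScalars', e, e]
  linear_combination (-(1 / 2) * MvPolynomial.aeval z (MvPolynomial.pderiv a P)) * Complex.I_sq

/-! ### The Kähler potential, its metric and the central charge -/

variable (d : MvPolynomial ι ℝ)

/-- The logarithmic gradient `∂_a d / d`. -/
def logGrad (y : ι → ℝ) (a : ι) : ℝ :=
  MvPolynomial.eval y (MvPolynomial.pderiv a d) / MvPolynomial.eval y d

theorem hasFDerivAt_eval (P : MvPolynomial ι ℝ) (y : ι → ℝ) :
    ∃ P' : (ι → ℝ) →L[ℝ] ℝ, HasFDerivAt (fun y => MvPolynomial.eval y P) P' y ∧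
      ∀ a, P' (Pi.single a 1) = MvPolynomial.eval y (MvPolynomial.pderiv a P) := by
  refine ⟨_, by simpa only [MvPolynomial.aeval_eq_eval] using hasFDerivAt_aeval (𝕜 := ℝ) P y,
    fun a => ?_⟩
  simp only [sum_apply, smul_apply, ContinuousLinearMap.proj_apply, smul_eq_mul]
  rw [Finset.sum_eq_single a]
  · simp
  · intro b _ hb
    simp [hb]
  · simp

theorem hasFDerivAt_neg_log (y : ι → ℝ) (hy : 0 < MvPolynomial.eval y d) :
    ∃ F' : (ι → ℝ) →L[ℝ] ℝ, HasFDerivAt (fun y => -Real.log (8 * MvPolynomial.eval y d)) F' y ∧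
      ∀ a, F' (Pi.single a 1) = -logGrad d y a := by
  obtain ⟨P', hP, eP⟩ := hasFDerivAt_eval d y
  refine ⟨_, ((hP.const_mul 8).log (by positivity)).neg, fun a => ?_⟩
  simp only [neg_apply, smul_apply, smul_eq_mul, eP, logGrad]
  field_simp

theorem wirt_kahler {z : ι → ℂ} (hz : 0 < MvPolynomial.eval (imL z) d) (a : ι) :
    wirt (fun u => (kahler d u : ℂ)) z a = Complex.I / 2 * logGrad d (imL z) a := by
  obtain ⟨F', hF, eF⟩ := hasFDerivAt_neg_log d _ hz
  refine (wirt_ofReal_imL hF a).trans ?_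
  rw [eF]
  push_cast
  ring

theorem wirtBar_kahler {z : ι → ℂ} (hz : 0 < MvPolynomial.eval (imL z) d) (a : ι) :
    wirtBar (fun u => (kahler d u : ℂ)) z a = -(Complex.I / 2) * logGrad d (imL z) a := by
  obtain ⟨F', hF, eF⟩ := hasFDerivAt_neg_log d _ hz
  refine (wirtBar_ofReal_imL hF a).trans ?_
  rw [eF]
  push_cast
  ring

theorem continuous_eval_imL (P : MvPolynomial ι ℝ) :
    Continuous fun z : ι → ℂ => MvPolynomial.eval (imL z) P :=
  (MvPolynomial.continuous_eval P).comp imL.continuous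

theorem eventually_eval_imL_pos {z : ι → ℂ} (hz : 0 < MvPolynomial.eval (imL z) d) :
    ∀ᶠ w in 𝓝 z, 0 < MvPolynomial.eval (imL w) d :=
  (continuous_eval_imL d).continuousAt.eventually (lt_mem_nhds hz)

/-- The Hessian `(1/4) ∂_a ∂_b (-log d)` as a real matrix. -/
def hessMatrix (y : ι → ℝ) : Matrix ι ι ℝ :=
  Matrix.of fun a b => (1 / 4) * (logGrad d y a * logGrad d y b
    - MvPolynomial.eval y (MvPolynomial.pderiv a (MvPolynomial.pderiv b d)) / MvPolynomial.eval y d)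

theorem kahlerMetric_eq {z : ι → ℂ} (hz : 0 < MvPolynomial.eval (imL z) d) :
    kahlerMetric d z = (hessMatrix d (imL z)).map Complex.ofReal := by
  ext a b
  obtain ⟨P', hP, eP⟩ := hasFDerivAt_eval d (imL z)
  obtain ⟨Q', hQ, eQ⟩ := hasFDerivAt_eval (MvPolynomial.pderiv b d) (imL z)
  have hdiv : HasFDerivAt (fun y => logGrad d y b) _ (imL z) :=
    hQ.fun_mul ((hasDerivAt_inv hz.ne').comp_hasFDerivAt (imL z) hP)
  -- A second derivative needs the first one on a neighbourhood, not only at `z`.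
  have hev : (fun w => wirtBar (fun u => (kahler d u : ℂ)) w b) =ᶠ[𝓝 z]
      fun w => -(Complex.I / 2) * (logGrad d (imL w) b : ℂ) := by
    filter_upwards [eventually_eval_imL_pos d hz] with w hw
    exact wirtBar_kahler d hw b
  have h1 : wirt (fun w => wirtBar (fun u => (kahler d u : ℂ)) w b) z a
      = wirt (fun w => -(Complex.I / 2) * (logGrad d (imL w) b : ℂ)) z a := by
    rw [wirt, wirt, hev.fderiv_eq]
  have h2 := wirt_mul (f := fun _ => -(Complex.I / 2)) (differentiableAt_const _)
    (HasFDerivAt.ofReal_imL hdiv).differentiableAt a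
  have h3 : wirt (fun _ : ι → ℂ => -(Complex.I / 2)) z a = 0 := by simp [wirt]
  rw [kahlerMetric, Matrix.of_apply, h1, h2, h3, wirt_ofReal_imL hdiv, Matrix.map_apply,
    hessMatrix, Matrix.of_apply]
  simp only [add_apply, smul_apply, smul_eq_mul, eP, eQ, logGrad]
  set D := MvPolynomial.eval (imL z) d
  have hD : (D : ℂ) ≠ 0 := Complex.ofReal_ne_zero.2 hz.ne'
  push_cast
  field_simp
  rw [Complex.I_sq]
  ring

/-- The superpotential `p^I F_I - q_I X^I` along the section `X = (1, z)`. -/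
def superpotential (p q : Option ι → ℝ) : MvPolynomial ι ℝ :=
  -MvPolynomial.C (p none) * d + ∑ a, MvPolynomial.C (p (some a)) * MvPolynomial.pderiv a d
    - MvPolynomial.C (q none) - ∑ a, MvPolynomial.C (q (some a)) * MvPolynomial.X a

theorem dPrepotential_lift_none (z : ι → ℂ) :
    dPrepotential d (lift z) none = -MvPolynomial.aeval z d := by
  have e : (fun s : ℂ => prepotential d (lift z + s • Pi.single none 1))
      = fun s => MvPolynomial.aeval z d * (1 + s)⁻¹ := by
    ext s
    simp [prepotential, lift, div_eq_mul_inv]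
  rw [dPrepotential, e]
  have h1 : HasDerivAt (fun s : ℂ => (1 + s)⁻¹) (-1 / (1 + 0) ^ 2) 0 :=
    HasDerivAt.fun_inv ((hasDerivAt_id (0 : ℂ)).const_add 1) (by simp)
  rw [(h1.const_mul _).deriv]
  simp

theorem dPrepotential_lift_some (z : ι → ℂ) (a : ι) :
    dPrepotential d (lift z) (some a) = MvPolynomial.aeval z (MvPolynomial.pderiv a d) := by
  have e : (fun s : ℂ => prepotential d (lift z + s • Pi.single (some a) 1))
      = fun s => MvPolynomial.aeval (z + s • Pi.single a 1) d := by
    ext s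
    simp only [prepotential]
    have e1 : (lift z + s • Pi.single (some a) 1 : Option ι → ℂ) none = 1 := by simp [lift]
    have e2 : (fun b : ι => (lift z + s • Pi.single (some a) 1 : Option ι → ℂ) (some b))
        = z + s • Pi.single a 1 := by
      ext b
      simp [lift, Pi.single_apply]
    rw [e1, e2, div_one]
  rw [dPrepotential, e]
  have h0 := hasFDerivAt_aeval (𝕜 := ℂ) d z
  have e0 : z = z + (0 : ℂ) • Pi.single a 1 := by simp
  have h := HasFDerivAt.comp_hasDerivAt (0 : ℂ) (f := fun s : ℂ => z + s • Pi.single a (1 : ℂ))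
    (e0 ▸ h0) (((hasDerivAt_id (0 : ℂ)).smul_const (Pi.single a (1 : ℂ))).const_add z)
  refine h.deriv.trans ?_
  simp only [sum_apply, smul_apply, ContinuousLinearMap.proj_apply, smul_eq_mul]
  rw [Finset.sum_eq_single a]
  · simp
  · intro b _ hb
    simp [hb]
  · simp

theorem centralCharge_eq (p q : Option ι → ℝ) (z : ι → ℂ) :
    centralCharge d p q z =
      (Real.exp (kahler d z / 2) : ℂ) * MvPolynomial.aeval z (superpotential d p q) := by
  rw [centralCharge]
  congr 1
  rw [Fintype.sum_option]
  simp only [dPrepotential_lift_none, dPrepotential_lift_some, lift, superpotential, map_add,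
    map_sub, map_mul, map_neg, map_sum, MvPolynomial.aeval_C, MvPolynomial.aeval_X,
    Complex.coe_algebraMap, Finset.sum_sub_distrib]
  ring

/-- Differentiating the prefactor e^{𝒦/2} contributes half of ∂_a𝒦 and the connection term the other
half; ∂_a𝒦 = (i/2) ∂_a d / d. -/
theorem covCharge_eq (p q : Option ι → ℝ) {z : ι → ℂ} (hz : 0 < MvPolynomial.eval (imL z) d)
    (a : ι) : covCharge d p q z a = (Real.exp (kahler d z / 2) : ℂ) *
      (MvPolynomial.aeval z (MvPolynomial.pderiv a (superpotential d p q))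
        + Complex.I / 2 * logGrad d (imL z) a * MvPolynomial.aeval z (superpotential d p q)) := by
  obtain ⟨F', hF, eF⟩ := hasFDerivAt_neg_log d _ hz
  have hE : HasFDerivAt (fun y => Real.exp (-Real.log (8 * MvPolynomial.eval y d) / 2)) _ (imL z) :=
    (hF.mul_const (2 : ℝ)⁻¹).exp
  have h1 : centralCharge d p q = fun z => (Real.exp (kahler d z / 2) : ℂ) *
      MvPolynomial.aeval z (superpotential d p q) := funext (centralCharge_eq d p q)
  have h2 : wirt (fun z => (Real.exp (kahler d z / 2) : ℂ)) z a =
      Complex.I / 4 * logGrad d (imL z) a * Real.exp (kahler d z / 2) := by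
    refine (wirt_ofReal_imL hE a).trans ?_
    simp only [smul_apply, smul_eq_mul, eF]
    push_cast
    have e : Real.log (8 * MvPolynomial.eval (imL z) d) = -kahler d z := by
      simp [kahler, imL_apply]
    rw [← div_eq_mul_inv, e]
    push_cast
    ring_nf
  have h3 := wirt_mul (f := fun z => (Real.exp (kahler d z / 2) : ℂ))
    (g := fun z => MvPolynomial.aeval z (superpotential d p q)) (z := z)
    (HasFDerivAt.ofReal_imL hE).differentiableAt
    ((hasFDerivAt_aeval (𝕜 := ℂ) _ z).restrictScalars ℝ).differentiableAt a
  rw [covCharge, wirt_kahler d hz, h1, h3, wirt_aeval, h2]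
  ring

theorem inv_map_ofReal {A : Matrix ι ι ℝ} (hA : A.det ≠ 0) :
    (A.map Complex.ofReal)⁻¹ = A⁻¹.map Complex.ofReal := by
  refine Matrix.inv_eq_right_inv ?_
  have h : A.map Complex.ofReal * A⁻¹.map Complex.ofReal
      = (A * A⁻¹).map Complex.ofRealHom := (Matrix.map_mul (f := Complex.ofRealHom)).symm
  rw [h, Matrix.mul_nonsing_inv _ (isUnit_iff_ne_zero.2 hA)]
  simp

/-- The potential is defined through derivatives and a matrix inverse, so continuity is read off
from closed formulas valid near `z`, where d > 0 and the determinant stays nonzero. -/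
theorem continuousAt_potentialBH (p q : Option ι → ℝ) {z : ι → ℂ}
    (hz : 0 < MvPolynomial.eval (imL z) d) (hdet : (hessMatrix d (imL z)).det ≠ 0) :
    ContinuousAt (potentialBH d p q) z := by
  have hcd (P : MvPolynomial ι ℝ) := (continuous_eval_imL P).continuousAt (x := z)
  have hca (P : MvPolynomial ι ℝ) : ContinuousAt (fun z : ι → ℂ => MvPolynomial.aeval z P) z :=
    (hasFDerivAt_aeval (𝕜 := ℂ) P z).continuousAt
  have hlog (a : ι) : ContinuousAt (fun w => logGrad d (imL w) a) z :=
    (hcd _).div (hcd _) hz.ne'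
  have hhess : ContinuousAt (fun w => hessMatrix d (imL w)) z := by
    refine continuousAt_pi.2 fun a => continuousAt_pi.2 fun b => ?_
    exact (((hlog a).mul (hlog b)).sub ((hcd _).div (hcd _) hz.ne')).const_mul _
  have hinv : ContinuousAt (fun w => (hessMatrix d (imL w))⁻¹) z := by
    refine ContinuousAt.comp (f := fun w => hessMatrix d (imL w)) ?_ hhess
    refine continuousAt_matrix_inv _ ?_
    rw [Ring.inverse_eq_inv']
    exact continuousAt_inv₀ hdet
  have hinv' (a b : ι) : ContinuousAt (fun w => (hessMatrix d (imL w))⁻¹ a b) z :=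
    continuousAt_pi.1 (continuousAt_pi.1 hinv a) b
  have hK : ContinuousAt (fun w => (Real.exp (kahler d w / 2) : ℂ)) z := by
    refine Complex.continuous_ofReal.continuousAt.comp (Real.continuous_exp.continuousAt.comp ?_)
    exact ((((hcd d).const_mul 8).log (by positivity)).neg).div_const 2
  have hZ : ContinuousAt (centralCharge d p q) z := by
    rw [show centralCharge d p q = _ from funext (centralCharge_eq d p q)]
    exact hK.mul (hca _)
  have hev : (fun w => ‖centralCharge d p q w‖ ^ 2 + (∑ a, ∑ b,
      (((hessMatrix d (imL w))⁻¹ b a : ℝ) : ℂ) * ((Real.exp (kahler d w / 2) : ℂ) *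
      (MvPolynomial.aeval w (MvPolynomial.pderiv a (superpotential d p q))
        + Complex.I / 2 * logGrad d (imL w) a * MvPolynomial.aeval w (superpotential d p q))) *
      (starRingEnd ℂ) ((Real.exp (kahler d w / 2) : ℂ) *
      (MvPolynomial.aeval w (MvPolynomial.pderiv b (superpotential d p q))
        + Complex.I / 2 * logGrad d (imL w) b * MvPolynomial.aeval w (superpotential d p q)))).re)
      =ᶠ[𝓝 z] potentialBH d p q := by
    have hdet' := ContinuousAt.comp (f := fun w => hessMatrix d (imL w))
      continuous_id.matrix_det.continuousAt hhess
    filter_upwards [eventually_eval_imL_pos d hz, hdet'.eventually_ne hdet] with w hw hw'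
    have hw₀ : (hessMatrix d (imL w)).det ≠ 0 := hw'
    simp only [potentialBH, covCharge_eq d p q hw, kahlerMetric_eq d hw, inv_map_ofReal hw₀,
      Matrix.map_apply]
  refine ContinuousAt.congr ?_ hev
  refine (hZ.norm.pow 2).add (Complex.continuous_re.continuousAt.comp ?_)
  refine tendsto_finsetSum _ fun a _ => tendsto_finsetSum _ fun b _ => ?_
  have hcov (a : ι) := hK.mul ((hca (MvPolynomial.pderiv a (superpotential d p q))).add
    (((Complex.continuous_ofReal.continuousAt.comp (hlog a)).const_mul (Complex.I / 2)).mul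
      (hca (superpotential d p q))))
  exact ((Complex.continuous_ofReal.continuousAt.comp (hinv' b a)).mul (hcov a)).mul
    (Complex.continuous_conj.continuousAt.comp (hcov b))

/-- The inverse metric is real, symmetric and positive definite, so the Hermitian term is the sum of
its values on the real and imaginary parts of `Z_a`; both must vanish. -/
theorem covCharge_eq_zero_of_potentialBH_eq (p q : Option ι → ℝ) {z : ι → ℂ}
    (hz : 0 < MvPolynomial.eval (imL z) d) (hpos : (hessMatrix d (imL z)).PosDef)
    (h : potentialBH d p q z = ‖centralCharge d p q z‖ ^ 2) (a : ι) : covCharge d p q z a = 0 := by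
  have hinv := hpos.inv
  set N := (hessMatrix d (imL z))⁻¹ with hN
  set R : ι → ℝ := fun a => (covCharge d p q z a).re with hR
  set S : ι → ℝ := fun a => (covCharge d p q z a).im with hS
  have hsum : (∑ a, ∑ b, (kahlerMetric d z)⁻¹ b a * covCharge d p q z a *
      (starRingEnd ℂ) (covCharge d p q z b)).re = star R ⬝ᵥ N.mulVec R + star S ⬝ᵥ N.mulVec S := by
    rw [kahlerMetric_eq d hz, inv_map_ofReal hpos.det_pos.ne', ← hN]
    have hsymm (a b : ι) : N a b = N b a := by
      have := congrFun (congrFun hinv.1 a) b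
      simpa using this.symm
    have e (T : ι → ℝ) : star T ⬝ᵥ N.mulVec T = ∑ a, ∑ b, N b a * T a * T b := by
      simp only [dotProduct, Matrix.mulVec, Finset.mul_sum, Pi.star_apply, star_trivial]
      refine Finset.sum_congr rfl fun a _ => Finset.sum_congr rfl fun b _ => ?_
      rw [hsymm]
      ring
    rw [e, e, ← Finset.sum_add_distrib, Complex.re_sum]
    refine Finset.sum_congr rfl fun a _ => ?_
    rw [← Finset.sum_add_distrib, Complex.re_sum]
    refine Finset.sum_congr rfl fun b _ => ?_
    simp only [Matrix.map_apply, Complex.mul_re, Complex.mul_im, Complex.ofReal_re,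
      Complex.ofReal_im, Complex.conj_re, Complex.conj_im, hR, hS]
    ring
  rw [potentialBH, hsum] at h
  have nonneg (T : ι → ℝ) : 0 ≤ star T ⬝ᵥ N.mulVec T := by
    rcases eq_or_ne T 0 with rfl | hT
    · simp
    · exact (hinv.dotProduct_mulVec_pos hT).le
  have zero (T : ι → ℝ) (hT : star T ⬝ᵥ N.mulVec T = 0) : T = 0 := by
    by_contra hne
    exact (hinv.dotProduct_mulVec_pos hne).ne' hT
  have hR0 := zero R (by linarith [nonneg R, nonneg S])
  have hS0 := zero S (by linarith [nonneg R, nonneg S])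
  exact Complex.ext (congrFun hR0 a) (congrFun hS0 a)

end Horizon

section Attractor

set_option linter.unusedSectionVars false

variable {V S₀ S₁ : Type*}
  [NormedAddCommGroup V] [InnerProductSpace ℝ V] [FiniteDimensional ℝ V]
  [NormedAddCommGroup S₀] [InnerProductSpace ℝ S₀] [FiniteDimensional ℝ S₀]
  [NormedAddCommGroup S₁] [InnerProductSpace ℝ S₁] [FiniteDimensional ℝ S₁]
  {ι : Type*} [Fintype ι] [DecidableEq ι]

/-! ### Polarization of the cubic form and nondegeneracy on the cone -/

namespace MetricCliffordModule

theorem form_cross_right_comm (M : MetricCliffordModule V S₀ S₁) (X Y Z : Herm V S₀ S₁) :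
    M.form (M.cross X Y) Z = M.form (M.cross X Z) Y := by
  obtain ⟨x₁, x₂, x₃, v, s, t⟩ := X
  obtain ⟨y₁, y₂, y₃, v', s', t'⟩ := Y
  obtain ⟨z₁, z₂, z₃, w, a, b⟩ := Z
  simp only [cross, form_apply, inner_add_left, inner_sub_left, real_inner_smul_left, inner_vec,
    inner_adj]
  rw [real_inner_comm v' w, real_inner_comm s' a, real_inner_comm t' b]
  ring

theorem cross_self (M : MetricCliffordModule V S₀ S₁) (X : Herm V S₀ S₁) :
    M.cross X X = (2 : ℝ) • M.adjoint X := by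
  have h := M.adjoint_add X X
  rw [← two_smul ℝ X, M.adjoint_smul] at h
  linear_combination (norm := module) -h

theorem form_cross_self (M : MetricCliffordModule V S₀ S₁) (X U : Herm V S₀ S₁) :
    M.form (M.cross X U) U = 2 * M.form (M.adjoint U) X := by
  rw [cross_comm, form_cross_right_comm, cross_self, form_smul_left]

theorem adjoint_fst_pos_of_mem_cone (M : MetricCliffordModule V S₀ S₁) {X : Herm V S₀ S₁}
    (hX : X ∈ M.cone) : 0 < (M.adjoint X).1 := by
  obtain ⟨x₁, x₂, x₃, v, s, t⟩ := X
  exact ((M.mem_cone_iff ..).1 hX).2.1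

/-- If Z × Y = 0, then pairing with Z and with Y gives ⟪Z#, Y⟫ = 0 and ⟪Y#, Z⟫ = 0, which
contradicts the strict inequality of `LogConcaveAt` unless Z = 0. -/
theorem eq_zero_of_cross_eq_zero (M : MetricCliffordModule V S₀ S₁) {Y Z : Herm V S₀ S₁}
    (hY : Y ∈ M.cone) (h : M.cross Z Y = 0) : Z = 0 := by
  by_contra hZ
  have h1 := M.logConcaveAt_of_mem_cone hY Z hZ
  have zero (X : Herm V S₀ S₁) : M.form 0 X = 0 := by simpa using M.form_smul_left 0 0 X
  have h2 := M.form_cross_self Y Z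
  have h3 := M.form_cross_right_comm Y Y Z
  rw [M.cross_comm, h, zero] at h2
  rw [M.cross_self, M.form_smul_left, M.cross_comm, h, zero] at h3
  have h4 : M.form (M.adjoint Z) Y = 0 := by linarith
  have h5 : M.form (M.adjoint Y) Z = 0 := by linarith
  rw [h4, h5] at h1
  linarith

/-- The solution of the real form of the attractor equations. -/
theorem attractor (M : MetricCliffordModule V S₀ S₁) {Ξ Y A : Herm V S₀ S₁} (hY : Y ∈ M.cone)
    {k p₀ J Wr Wi : ℝ} (hk : 0 < k) (hp : p₀ ≠ 0)
    (hre : ∀ H, -p₀ * k * M.form (M.adjoint Ξ) H + 3 / p₀ * M.form A H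
      + p₀ * k * M.form (M.adjoint Y) H - Wi / (2 * M.dV Y) * M.form (M.adjoint Y) H = 0)
    (him : ∀ H, -p₀ * k * M.form (M.cross Ξ Y) H
      + Wr / (2 * M.dV Y) * M.form (M.adjoint Y) H = 0)
    (hWr : Wr = -p₀ * (k * M.dV Ξ - k * M.form (M.adjoint Y) Ξ) + 3 / p₀ * M.form A Ξ - J / p₀ ^ 2)
    (hWi : Wi = -p₀ * (k * M.form (M.adjoint Ξ) Y - k * M.dV Y) + 3 / p₀ * M.form A Y) :
    ∃ c : ℝ, A = (p₀ ^ 2 * k / 3 * (1 + c ^ 2)) • M.adjoint Y ∧ Wr = 4 * p₀ * k * M.dV Y * c ∧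
      Wi = 4 * p₀ * k * M.dV Y ∧ J = 2 * p₀ ^ 3 * k * M.dV Y * c * (1 + c ^ 2) := by
  have hδ := M.dV_pos_of_mem_cone hY
  have hδ' := hδ.ne'
  have hk' := hk.ne'
  set δ := M.dV Y with hδdef
  -- This normalization makes the imaginary equation (Ξ - cY) × Y = 0, because Y × Y = 2 Y#.
  obtain ⟨c, hWr'⟩ : ∃ c, Wr = 4 * p₀ * k * δ * c :=
    ⟨Wr / (4 * p₀ * k * δ), by field_simp⟩
  have hΞ : Ξ = c • Y := by
    have h1 : M.cross (Ξ + (-c) • Y) Y = 0 := by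
      refine M.eq_of_forall_form_eq fun H => ?_
      have h2 := him H
      have zero : M.form 0 H = 0 := by simpa using M.form_smul_left 0 0 H
      rw [zero, M.cross_add_left, M.cross_smul_left, M.cross_self, M.form_add_left,
        M.form_smul_left, M.form_smul_left]
      rw [hWr'] at h2
      have h3 : p₀ * k * (M.form (M.cross Ξ Y) H + -c * (2 * M.form (M.adjoint Y) H)) = 0 := by
        field_simp at h2
        linear_combination (-1 / 2) * h2
      exact (mul_eq_zero.1 h3).resolve_left (mul_ne_zero hp hk')
    have h2 := M.eq_zero_of_cross_eq_zero hY h1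
    linear_combination (norm := module) h2
  set l := p₀ / 3 * (p₀ * k * (c ^ 2 - 1) + Wi / (2 * δ)) with hl
  have hA : A = l • M.adjoint Y := by
    refine M.eq_of_forall_form_eq fun H => ?_
    have h1 := hre H
    rw [hΞ, M.adjoint_smul, M.form_smul_left] at h1
    rw [M.form_smul_left, hl]
    field_simp at h1 ⊢
    linear_combination h1
  have hYY := M.form_adjoint_self Y
  rw [← hδdef] at hYY
  rw [hΞ, M.adjoint_smul, M.form_smul_left, hA, M.form_smul_left, hYY] at hWi
  -- Substituting Ξ = cY and A = l Y# into the definition of `Wi` leaves a linear equation in `Wi`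
  -- from which `c` drops out.
  have hWi' : Wi = 4 * p₀ * k * δ := by
    rw [hl] at hWi
    field_simp at hWi
    linear_combination -hWi
  have hl' : l = p₀ ^ 2 * k / 3 * (1 + c ^ 2) := by
    rw [hl, hWi']
    field_simp
    ring
  refine ⟨c, by rw [hA, hl'], hWr', hWi', ?_⟩
  rw [hΞ, M.dV_smul, M.form_smul_right, hA, M.form_smul_left, M.form_smul_right, hYY, hl', hWr',
    ← hδdef] at hWr
  field_simp at hWr
  linear_combination hWr

end MetricCliffordModule

/-! ### Complex values of polynomials from real lines -/

/-- The value at x + iy is obtained by putting t = i in the restriction to the real line x + ty.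
Thus complex values follow from real expansions, and the Clifford module need not be complexified.
-/
theorem aeval_add_mul_I (P : MvPolynomial ι ℝ) (x y : ι → ℝ) (c₀ c₁ c₂ c₃ : ℝ)
    (h : ∀ t : ℝ, MvPolynomial.eval (x + t • y) P = c₀ + c₁ * t + c₂ * t ^ 2 + c₃ * t ^ 3) :
    MvPolynomial.aeval (fun a => (x a + y a * Complex.I : ℂ)) P
      = ((c₀ - c₂ : ℝ) : ℂ) + ((c₁ - c₃ : ℝ) : ℂ) * Complex.I := by
  set g : ι → Polynomial ℝ := fun a => .C (x a) + .C (y a) * .X with hg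
  -- Two real polynomials in t with equal values at all real t coincide, so they may be evaluated at
  -- i.
  have h1 : MvPolynomial.aeval g P
      = .C c₀ + .C c₁ * .X + .C c₂ * .X ^ 2 + .C c₃ * .X ^ 3 := by
    refine Polynomial.funext fun t => ?_
    have h2 := h t
    rw [← Polynomial.coe_aeval_eq_eval, ← AlgHom.comp_apply,
      MvPolynomial.comp_aeval]
    rw [← MvPolynomial.aeval_eq_eval] at h2
    have e : (fun a => Polynomial.aeval t (g a)) = x + t • y := by
      ext a
      simp only [hg, map_add, map_mul, Polynomial.aeval_C, Polynomial.aeval_X, Algebra.algebraMap_self,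
        RingHom.id_apply, Pi.add_apply, Pi.smul_apply, smul_eq_mul, mul_comm]
    rw [e, h2]
    simp
  have h2 := congrArg (Polynomial.aeval Complex.I) h1
  rw [← AlgHom.comp_apply, MvPolynomial.comp_aeval] at h2
  have e : (fun a => Polynomial.aeval Complex.I (g a)) = fun a => (x a + y a * Complex.I : ℂ) := by
    ext a
    simp only [hg, map_add, map_mul, Polynomial.aeval_C, Polynomial.aeval_X,
      Complex.coe_algebraMap]
  rw [e] at h2
  rw [h2]
  simp only [map_add, map_mul, map_pow, Polynomial.aeval_C, Polynomial.aeval_X,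
    Complex.coe_algebraMap, Complex.I_sq, Complex.I_pow_three]
  push_cast
  ring

variable (M : MetricCliffordModule V S₀ S₁) (φ : (ι → ℝ) ≃ₗ[ℝ] Herm V S₀ S₁)
  (k : ℝ) (d : MvPolynomial ι ℝ)

theorem sum_mul_eval_pderiv_pderiv (hd : ∀ x, MvPolynomial.eval x d = k * M.dV (φ x))
    (y u : ι → ℝ) :
    ∑ a, ∑ b, u a * u b * MvPolynomial.eval y (MvPolynomial.pderiv a (MvPolynomial.pderiv b d))
      = 2 * k * M.form (M.adjoint (φ u)) (φ y) := by
  have h1 : HasDerivAt (fun t : ℝ => ∑ b, u b * MvPolynomial.eval (y + t • u)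
      (MvPolynomial.pderiv b d)) (∑ b, u b * ∑ a, u a * MvPolynomial.eval (y + (0 : ℝ) • u)
        (MvPolynomial.pderiv a (MvPolynomial.pderiv b d))) 0 :=
    HasDerivAt.fun_sum fun b _ => (hasDerivAt_eval_line _ y u 0).const_mul _
  have e : (fun t : ℝ => ∑ b, u b * MvPolynomial.eval (y + t • u) (MvPolynomial.pderiv b d))
      = fun t => k * (M.form (M.adjoint (φ y)) (φ u) + t * (2 * M.form (M.adjoint (φ u)) (φ y))
        + t ^ 2 * M.form (M.adjoint (φ u)) (φ u)) := by
    ext t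
    rw [sum_mul_eval_pderiv M φ k d hd, map_add, map_smul, M.adjoint_add, M.adjoint_smul,
      M.cross_smul_right, M.form_add_left, M.form_add_left, M.form_smul_left, M.form_smul_left,
      M.form_cross_self]
  have h2 : HasDerivAt (fun t : ℝ => k * (M.form (M.adjoint (φ y)) (φ u)
      + t * (2 * M.form (M.adjoint (φ u)) (φ y)) + t ^ 2 * M.form (M.adjoint (φ u)) (φ u)))
      (k * (0 + 1 * (2 * M.form (M.adjoint (φ u)) (φ y))
        + (2 * (0 : ℝ) ^ 1 * 1) * M.form (M.adjoint (φ u)) (φ u))) 0 :=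
    ((((hasDerivAt_const _ _).add ((hasDerivAt_id _).mul_const _)).add
      (((hasDerivAt_id _).pow 2).mul_const _))).const_mul k
  rw [e, zero_smul, add_zero] at h1
  have h3 := h1.unique h2
  rw [Finset.sum_comm]
  simp only [Finset.mul_sum] at h3
  linear_combination (norm := skip) h3
  have e2 : ∑ b, ∑ a, u a * u b * MvPolynomial.eval y (MvPolynomial.pderiv a
      (MvPolynomial.pderiv b d)) = ∑ b, ∑ a, u b * (u a * MvPolynomial.eval y
        (MvPolynomial.pderiv a (MvPolynomial.pderiv b d))) :=
    Finset.sum_congr rfl fun b _ => Finset.sum_congr rfl fun a _ => by ring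
  rw [e2]
  ring

theorem pderiv_comm (P : MvPolynomial ι ℝ) (a b : ι) :
    MvPolynomial.pderiv a (MvPolynomial.pderiv b P)
      = MvPolynomial.pderiv b (MvPolynomial.pderiv a P) := by
  have h : ⁅MvPolynomial.pderiv (R := ℝ) a, MvPolynomial.pderiv (R := ℝ) b⁆ = 0 := by
    refine MvPolynomial.derivation_ext fun i => ?_
    rw [Derivation.commutator_apply]
    simp [MvPolynomial.pderiv_X, Pi.single_apply, apply_ite]
  have h2 := congrArg (fun D => D P) h
  simp only [Derivation.commutator_apply, Derivation.coe_zero, Pi.zero_apply] at h2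
  exact sub_eq_zero.1 h2

/-- The quadratic form of the matrix is (⟪Y#, U⟫² - 2 d(Y) ⟪U#, Y⟫) / (4 d(Y)²) with d = `dV`,
positive by strict log-concavity. -/
theorem posDef_hessMatrix (hk : 0 < k) (hd : ∀ x, MvPolynomial.eval x d = k * M.dV (φ x))
    {y : ι → ℝ} (hy : φ y ∈ M.cone) : (hessMatrix d y).PosDef := by
  have hδ := M.dV_pos_of_mem_cone hy
  refine .of_dotProduct_mulVec_pos ?_ fun u hu => ?_
  · ext a b
    simp only [Matrix.conjTranspose_apply, hessMatrix, Matrix.of_apply, star_trivial,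
      pderiv_comm d b a]
    ring
  · have hφu : φ u ≠ 0 := fun h => hu (φ.map_eq_zero_iff.1 h)
    have h1 := M.logConcaveAt_of_mem_cone hy (φ u) hφu
    have h2 := sum_mul_eval_pderiv M φ k d hd y u
    have h3 := sum_mul_eval_pderiv_pderiv M φ k d hd y u
    have e : star u ⬝ᵥ (hessMatrix d y).mulVec u = (1 / 4) *
        ((∑ a, u a * MvPolynomial.eval y (MvPolynomial.pderiv a d)) ^ 2
          / MvPolynomial.eval y d ^ 2 - (∑ a, ∑ b, u a * u b * MvPolynomial.eval y
          (MvPolynomial.pderiv a (MvPolynomial.pderiv b d))) / MvPolynomial.eval y d) := by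
      rw [sq, Finset.sum_mul_sum, Finset.sum_div, Finset.sum_div, ← Finset.sum_sub_distrib,
        Finset.mul_sum]
      simp only [dotProduct, Matrix.mulVec, Finset.mul_sum, Pi.star_apply, star_trivial]
      refine Finset.sum_congr rfl fun a _ => ?_
      rw [Finset.sum_div, Finset.sum_div, ← Finset.sum_sub_distrib, Finset.mul_sum]
      refine Finset.sum_congr rfl fun b _ => ?_
      simp only [hessMatrix, Matrix.of_apply, logGrad]
      ring
    rw [e, h2, h3, hd]
    have e2 : (1 / 4 : ℝ) * ((k * M.form (M.adjoint (φ y)) (φ u)) ^ 2 / (k * M.dV (φ y)) ^ 2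
        - 2 * k * M.form (M.adjoint (φ u)) (φ y) / (k * M.dV (φ y)))
        = (M.form (M.adjoint (φ y)) (φ u) ^ 2
          - 2 * M.dV (φ y) * M.form (M.adjoint (φ u)) (φ y)) / (4 * M.dV (φ y) ^ 2) := by
      field_simp
    rw [e2]
    have := sub_pos.2 h1
    positivity

/-! ### The superpotential around `p / p⁰` -/

/-- The shift by p/p⁰ depresses the cubic: -p⁰ d and p^a ∂_a d contribute opposite terms quadratic
in v. The linear coefficient is 3α/p⁰, and this is how α and J enter the problem. -/
theorem eval_superpotential (hd : ∀ x, MvPolynomial.eval x d = k * M.dV (φ x))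
    (p q : Option ι → ℝ) (hp : p none ≠ 0) (v : ι → ℝ) :
    MvPolynomial.eval ((p none)⁻¹ • (fun a => p (some a)) + v) (superpotential d p q)
      = -p none * (k * M.dV (φ v)) + 3 / p none * M.form (sharpCoord φ (alpha d p q)) (φ v)
        - chargeJ d p q / p none ^ 2 := by
  set p' : ι → ℝ := fun a => p (some a) with hp'
  have h1 := sum_mul_eval_pderiv M φ k d hd ((p none)⁻¹ • p' + v) p'
  have h2 : MvPolynomial.eval ((p none)⁻¹ • p' + v) (superpotential d p q)
      = -p none * (k * M.dV (φ ((p none)⁻¹ • p' + v)))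
        + k * M.form (M.adjoint (φ ((p none)⁻¹ • p' + v))) (φ p') - q none
        - ((p none)⁻¹ * pairing q p + ∑ a, q (some a) * v a) := by
    rw [← h1, ← hd]
    simp only [superpotential, map_add, map_sub, map_mul, map_neg, map_sum, MvPolynomial.eval_C,
      MvPolynomial.eval_X, pairing, Finset.mul_sum, Pi.add_apply, Pi.smul_apply, smul_eq_mul,
      mul_add, Finset.sum_add_distrib, hp']
    congr 3
    ext a
    ring
  have h3 : M.form (sharpCoord φ (alpha d p q)) (φ v) = k / 3 * M.form (M.adjoint (φ p')) (φ v)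
      + -(1 / 3) * p none * ∑ a, q (some a) * v a := by
    rw [sharpCoord_alpha M φ k d hd, M.form_add_left, M.form_smul_left, M.form_smul_left,
      form_sharpCoord, LinearEquiv.symm_apply_apply]
  have h4 : M.dV (φ ((p none)⁻¹ • p' + v)) = (p none)⁻¹ ^ 3 * M.dV (φ p')
      + (p none)⁻¹ ^ 2 * M.form (M.adjoint (φ p')) (φ v)
      + (p none)⁻¹ * M.form (M.adjoint (φ v)) (φ p') + M.dV (φ v) := by
    have := M.dV_add_smul ((p none)⁻¹ • φ p') (φ v) 1
    rw [M.dV_smul, M.adjoint_smul, M.form_smul_left, M.form_smul_right] at this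
    rw [map_add, map_smul, ← one_smul ℝ (φ v), this]
    simp
  have h5 : M.form (M.adjoint (φ ((p none)⁻¹ • p' + v))) (φ p')
      = (p none)⁻¹ ^ 2 * (3 * M.dV (φ p')) + (p none)⁻¹ * (2 * M.form (M.adjoint (φ p')) (φ v))
        + M.form (M.adjoint (φ v)) (φ p') := by
    rw [map_add, map_smul, M.adjoint_add, M.adjoint_smul, M.cross_smul_left, M.form_add_left,
      M.form_add_left, M.form_smul_left, M.form_smul_left, M.form_adjoint_self,
      M.form_cross_right_comm, M.cross_self, M.form_smul_left]
  rw [h2, h3, h4, h5, chargeJ, hd]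
  field_simp
  ring

theorem sum_eval_pderiv_superpotential (hd : ∀ x, MvPolynomial.eval x d = k * M.dV (φ x))
    (p q : Option ι → ℝ) (hp : p none ≠ 0) (v η : ι → ℝ) :
    ∑ a, η a * MvPolynomial.eval ((p none)⁻¹ • (fun a => p (some a)) + v)
        (MvPolynomial.pderiv a (superpotential d p q))
      = -p none * k * M.form (M.adjoint (φ v)) (φ η)
        + 3 / p none * M.form (sharpCoord φ (alpha d p q)) (φ η) := by
  set A := sharpCoord φ (alpha d p q)
  have h1 := hasDerivAt_eval_line (superpotential d p q)
    ((p none)⁻¹ • (fun a => p (some a)) + v) η 0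
  have e : (fun t : ℝ => MvPolynomial.eval ((p none)⁻¹ • (fun a => p (some a)) + v + t • η)
      (superpotential d p q)) = fun t => -p none * (k * (M.dV (φ v)
        + t * M.form (M.adjoint (φ v)) (φ η) + t ^ 2 * M.form (M.adjoint (φ η)) (φ v)
        + t ^ 3 * M.dV (φ η))) + 3 / p none * (M.form A (φ v) + t * M.form A (φ η))
        - chargeJ d p q / p none ^ 2 := by
    ext t
    rw [add_assoc, eval_superpotential M φ k d hd p q hp, map_add, map_smul, M.dV_add_smul,
      M.form_add_right, M.form_smul_right]
  have h2 : HasDerivAt (fun t : ℝ => -p none * (k * (M.dV (φ v)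
        + t * M.form (M.adjoint (φ v)) (φ η) + t ^ 2 * M.form (M.adjoint (φ η)) (φ v)
        + t ^ 3 * M.dV (φ η))) + 3 / p none * (M.form A (φ v) + t * M.form A (φ η))
        - chargeJ d p q / p none ^ 2)
      (-p none * (k * (0 + 1 * M.form (M.adjoint (φ v)) (φ η)
        + (2 * (0 : ℝ) ^ 1 * 1) * M.form (M.adjoint (φ η)) (φ v)
        + (3 * (0 : ℝ) ^ 2 * 1) * M.dV (φ η))) + 3 / p none * (0 + 1 * M.form A (φ η))) 0 :=
    (((((((hasDerivAt_const _ _).add ((hasDerivAt_id _).mul_const _)).add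
      (((hasDerivAt_id _).pow 2).mul_const _)).add
      (((hasDerivAt_id _).pow 3).mul_const _)).const_mul k).const_mul _).add
      (((hasDerivAt_const _ _).add ((hasDerivAt_id _).mul_const _)).const_mul _)).sub_const _
  rw [e, zero_smul, add_zero] at h1
  rw [h1.unique h2]
  ring

theorem exp_kahler {z : ι → ℂ} (hz : 0 < MvPolynomial.eval (imL z) d) :
    Real.exp (kahler d z) = (8 * MvPolynomial.eval (imL z) d)⁻¹ := by
  have e : kahler d z = -Real.log (8 * MvPolynomial.eval (imL z) d) := rfl
  rw [e, Real.exp_neg, Real.exp_log (by positivity)]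

/-- The attractor equations `Z_a = 0` determine the charges and the central charge. -/
theorem exists_of_covCharge_eq_zero (hk : 0 < k)
    (hd : ∀ x, MvPolynomial.eval x d = k * M.dV (φ x)) {p q : Option ι → ℝ} (hp : p none ≠ 0)
    {z : ι → ℂ} (hz : φ (imL z) ∈ M.cone) (hcov : ∀ a, covCharge d p q z a = 0) :
    ∃ c : ℝ, sharpCoord φ (alpha d p q)
        = (p none ^ 2 * k / 3 * (1 + c ^ 2)) • M.adjoint (φ (imL z)) ∧
      chargeJ d p q = 2 * p none ^ 3 * k * M.dV (φ (imL z)) * c * (1 + c ^ 2) ∧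
      ‖centralCharge d p q z‖ ^ 2 = 2 * p none ^ 2 * k * M.dV (φ (imL z)) * (1 + c ^ 2) := by
  have hδ := M.dV_pos_of_mem_cone hz
  have hδ' := hδ.ne'
  have hk' := hk.ne'
  have hpos : 0 < MvPolynomial.eval (imL z) d := by
    rw [hd]
    positivity
  set y := imL z with hy
  set x₀ : ι → ℝ := (p none)⁻¹ • fun a => p (some a) with hx₀
  set ξ : ι → ℝ := (fun a => (z a).re) - x₀ with hξ
  -- The point is written as p/p⁰ + ξ + iy, the centre at which the superpotential has its depressed
  -- form.
  have hzxy : z = fun a => (((x₀ + ξ) a : ℝ) + (y a : ℝ) * Complex.I : ℂ) := by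
    ext a
    simp only [hξ, add_sub_cancel, hy, imL_apply]
    exact (Complex.re_add_im _).symm
  set A := sharpCoord φ (alpha d p q)
  set J := chargeJ d p q
  set Wr := -p none * (k * M.dV (φ ξ) - k * M.form (M.adjoint (φ y)) (φ ξ))
    + 3 / p none * M.form A (φ ξ) - J / p none ^ 2 with hWr
  set Wi := -p none * (k * M.form (M.adjoint (φ ξ)) (φ y) - k * M.dV (φ y))
    + 3 / p none * M.form A (φ y) with hWi
  have hW : MvPolynomial.aeval z (superpotential d p q) = (Wr : ℂ) + Wi * Complex.I := by
    rw [hzxy, aeval_add_mul_I _ (x₀ + ξ) y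
      (-p none * (k * M.dV (φ ξ)) + 3 / p none * M.form A (φ ξ) - J / p none ^ 2)
      (-p none * (k * M.form (M.adjoint (φ ξ)) (φ y)) + 3 / p none * M.form A (φ y))
      (-p none * (k * M.form (M.adjoint (φ y)) (φ ξ))) (-p none * (k * M.dV (φ y)))]
    · rw [hWr, hWi]
      push_cast
      ring
    · intro t
      rw [add_assoc, hx₀, eval_superpotential M φ k d hd p q hp, map_add, map_smul, M.dV_add_smul,
        M.form_add_right, M.form_smul_right]
      ring
  have hdW (η : ι → ℝ) : ∑ a, (η a : ℂ) * MvPolynomial.aeval z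
      (MvPolynomial.pderiv a (superpotential d p q))
      = ((-p none * k * M.form (M.adjoint (φ ξ)) (φ η) + 3 / p none * M.form A (φ η)
        + p none * k * M.form (M.adjoint (φ y)) (φ η) : ℝ) : ℂ)
        + ((-p none * k * M.form (M.cross (φ ξ) (φ y)) (φ η) : ℝ) : ℂ) * Complex.I := by
    have e : ∑ a, (η a : ℂ) * MvPolynomial.aeval z
        (MvPolynomial.pderiv a (superpotential d p q))
        = MvPolynomial.aeval z (∑ a, MvPolynomial.C (η a) *
          MvPolynomial.pderiv a (superpotential d p q)) := by
      simp
    rw [e, hzxy, aeval_add_mul_I _ (x₀ + ξ) y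
      (-p none * k * M.form (M.adjoint (φ ξ)) (φ η) + 3 / p none * M.form A (φ η))
      (-p none * k * M.form (M.cross (φ ξ) (φ y)) (φ η))
      (-p none * k * M.form (M.adjoint (φ y)) (φ η)) 0]
    · push_cast
      ring
    · intro t
      have h1 := sum_eval_pderiv_superpotential M φ k d hd p q hp (ξ + t • y) η
      simp only [map_sum, map_mul, MvPolynomial.eval_C]
      rw [add_assoc, hx₀, h1, map_add, map_smul, M.adjoint_add, M.adjoint_smul, M.cross_smul_right,
        M.form_add_left, M.form_add_left, M.form_smul_left, M.form_smul_left]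
      ring
  have hE : (Real.exp (kahler d z / 2) : ℂ) ≠ 0 := Complex.ofReal_ne_zero.2 (Real.exp_ne_zero _)
  have heq (a : ι) : MvPolynomial.aeval z (MvPolynomial.pderiv a (superpotential d p q))
      + Complex.I / 2 * logGrad d y a * MvPolynomial.aeval z (superpotential d p q) = 0 := by
    have := hcov a
    rw [covCharge_eq d p q hpos] at this
    exact (mul_eq_zero.1 this).resolve_left hE
  have hlog (η : ι → ℝ) : ∑ a, (η a : ℂ) * logGrad d y a
      = ((M.form (M.adjoint (φ y)) (φ η) / M.dV (φ y) : ℝ) : ℂ) := by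
    have h1 := sum_mul_eval_pderiv M φ k d hd y η
    have h2 : ∑ a, η a * logGrad d y a = M.form (M.adjoint (φ y)) (φ η) / M.dV (φ y) := by
      simp only [logGrad, ← mul_div_assoc]
      rw [← Finset.sum_div, h1, hd]
      field_simp
    rw [← h2]
    push_cast
    rfl
  -- The equations Z_a = 0 contracted with a real vector η; their real and imaginary parts are the
  -- inputs of `attractor`.
  have hsum (η : ι → ℝ) :
      ((-p none * k * M.form (M.adjoint (φ ξ)) (φ η) + 3 / p none * M.form A (φ η)
        + p none * k * M.form (M.adjoint (φ y)) (φ η) : ℝ) : ℂ)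
        + ((-p none * k * M.form (M.cross (φ ξ) (φ y)) (φ η) : ℝ) : ℂ) * Complex.I
        + Complex.I / 2 * ((M.form (M.adjoint (φ y)) (φ η) / M.dV (φ y) : ℝ) : ℂ)
          * ((Wr : ℂ) + Wi * Complex.I) = 0 := by
    rw [← hdW, ← hlog, ← hW, Finset.mul_sum, Finset.sum_mul, ← Finset.sum_add_distrib]
    refine Finset.sum_eq_zero fun a _ => ?_
    linear_combination (η a : ℂ) * heq a
  obtain ⟨c, hA, hr, hi, hJ⟩ := M.attractor (Ξ := φ ξ) hz hk hp (A := A) (J := J) (Wr := Wr)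
    (Wi := Wi) (fun H => by
      obtain ⟨η, rfl⟩ := φ.surjective H
      have := congrArg Complex.re (hsum η)
      simp only [Complex.add_re, Complex.mul_re, Complex.mul_im, Complex.add_im, Complex.ofReal_re,
        Complex.ofReal_im, Complex.I_re, Complex.I_im, Complex.div_ofNat_re, Complex.div_ofNat_im,
        Complex.zero_re] at this
      rw [← this]
      field_simp
      ring) (fun H => by
      obtain ⟨η, rfl⟩ := φ.surjective H
      have := congrArg Complex.im (hsum η)
      simp only [Complex.add_re, Complex.mul_re, Complex.mul_im, Complex.add_im, Complex.ofReal_re,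
        Complex.ofReal_im, Complex.I_re, Complex.I_im, Complex.div_ofNat_re, Complex.div_ofNat_im,
        Complex.zero_im] at this
      rw [← this]
      field_simp
      ring) hWr hWi
  refine ⟨c, hA, hJ, ?_⟩
  have hn : ‖(Wr : ℂ) + Wi * Complex.I‖ ^ 2 = Wr ^ 2 + Wi ^ 2 := by
    rw [← Complex.normSq_eq_norm_sq, Complex.normSq_add_mul_I]
  rw [centralCharge_eq, hW, norm_mul, mul_pow, hn, Complex.norm_real, Real.norm_eq_abs, sq_abs,
    ← Real.exp_nat_mul]
  have e : ((2 : ℕ) : ℝ) * (kahler d z / 2) = kahler d z := by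
    push_cast
    ring
  rw [e, exp_kahler d hpos, hr, hi, ← hy, hd]
  field_simp
  ring

/-- With Y the matrix of Im z_o, δ = `dV` of Y and P = (p⁰)² k δ, the attractor values are (d' +
𝔡')(α) = (p⁰)² P² (1 + c²)³ and J² = 4 (p⁰)² P² c² (1 + c²)². In 4 (d' + 𝔡') - J² the factor (1 +
c²) - c² = 1 appears, so that I₄ = (2P(1 + c²))² = |Z_o|⁴. -/
theorem entropy_formula (hk : 0 < k) (hd : ∀ x, MvPolynomial.eval x d = k * M.dV (φ x))
    (B : ExtremalBlackHole d (φ ⁻¹' M.cone)) (hB : B.IsBPS) (hp : B.p none ≠ 0) :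
    0 < (sharpCoord φ (alpha d B.p B.q)).1 ∧
      0 < dDual M φ k (alpha d B.p B.q) + frakdDual M φ k (alpha d B.p B.q) ∧
      ∃ I : ℝ, 0 < I ∧ I₄ M φ k d B.p B.q = (I : ℂ) ∧ B.entropy = Real.pi * √I := by
  have hz : φ (imL B.zHor) ∈ M.cone := B.zHor_mem
  have hδ := M.dV_pos_of_mem_cone hz
  have hΔ := M.adjoint_fst_pos_of_mem_cone hz
  have hpos : 0 < MvPolynomial.eval (imL B.zHor) d := by
    rw [hd]
    positivity
  have hH := posDef_hessMatrix M φ k d hk hd hz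
  have hV := B.potentialBH_zHor (continuousAt_potentialBH d B.p B.q hpos hH.det_pos.ne')
  have hm : B.radius = ‖centralCharge d B.p B.q B.zHor‖ := hB
  obtain ⟨c, hA, hJ, hZ⟩ := exists_of_covCharge_eq_zero M φ k d hk hd hp hz
    (covCharge_eq_zero_of_potentialBH_eq d B.p B.q hpos hH (by rw [hV, hm]))
  set δ := M.dV (φ (imL B.zHor))
  set p₀ := B.p none
  have hp2 : 0 < p₀ ^ 2 := by positivity
  have hl : 0 < p₀ ^ 2 * k / 3 * (1 + c ^ 2) := by positivity
  have hα : 0 < (sharpCoord φ (alpha d B.p B.q)).1 := by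
    rw [hA, Prod.smul_fst, smul_eq_mul]
    positivity
  -- Both parts are homogeneous of degree 3 and α is a multiple of Y#, where (d + 𝔡)(Y#) = d(Y)² for
  -- d = `dV`.
  have hdd : dDual M φ k (alpha d B.p B.q) + frakdDual M φ k (alpha d B.p B.q)
      = p₀ ^ 6 * k ^ 2 * (1 + c ^ 2) ^ 3 * δ ^ 2 := by
    rw [dDual, frakdDual, ← mul_add, hA, M.dV_smul, frakdV_smul, ← mul_add,
      M.dV_add_frakdV_adjoint _ hΔ.ne']
    field_simp
    ring
  refine ⟨hα, by rw [hdd]; positivity, (2 * p₀ ^ 2 * k * δ * (1 + c ^ 2)) ^ 2, by positivity, ?_, ?_⟩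
  · rw [I₄_eq M φ k d (sum_mul_gradThird_frakdDual M φ k _ hα.ne'), hdd, hJ]
    rw [show B.p none = p₀ from rfl]
    congr 1
    field_simp
    ring
  · rw [Real.sqrt_sq (by positivity), ← hZ, ← hm, ExtremalBlackHole.entropy,
      ExtremalBlackHole.horizonArea]
    ring

end Attractor

end EntropyFormula

end

/-! ### Assembly of the three assertions -/

theorem mainTheorem7 {V S₀ S₁ : Type*}
    [NormedAddCommGroup V] [InnerProductSpace ℝ V] [FiniteDimensional ℝ V]
    [NormedAddCommGroup S₀] [InnerProductSpace ℝ S₀] [FiniteDimensional ℝ S₀]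
    [NormedAddCommGroup S₁] [InnerProductSpace ℝ S₁] [FiniteDimensional ℝ S₁]
    {ι : Type*} [Fintype ι] [DecidableEq ι]
    (M : EntropyFormula.MetricCliffordModule V S₀ S₁)
    (φ : (ι → ℝ) ≃ₗ[ℝ] EntropyFormula.Herm V S₀ S₁)
    (k : ℝ) (hk : 0 < k)
    (d : MvPolynomial ι ℝ) (hd : ∀ x, MvPolynomial.eval x d = k * M.dV (φ x))
    (hirr : Irreducible d) :
    -- the entropy formula
    (∀ B : EntropyFormula.ExtremalBlackHole d (φ ⁻¹' M.cone), B.IsBPS → B.p none ≠ 0 →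
      0 < (EntropyFormula.sharpCoord φ (EntropyFormula.alpha d B.p B.q)).1 ∧
      0 < EntropyFormula.dDual M φ k (EntropyFormula.alpha d B.p B.q)
        + EntropyFormula.frakdDual M φ k (EntropyFormula.alpha d B.p B.q) ∧
      ∃ I : ℝ, 0 < I ∧ EntropyFormula.I₄ M φ k d B.p B.q = (I : ℂ) ∧
        B.entropy = Real.pi * √I) ∧
    -- `I₄` is a homogeneous rational function of degree 4
    (∃ (m : ℕ) (N D : MvPolynomial (Option ι ⊕ Option ι) ℝ),
      N.IsHomogeneous (m + 4) ∧ D.IsHomogeneous m ∧ D ≠ 0 ∧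
      ∀ p q : Option ι → ℝ, p none ≠ 0 →
        (EntropyFormula.sharpCoord φ (EntropyFormula.alpha d p q)).1 ≠ 0 →
        MvPolynomial.eval (Sum.elim p q) D ≠ 0 ∧
        EntropyFormula.I₄ M φ k d p q =
          ((MvPolynomial.eval (Sum.elim p q) N / MvPolynomial.eval (Sum.elim p q) D : ℝ) : ℂ)) ∧
    -- the symmetric case
    (M.IsSelfAdjoint →
      (∀ w, EntropyFormula.frakdDual M φ k w = 0) ∧
      ∀ p q : Option ι → ℝ, p none ≠ 0 →
        EntropyFormula.I₄ M φ k d p q = (EntropyFormula.quartic M φ k d p q : ℂ)) := by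
  refine ⟨fun B hB hp => EntropyFormula.entropy_formula M φ k d hk hd B hB hp,
    EntropyFormula.exists_rational_I₄ M φ k d hd, fun h => ?_⟩
  have hM := fun s t => h.defect_eq_zero s t
  exact ⟨EntropyFormula.frakdDual_eq_zero M φ k hM, fun p q hp =>
    EntropyFormula.I₄_eq_quartic M φ k d hk.ne' hd hM p q hp⟩
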